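/- Let $R$ be a noetherian ring and let $X \to \operatorname{Spec} R$ be a projective scheme on which a finite group $G$ acts from the left by automorphisms over $R$. Let $\mathcal{L}$ be a $G$-equivariant ample line bundle on $X$. Let $x_1,\dots,x_m \colon \operatorname{Spec} R \to X$ be finitely many pairwise disjoint $R$-points, let $i \colon Z := \coprod_j x_j \hookrightarrow X$ be the resulting closed embedding, with ideal sheaf $\mathcal{I}$, and suppose that $Z$ is $G$-stable. Let $\widehat{\mathcal{O}}_Z := \varprojlim_n \mathcal{O}_X/\mathcal{I}^n$ be the completion of $\mathcal{O}_X$ along $Z$; for a coherent sheaf $\mathcal{M}$ on $X$, $\mathcal{M} \otimes \widehat{\mathcal{O}}_Z$ denotes the completion $\varprojlim_n \mathcal{M}/\mathcal{I}^n\mathcal{M}$. If $\mathcal{M}$ is $G$-equivariant, with pullback maps of sections $g^* \colon \mathcal{M}(U) \to \mathcal{M}(g^{-1}U)$, then $G$ acts $R$-linearly on $H^0(X,\mathcal{M})$, $H^0(Z, i^*\mathcal{M})$ and $H^0(X, \mathcal{M} \otimes \widehat{\mathcal{O}}_Z)$ by $g \cdot s = (g^{-1})^* s$. For a character $\psi \colon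 G \to R^*$ and an $R$-module $M$ with $R$-linear $G$-action put $M^\psi = \{ s \in M : g \cdot s = \psi(g)\, s \text{ for all } g \in G\}$. Let $\mathcal{F}$ be a $G$-equivariant coherent sheaf on $X$. Suppose that the reduction maps $$H^0(X, \mathcal{F} \otimes \widehat{\mathcal{O}}_Z) \to H^0(Z, i^*\mathcal{F}) \quad\text{and}\quad H^0(X, \mathcal{L} \otimes \widehat{\mathcal{O}}_Z) \to H^0(Z, i^*\mathcal{L})$$ each admit an $R$-linear $G$-equivariant section. Then there exists $k_0 > 0$ such that for all $k \ge k_0$ and all characters $\psi \colon G \to R^*$ the restriction map $$H^0(X, \mathcal{L}^{\otimes k} \otimes \mathcal{F})^\psi \to H^0(Z, i^*(\mathcal{L}^{\otimes k} \otimes \mathcal{F}))^\psi$$ is surjective. -/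

import Mathlib

open CategoryTheory AlgebraicGeometry Limits

universe u v

noncomputable section

namespace EquivSurj

/-! ### Tensor products of sheaves of modules -/

section Tensor

variable {X Y : Scheme.{u}}

/-- The presheaf `U ↦ M(U) ⊗_{𝒪(U)} N(U)`. -/
def presheafTensor (M N : X.Modules) : X.PresheafOfModules :=
  PresheafOfModules.Monoidal.tensorObj (R := X.presheaf)
    ((Scheme.Modules.toPresheafOfModules X).obj M) ((Scheme.Modules.toPresheafOfModules X).obj N)

/-- The tensor product `M ⊗ N` of sheaves of `𝒪_X`-modules: the sheaf associated with
`U ↦ M(U) ⊗_{𝒪(U)} N(U)`. -/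
def tensor (M N : X.Modules) : X.Modules :=
  (PresheafOfModules.sheafification (𝟙 X.ringCatSheaf.obj)).obj (presheafTensor M N)

/-- The canonical map from the tensor product presheaf to the tensor product. -/
def toTensor (M N : X.Modules) :
    presheafTensor M N ⟶ (Scheme.Modules.toPresheafOfModules X).obj (tensor M N) :=
  PresheafOfModules.sheafificationHomEquiv (𝟙 X.ringCatSheaf.obj) (𝟙 _)

/-- The section `m ⊗ n` of `M ⊗ N` over `U`. -/
def tmul {M N : X.Modules} {U : X.Opens} (m : Γ(M, U)) (n : Γ(N, U)) : Γ(tensor M N, U) :=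
  (toTensor M N).app (.op U) (TensorProduct.tmul Γ(X, U) (M := Γ(M, U)) (N := Γ(N, U)) m n)

section tmulLemmas

variable {M N : X.Modules} {U V : X.Opens}

lemma tmul_add (m : Γ(M, U)) (n n' : Γ(N, U)) : tmul m (n + n') = tmul m n + tmul m n' := by
  unfold tmul
  rw [TensorProduct.tmul_add]
  exact map_add _ _ _

lemma add_tmul (m m' : Γ(M, U)) (n : Γ(N, U)) : tmul (m + m') n = tmul m n + tmul m' n := by
  unfold tmul
  rw [TensorProduct.add_tmul]
  exact map_add _ _ _

lemma smul_tmul (r : Γ(X, U)) (m : Γ(M, U)) (n : Γ(N, U)) : tmul (r • m) n = r • tmul m n := by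
  unfold tmul
  rw [← TensorProduct.smul_tmul']
  exact ((toTensor M N).app (.op U)).hom.map_smul r _

lemma tmul_smul (r : Γ(X, U)) (m : Γ(M, U)) (n : Γ(N, U)) : tmul m (r • n) = r • tmul m n := by
  unfold tmul
  rw [TensorProduct.tmul_smul]
  exact ((toTensor M N).app (.op U)).hom.map_smul r _

lemma map_tmul (j : V ⟶ U) (m : Γ(M, U)) (n : Γ(N, U)) :
    (tensor M N).presheaf.map j.op (tmul m n) =
      tmul (M.presheaf.map j.op m) (N.presheaf.map j.op n) :=
  (PresheafOfModules.naturality_apply (toTensor M N) j.op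
    (TensorProduct.tmul Γ(X, U) (M := Γ(M, U)) (N := Γ(N, U)) m n)).symm

end tmulLemmas

/-- A morphism `h : X ⟶ Y` together with `φ : M ⟶ h_* M'` and `χ : N ⟶ h_* N'` induces
`M ⊗ N ⟶ h_* (M' ⊗ N')`, given on sections by `m ⊗ n ↦ φ(m) ⊗ χ(n)`. -/
def tensorOver (h : X ⟶ Y) {M N : Y.Modules} {M' N' : X.Modules}
    (φ : M ⟶ (Scheme.Modules.pushforward h).obj M')
    (χ : N ⟶ (Scheme.Modules.pushforward h).obj N') :
    tensor M N ⟶ (Scheme.Modules.pushforward h).obj (tensor M' N') :=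
  (PresheafOfModules.sheafificationHomEquiv (𝟙 Y.ringCatSheaf.obj)).symm
    { app := fun U => ModuleCat.MonoidalCategory.tensorLift (R := Y.presheaf.obj U)
        (M₁ := M.val.obj U) (M₂ := N.val.obj U)
        (M₃ := ((Scheme.Modules.pushforward h).obj (tensor M' N')).val.obj U)
        (fun m n => tmul (U := h ⁻¹ᵁ U.unop) (φ.app U.unop m) (χ.app U.unop n))
        (fun m m' n => by
          have e := map_add (φ.app U.unop).hom m m'
          exact (congrArg (fun t => tmul (U := h ⁻¹ᵁ U.unop) t (χ.app U.unop n)) e).trans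
            (add_tmul (U := h ⁻¹ᵁ U.unop) (φ.app U.unop m) (φ.app U.unop m') (χ.app U.unop n)))
        (fun r m n => by
          have e := Scheme.Modules.Hom.app_smul φ (U := U.unop) r m
          exact (congrArg (fun t => tmul (U := h ⁻¹ᵁ U.unop) t (χ.app U.unop n)) e).trans
            (smul_tmul (U := h ⁻¹ᵁ U.unop) (h.app U.unop r) (φ.app U.unop m) (χ.app U.unop n)))
        (fun m n n' => by
          have e := map_add (χ.app U.unop).hom n n'
          exact (congrArg (fun t => tmul (U := h ⁻¹ᵁ U.unop) (φ.app U.unop m) t) e).trans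
            (tmul_add (U := h ⁻¹ᵁ U.unop) (φ.app U.unop m) (χ.app U.unop n) (χ.app U.unop n')))
        (fun r m n => by
          have e := Scheme.Modules.Hom.app_smul χ (U := U.unop) r n
          exact (congrArg (fun t => tmul (U := h ⁻¹ᵁ U.unop) (φ.app U.unop m) t) e).trans
            (tmul_smul (U := h ⁻¹ᵁ U.unop) (h.app U.unop r) (φ.app U.unop m) (χ.app U.unop n)))
      naturality := fun {U V} j => by
        refine ModuleCat.MonoidalCategory.tensor_ext (R := Y.presheaf.obj U) (fun m n => ?_)
        have e1 : φ.app V.unop (M.presheaf.map j m) =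
            M'.presheaf.map ((TopologicalSpace.Opens.map h.base).map j.unop).op (φ.app U.unop m) :=
          ConcreteCategory.congr_hom (φ.mapPresheaf.naturality j) m
        have e2 : χ.app V.unop (N.presheaf.map j n) =
            N'.presheaf.map ((TopologicalSpace.Opens.map h.base).map j.unop).op (χ.app U.unop n) :=
          ConcreteCategory.congr_hom (χ.mapPresheaf.naturality j) n
        refine Eq.trans (b := tmul (U := h ⁻¹ᵁ V.unop) (φ.app V.unop (M.presheaf.map j m))
          (χ.app V.unop (N.presheaf.map j n))) rfl ?_
        rw [e1, e2]
        exact (map_tmul ((TopologicalSpace.Opens.map h.base).map j.unop)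
          (φ.app U.unop m) (χ.app U.unop n)).symm }

lemma tensorOver_tmul (h : X ⟶ Y) {M N : Y.Modules} {M' N' : X.Modules}
    (φ : M ⟶ (Scheme.Modules.pushforward h).obj M')
    (χ : N ⟶ (Scheme.Modules.pushforward h).obj N') {U : Y.Opens} (m : Γ(M, U)) (n : Γ(N, U)) :
    (tensorOver h φ χ).app U (tmul m n) =
      tmul (M := M') (N := N') (U := h ⁻¹ᵁ U) (φ.app U m) (χ.app U n) := by
  have e := fun p => Equiv.apply_symm_apply
    (PresheafOfModules.sheafificationHomEquiv (𝟙 Y.ringCatSheaf.obj)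
      (P := presheafTensor M N) (F := (Scheme.Modules.pushforward h).obj (tensor M' N'))) p
  exact congrArg (fun q => (q.app (.op U)).hom
    (TensorProduct.tmul Γ(Y, U) (M := Γ(M, U)) (N := Γ(N, U)) m n)) (e _)

/-- The tensor powers `M^{⊗ k}`, with `M^{⊗ 0} = 𝒪_X`. -/
def tensorPow (M : X.Modules) : ℕ → X.Modules
  | 0 => SheafOfModules.unit X.ringCatSheaf
  | k + 1 => tensor M (tensorPow M k)

/-- The morphism `M^{⊗ k} ⟶ h_* (M'^{⊗ k})` induced by `φ : M ⟶ h_* M'`. -/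
def tensorPowOver (h : X ⟶ Y) {M : Y.Modules} {M' : X.Modules}
    (φ : M ⟶ (Scheme.Modules.pushforward h).obj M') :
    ∀ k : ℕ, tensorPow M k ⟶ (Scheme.Modules.pushforward h).obj (tensorPow M' k)
  | 0 => SheafOfModules.unitToPushforwardObjUnit h.toRingCatSheafHom
  | k + 1 => tensorOver h φ (tensorPowOver h φ k)

end Tensor

/-! ### Functoriality of inverse images -/

/-- For a commutative square `h ≫ b = a ≫ r`, a morphism `φ : F ⟶ r_* E` induces
`b^* F ⟶ h_* (a^* E)`. It is adjoint to `F ⟶ r_* E ⟶ r_* a_* a^* E = b_* h_* a^* E`. -/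
def pullbackOver {A B X Y : Scheme.{u}} {h : A ⟶ B} {a : A ⟶ X} {b : B ⟶ Y} {r : X ⟶ Y}
    (sq : h ≫ b = a ≫ r) {F : Y.Modules} {E : X.Modules}
    (φ : F ⟶ (Scheme.Modules.pushforward r).obj E) :
    (Scheme.Modules.pullback b).obj F ⟶
      (Scheme.Modules.pushforward h).obj ((Scheme.Modules.pullback a).obj E) :=
  ((Scheme.Modules.pullbackPushforwardAdjunction b).homEquiv _ _).symm
    (φ ≫ (Scheme.Modules.pushforward r).map
        ((Scheme.Modules.pullbackPushforwardAdjunction a).unit.app E) ≫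
      (Scheme.Modules.pushforwardComp a r).hom.app _ ≫
      (Scheme.Modules.pushforwardCongr sq.symm).hom.app _ ≫
      (Scheme.Modules.pushforwardComp h b).inv.app _)

lemma pullbackOver_unit {A B X Y : Scheme.{u}} {h : A ⟶ B} {a : A ⟶ X} {b : B ⟶ Y} {r : X ⟶ Y}
    (sq : h ≫ b = a ≫ r) {F : Y.Modules} {E : X.Modules}
    (φ : F ⟶ (Scheme.Modules.pushforward r).obj E) (s : Γ(F, (⊤ : Y.Opens))) :
    (pullbackOver sq φ).app ⊤
        (((Scheme.Modules.pullbackPushforwardAdjunction b).unit.app F).app ⊤ s) =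
      ((Scheme.Modules.pullbackPushforwardAdjunction a).unit.app E).app ⊤ (φ.app ⊤ s) := by
  have e := (Adjunction.homEquiv_unit (Scheme.Modules.pullbackPushforwardAdjunction b) F _
    (pullbackOver sq φ)).symm.trans (Equiv.apply_symm_apply _ _)
  generalize pullbackOver sq φ = P at e
  have e' := congrArg (fun q => Scheme.Modules.Hom.app q ⊤) e
  simp only [Scheme.Modules.Hom.comp_app, Scheme.Modules.pushforwardComp_hom_app_app,
    Scheme.Modules.pushforwardComp_inv_app_app, Scheme.Modules.pushforwardCongr_hom_app_app] at e'
  refine (ConcreteCategory.congr_hom e' s).trans ?_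
  exact ConcreteCategory.congr_hom
    (((Scheme.Modules.pullback a).obj E).presheaf.map_id (.op ⊤)) _

/-- For a morphism `h ≫ b = a` of schemes over `Y`, the canonical morphism
`b^* F ⟶ h_* (a^* F)`. -/
def pullbackRestrict {A B Y : Scheme.{u}} {h : A ⟶ B} {a : A ⟶ Y} {b : B ⟶ Y}
    (w : h ≫ b = a) (F : Y.Modules) :
    (Scheme.Modules.pullback b).obj F ⟶
      (Scheme.Modules.pushforward h).obj ((Scheme.Modules.pullback a).obj F) :=
  pullbackOver (r := 𝟙 Y) (w.trans (Category.comp_id a).symm)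
    ((Scheme.Modules.pushforwardId Y).inv.app F)

/-! ### Global sections as modules over the base ring -/

section Sections

variable {R : Type u} [CommRing R] {X Y : Scheme.{u}}

/-- The ring homomorphism `R → Γ(X, 𝒪_X)` given by a morphism `X ⟶ Spec R`. -/
def baseHom (f : X ⟶ Spec (.of R)) : R →+* Γ(X, ⊤) :=
  ((Scheme.ΓSpecIso (.of R)).inv ≫ f.appTop).hom

/-- `H⁰(X, M)`, as a module over `R`, for `f : X ⟶ Spec R`. -/
def H0 (_f : X ⟶ Spec (.of R)) (M : X.Modules) : Type u := Γ(M, (⊤ : X.Opens))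

instance (f : X ⟶ Spec (.of R)) (M : X.Modules) : AddCommGroup (H0 f M) :=
  inferInstanceAs (AddCommGroup Γ(M, (⊤ : X.Opens)))

instance (f : X ⟶ Spec (.of R)) (M : X.Modules) : Module R (H0 f M) :=
  Module.compHom Γ(M, (⊤ : X.Opens)) (baseHom f)

/-- For a morphism `h : X ⟶ Y` over `Spec R`, the map `H⁰(Y, N) → H⁰(X, M)` induced by
`φ : N ⟶ h_* M`. -/
def H0.map {f : X ⟶ Spec (.of R)} {g : Y ⟶ Spec (.of R)} {h : X ⟶ Y} (w : h ≫ g = f)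
    {N : Y.Modules} {M : X.Modules} (φ : N ⟶ (Scheme.Modules.pushforward h).obj M) :
    H0 g N →ₗ[R] H0 f M where
  toFun s := φ.app ⊤ s
  map_add' s t := map_add (φ.app ⊤).hom s t
  map_smul' r s := by
    subst w
    exact Scheme.Modules.Hom.app_smul φ (U := ⊤) (baseHom g r) s

end Sections

/-! ### Group actions and equivariant sheaves -/

section Equivariant

variable {R : Type u} [CommRing R] {G : Type v} [Group G] {X Z : Scheme.{u}}

/-- A `G`-equivariant structure on a sheaf of modules `M`, where `G` acts on `X` from the left via
`ρ`. The morphism `lift g : M ⟶ (ρ g)_* M` is the pullback of sections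
`g^* : M(U) → M(g⁻¹ U)`, semilinear along `𝒪(U) → 𝒪(g⁻¹ U)`; the conditions say `1^* = id` and
`(g h)^* = h^* g^*` (so that every `g^*` is an isomorphism). -/
structure EquivariantStructure (ρ : G →* Aut X) (M : X.Modules) where
  lift : ∀ g : G, M ⟶ (Scheme.Modules.pushforward (ρ g).hom).obj M
  lift_one : lift 1 = (Scheme.Modules.pushforwardId X).inv.app M ≫
    (Scheme.Modules.pushforwardCongr (show 𝟙 X = (ρ 1).hom by rw [map_one]; rfl)).hom.app M
  lift_mul : ∀ g h : G, lift (g * h) =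
    lift g ≫ (Scheme.Modules.pushforward (ρ g).hom).map (lift h) ≫
      (Scheme.Modules.pushforwardComp (ρ h).hom (ρ g).hom).hom.app M ≫
      (Scheme.Modules.pushforwardCongr
        (show (ρ h).hom ≫ (ρ g).hom = (ρ (g * h)).hom by rw [map_mul]; rfl)).hom.app M

/-- The action of `g : G` on `H⁰(Z, M)`, `g · s = (g⁻¹)^* s`, where `G` acts on `Z` over `Spec R`
by the morphisms `σ g` and `φ g : M ⟶ (σ g)_* M` is the pullback of sections `g^*`. -/
def act {p : Z ⟶ Spec (.of R)} {σ : G → (Z ⟶ Z)} (hσ : ∀ g, σ g ≫ p = p) {M : Z.Modules}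
    (φ : ∀ g, M ⟶ (Scheme.Modules.pushforward (σ g)).obj M) (g : G) : H0 p M →ₗ[R] H0 p M :=
  H0.map (hσ g⁻¹) (φ g⁻¹)

/-- The submodule `H⁰(Z, M)^ψ` of sections `s` such that `g · s = ψ(g) s` for all `g`. -/
def eigenSections {p : Z ⟶ Spec (.of R)} {σ : G → (Z ⟶ Z)} (hσ : ∀ g, σ g ≫ p = p)
    {M : Z.Modules} (φ : ∀ g, M ⟶ (Scheme.Modules.pushforward (σ g)).obj M) (ψ : G →* Rˣ) :
    Submodule R (H0 p M) where
  carrier := {s | ∀ g, act hσ φ g s = (ψ g : R) • s}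
  add_mem' hs ht g := by rw [map_add, hs g, ht g, smul_add]
  zero_mem' g := by rw [map_zero, smul_zero]
  smul_mem' r s hs g := by rw [map_smul, hs g, smul_comm]

/-- The restriction map `H⁰(X, M) → H⁰(Z, i^* M)`. -/
def restrictSections (f : X ⟶ Spec (.of R)) (i : Z ⟶ X) (M : X.Modules) :
    H0 f M →ₗ[R] H0 (i ≫ f) ((Scheme.Modules.pullback i).obj M) :=
  H0.map rfl ((Scheme.Modules.pullbackPushforwardAdjunction i).unit.app M)

end Equivariant

/-! ### Completion along a closed subscheme -/

section Completion

variable {X Z : Scheme.{u}}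

/-- The `n`-th infinitesimal neighbourhood of `i : Z ⟶ X`: the closed subscheme of `X` defined by
`ℐ ^ (n + 1)`, where `ℐ` is the ideal sheaf of `Z`. -/
abbrev infNbhd (i : Z ⟶ X) (n : ℕ) : Scheme.{u} := (i.ker ^ (n + 1)).subscheme

/-- The inclusion of the `n`-th infinitesimal neighbourhood. -/
abbrev infNbhdι (i : Z ⟶ X) (n : ℕ) : infNbhd i n ⟶ X := (i.ker ^ (n + 1)).subschemeι

lemma ker_pow_succ_le (i : Z ⟶ X) (n : ℕ) : i.ker ^ (n + 1) ≤ i.ker := fun _ =>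
  Ideal.pow_le_self n.succ_ne_zero

lemma ker_pow_le (i : Z ⟶ X) (n : ℕ) : i.ker ^ (n + 1 + 1) ≤ i.ker ^ (n + 1) := fun _ =>
  Ideal.pow_le_pow_right (Nat.le_succ _)

/-- The inclusion of `Z` into its `n`-th infinitesimal neighbourhood. -/
def toInfNbhd (i : Z ⟶ X) (n : ℕ) : Z ⟶ infNbhd i n :=
  IsClosedImmersion.lift (infNbhdι i n) i
    (by rw [Scheme.IdealSheafData.ker_subschemeι]; exact ker_pow_succ_le i n)

@[simp]
lemma toInfNbhd_ι (i : Z ⟶ X) (n : ℕ) : toInfNbhd i n ≫ infNbhdι i n = i :=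
  IsClosedImmersion.lift_fac _ _ _

/-- The inclusion of the `n`-th infinitesimal neighbourhood into the next one. -/
def infNbhdIncl (i : Z ⟶ X) (n : ℕ) : infNbhd i n ⟶ infNbhd i (n + 1) :=
  Scheme.IdealSheafData.inclusion (ker_pow_le i n)

@[simp]
lemma infNbhdIncl_ι (i : Z ⟶ X) (n : ℕ) : infNbhdIncl i n ≫ infNbhdι i (n + 1) = infNbhdι i n :=
  Scheme.IdealSheafData.inclusion_subschemeι _

lemma ker_pow_le_map {i : Z ⟶ X} {σ : Z ⟶ Z} {r : X ⟶ X} [IsAffineHom r]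
    (hσ : σ ≫ i = i ≫ r) (n : ℕ) : i.ker ^ (n + 1) ≤ (i.ker ^ (n + 1)).map r := by
  have h1 : i.ker ≤ i.ker.map r := by
    rw [Scheme.IdealSheafData.map_ker, ← hσ]
    exact Scheme.Hom.le_ker_comp σ i
  intro U
  have h2 := h1 U
  rw [Scheme.IdealSheafData.ideal_map_of_isAffineHom] at h2 ⊢
  exact (Ideal.pow_right_mono h2 _).trans (Ideal.le_comap_pow _ _)

/-- The endomorphism of the `n`-th infinitesimal neighbourhood of `Z` induced by a morphism
`r : X ⟶ X` which maps `Z` to itself. -/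
def infNbhdMap {i : Z ⟶ X} {σ : Z ⟶ Z} {r : X ⟶ X} [IsAffineHom r] (hσ : σ ≫ i = i ≫ r) (n : ℕ) :
    infNbhd i n ⟶ infNbhd i n :=
  IsClosedImmersion.lift (infNbhdι i n) (infNbhdι i n ≫ r)
    (by rw [Scheme.IdealSheafData.ker_subschemeι]; exact ker_pow_le_map hσ n)

@[simp]
lemma infNbhdMap_ι {i : Z ⟶ X} {σ : Z ⟶ Z} {r : X ⟶ X} [IsAffineHom r] (hσ : σ ≫ i = i ≫ r)
    (n : ℕ) : infNbhdMap hσ n ≫ infNbhdι i n = infNbhdι i n ≫ r :=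
  IsClosedImmersion.lift_fac _ _ _

variable {R : Type u} [CommRing R] (f : X ⟶ Spec (.of R)) (i : Z ⟶ X) (F : X.Modules)

/-- `H⁰(X, F ⊗ 𝒪_X / ℐ ^ (n + 1))`, the sections of `F` on the `n`-th infinitesimal
neighbourhood. -/
abbrev H0Inf (n : ℕ) : Type u :=
  H0 (infNbhdι i n ≫ f) ((Scheme.Modules.pullback (infNbhdι i n)).obj F)

/-- The transition map `H⁰(X, F ⊗ 𝒪_X / ℐ ^ (n + 2)) → H⁰(X, F ⊗ 𝒪_X / ℐ ^ (n + 1))`. -/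
def H0Inf.transition (n : ℕ) : H0Inf f i F (n + 1) →ₗ[R] H0Inf f i F n :=
  H0.map (by simp [← Category.assoc]) (pullbackRestrict (infNbhdIncl_ι i n) F)

/-- The sections of the completion of `F` along `Z`,
`H⁰(X, F ⊗ 𝒪̂_Z) = H⁰(X, lim F / ℐ ^ n F) = lim H⁰(X, F / ℐ ^ n F)` for `F` coherent. -/
def completedSections : Submodule R (∀ n, H0Inf f i F n) where
  carrier := {s | ∀ n, H0Inf.transition f i F n (s (n + 1)) = s n}
  add_mem' hs ht n := by simp only [Pi.add_apply, map_add, hs n, ht n]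
  zero_mem' n := by simp only [Pi.zero_apply, map_zero]
  smul_mem' r s hs n := by simp only [Pi.smul_apply, map_smul, hs n]

/-- The reduction map `H⁰(X, F ⊗ 𝒪̂_Z) → H⁰(Z, i^* F)`. -/
def completedToFiber :
    completedSections f i F →ₗ[R] H0 (i ≫ f) ((Scheme.Modules.pullback i).obj F) :=
  (H0.map (by simp [← Category.assoc]) (pullbackRestrict (toInfNbhd_ι i 0) F) :
      H0Inf f i F 0 →ₗ[R] H0 (i ≫ f) ((Scheme.Modules.pullback i).obj F)) ∘ₗ
    LinearMap.proj 0 ∘ₗ (completedSections f i F).subtype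

end Completion

section Action

variable {R : Type u} [CommRing R] {G : Type v} [Group G] {X Z : Scheme.{u}}
  {f : X ⟶ Spec (.of R)} {ρ : G →* Aut X} {i : Z ⟶ X} {σ : G → (Z ⟶ Z)}

lemma comp_base (hρ : ∀ g, (ρ g).hom ≫ f = f) (hσ : ∀ g, σ g ≫ i = i ≫ (ρ g).hom) (g : G) :
    σ g ≫ i ≫ f = i ≫ f := by
  rw [← Category.assoc, hσ g, Category.assoc, hρ g]

instance (e : Aut X) : IsIso e.hom := Iso.isIso_hom e

lemma infNbhdMap_base (hρ : ∀ g, (ρ g).hom ≫ f = f) (hσ : ∀ g, σ g ≫ i = i ≫ (ρ g).hom)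
    (n : ℕ) (g : G) :
    infNbhdMap (hσ g) n ≫ infNbhdι i n ≫ f = infNbhdι i n ≫ f :=
  comp_base (ρ := ρ) hρ (fun g => infNbhdMap_ι (hσ g) n) g

/-- The completion map `H⁰(X, F ⊗ 𝒪̂_Z) → H⁰(Z, i^* F)` has an `R`-linear `G`-equivariant
section. -/
def HasEquivariantSplitting (hρ : ∀ g, (ρ g).hom ≫ f = f)
    (hσ : ∀ g, σ g ≫ i = i ≫ (ρ g).hom) {F : X.Modules}
    (φ : ∀ g, F ⟶ (Scheme.Modules.pushforward (ρ g).hom).obj F) : Prop :=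
  ∃ s : H0 (i ≫ f) ((Scheme.Modules.pullback i).obj F) →ₗ[R] completedSections f i F,
    (∀ v, completedToFiber f i F (s v) = v) ∧
    ∀ (g : G) v (n : ℕ),
      (s (act (comp_base hρ hσ) (fun g => pullbackOver (hσ g) (φ g)) g v)).1 n =
        act (infNbhdMap_base hρ hσ n)
          (fun g => pullbackOver (infNbhdMap_ι (hσ g) n) (φ g)) g ((s v).1 n)

variable (hρ : ∀ g, (ρ g).hom ≫ f = f) (hσ : ∀ g, σ g ≫ i = i ≫ (ρ g).hom) {M : X.Modules}
  (φ : ∀ g, M ⟶ (Scheme.Modules.pushforward (ρ g).hom).obj M)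

lemma restrictSections_act (g : G) (s : H0 f M) :
    restrictSections f i M (act hρ φ g s) =
      act (comp_base hρ hσ) (fun g => pullbackOver (hσ g) (φ g)) g (restrictSections f i M s) :=
  (pullbackOver_unit (hσ g⁻¹) (φ g⁻¹) s).symm

/-- The restriction map `H⁰(X, M)^ψ → H⁰(Z, i^* M)^ψ` for a `G`-stable `i : Z ⟶ X`. -/
def restrictEigenSections (ψ : G →* Rˣ) :
    eigenSections hρ φ ψ →ₗ[R]
      eigenSections (comp_base hρ hσ) (fun g => pullbackOver (hσ g) (φ g)) ψ :=
  (restrictSections f i M).restrict fun s hs g => by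
    rw [← restrictSections_act hρ hσ φ g s, hs g, map_smul]

end Action

/-! ### Invertible and ample sheaves, projective morphisms -/

section Ample

variable {X : Scheme.{u}}

/-- The section `s` generates `M` freely on `V`: for all open `W ⊆ V`, multiplication by `s` is a
bijection `𝒪(W) → M(W)`. -/
def IsGenerator {M : X.Modules} {U : X.Opens} (s : Γ(M, U)) (V : X.Opens) (hV : V ≤ U) : Prop :=
  ∀ (W : X.Opens) (hW : W ≤ V), Function.Bijective
    fun r : Γ(X, W) => r • M.presheaf.map (homOfLE (hW.trans hV)).op s

/-- Line bundles: sheaves of modules which are locally free of rank one. -/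
def IsLineBundle (L : X.Modules) : Prop :=
  ∀ x : X, ∃ (V : X.Opens) (s : Γ(L, V)), x ∈ V ∧ IsGenerator s V le_rfl

/-- The locus `X_s` where a global section `s` of a line bundle does not vanish. -/
def nonvanishing {M : X.Modules} (s : Γ(M, (⊤ : X.Opens))) : Set X :=
  {x | ∃ V : X.Opens, x ∈ V ∧ IsGenerator s V le_top}

/-- A line bundle `L` on a quasi-compact scheme is ample if every point lies in an affine open
`X_s` for some `s ∈ H⁰(X, L^{⊗ n})`, `n ≥ 1`. -/
structure IsAmple (L : X.Modules) : Prop where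
  isLineBundle : IsLineBundle L
  compactSpace : CompactSpace X
  exists_affine : ∀ x : X, ∃ n : ℕ, 1 ≤ n ∧ ∃ (s : Γ(tensorPow L n, (⊤ : X.Opens)))
    (U : X.Opens), (U : Set X) = nonvanishing s ∧ IsAffineOpen U ∧ x ∈ U

instance (R : Type u) [CommRing R] (n : ℕ) :
    GradedAlgebra (MvPolynomial.homogeneousSubmodule (Fin (n + 1)) R) :=
  MvPolynomial.gradedAlgebra

/-- The structure morphism of the projective space `ℙⁿ_R = Proj R[T₀, …, Tₙ]`. -/
def projectiveSpaceHom (R : Type u) [CommRing R] (n : ℕ) :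
    Proj (MvPolynomial.homogeneousSubmodule (Fin (n + 1)) R) ⟶ Spec (.of R) :=
  Proj.toSpecZero _ ≫ Spec.map (CommRingCat.ofHom
    (algebraMap R (MvPolynomial.homogeneousSubmodule (Fin (n + 1)) R 0)))

/-- `f : X ⟶ Spec R` is projective: `X` is isomorphic over `R` to a closed subscheme of some
`ℙⁿ_R`. -/
def IsProjective {R : Type u} [CommRing R] (f : X ⟶ Spec (.of R)) : Prop :=
  ∃ (n : ℕ) (j : X ⟶ Proj (MvPolynomial.homogeneousSubmodule (Fin (n + 1)) R)),
    IsClosedImmersion j ∧ j ≫ projectiveSpaceHom R n = f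

end Ample

/-! ### Finite families of `R`-points -/

/-- The disjoint union of `m` copies of `Spec R`. -/
abbrev pointsScheme (R : Type u) [CommRing R] (m : ℕ) : Scheme.{u} :=
  ∐ fun _ : Fin m => Spec (.of R)

/-- The morphism `i : Z = ∐ⱼ Spec R ⟶ X` given by a finite family `x` of `R`-points of `X`. -/
abbrev pointsι {R : Type u} [CommRing R] {X : Scheme.{u}} {m : ℕ}
    (x : Fin m → (Spec (.of R) ⟶ X)) : pointsScheme R m ⟶ X :=
  Sigma.desc x

end EquivSurj

end

open EquivSurj

/-! Since |G| need not be invertible in R, an eigensection on Z cannot be lifted arbitrarily and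
then averaged. The assumed equivariant sections of the reduction maps take over the role of
averaging; the work consists in making them algebraic, compatible with twisting, and global.

Charts. Near each point of Spec R there are a ∈ R and a G-invariant section s of a power L^r such
that U = X_s is affine and G-stable, L is trivial on U, a is invertible on U, and Z ∩ U is the locus
of Z where a does not vanish (`exists_chart`; s comes from a norm). Let B = O(U), let I be the ideal
of Z in B, and M = F(U). Then B/I is finite étale over R_a, and the hypotheses give R_a-linear
equivariant sections of M/I^n M → M/I M, and of the same maps for L(U), for every n
(`exists_level_relation`).

Twisting. As B/I is étale, B/I^n → B/I has a unique R_a-algebra section τ, which is therefore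
equivariant. Averaging over the separability element of B/I makes the module sections τ-linear, and
keeps them equivariant because this element is invariant. If L(U) = B ℓ, the section for L sends ℓ
to u ℓ with u ≡ 1 mod I, and x ↦ u^k s(x) is an equivariant section for L^k ⊗ F
(`HasLevelSection.twist`).

Algebraization. Lifting generators of M/I M compatibly with their relations and with G means solving
finitely many linear equations over B^G, over which M is finite. The level sections solve them
modulo every power of I, and Artin–Rees corrects an approximate solution to an exact one
(`exists_section_of_levelSections`).

Globalization. The resulting section S has values in a finitely generated R_a-module. Hence one
power of s extends them to X, up to powers of a, and one further power turns the extensions of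
eigensections into eigensections; neither power depends on the character or on the section t to be
lifted (`exists_eigenSection_of_chart`). This covers all large k in each residue class modulo r,
hence all large k. What is lifted is a^e t instead of t; the elements a generate the unit ideal,
which gives t itself. -/

noncomputable section

namespace EquivSurj

/-! ### Algebraization: from sections at all levels to an equivariant section. -/

section EquivariantAlgebra

variable {R B M : Type*} {G : Type*} [CommRing R] [CommRing B] [Algebra R B] [Group G]
  [MulSemiringAction G B] [SMulCommClass G R B]
  [AddCommGroup M] [Module R M] [Module B M] [IsScalarTower R B M]

/-- The quotient map `M → M / I ^ n M` admits an `R`-linear section over `M / I M` which commutes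
with the semilinear maps `γ g`. -/
def HasLevelSection (R : Type*) {B M : Type*} {G : Type*} [CommRing R] [CommRing B] [Group G]
    [Algebra R B] [MulSemiringAction G B] [AddCommGroup M] [Module R M] [Module B M]
    [IsScalarTower R B M]
    (I : Ideal B) (γ : ∀ g : G, M →ₛₗ[MulSemiringAction.toRingHom G B g] M) (n : ℕ) : Prop :=
  ∃ s : M →ₗ[R] M ⧸ (I ^ n • ⊤ : Submodule B M),
    (∀ x ∈ (I • ⊤ : Submodule B M), s x = 0) ∧
    (∀ x y, s x = Submodule.Quotient.mk y → x - y ∈ (I • ⊤ : Submodule B M)) ∧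
    ∀ g x y, s x = Submodule.Quotient.mk y → s (γ g x) = Submodule.Quotient.mk (γ g y)

lemma semilinear_smul (γ : ∀ g : G, M →ₛₗ[MulSemiringAction.toRingHom G B g] M) (g : G) (r : R)
    (x : M) : γ g (r • x) = r • γ g x := by
  rw [← algebraMap_smul B r x, (γ g).map_smulₛₗ, ← algebraMap_smul B r (γ g x)]
  congr 1
  exact smul_algebraMap g r

variable (R G) in
/-- The ring of invariants of a finite group acting on a finitely generated algebra over a
noetherian ring is noetherian, and the algebra is finite over it. -/
lemma invariants_noetherian_finite [IsNoetherianRing R] [Algebra.FiniteType R B] [Finite G] :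
    IsNoetherianRing (FixedPoints.subalgebra R B G) ∧
      Module.Finite (FixedPoints.subalgebra R B G) B := by
  have : Algebra.IsInvariant (FixedPoints.subalgebra R B G) B G :=
    ⟨fun b hb => ⟨⟨b, hb⟩, rfl⟩⟩
  have : Algebra.IsIntegral (FixedPoints.subalgebra R B G) B :=
    Algebra.IsInvariant.isIntegral _ _ G
  have : Algebra.FiniteType (FixedPoints.subalgebra R B G) B :=
    Algebra.FiniteType.of_restrictScalars_finiteType R _ B
  have hfin : Module.Finite (FixedPoints.subalgebra R B G) B := Algebra.IsIntegral.finite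
  refine ⟨?_, hfin⟩
  -- Artin–Tate: B is of finite type over R and finite over the invariants.
  have : Algebra.FiniteType R (FixedPoints.subalgebra R B G) :=
    ⟨fg_of_fg_of_fg R _ B Algebra.FiniteType.out hfin.1 Subtype.val_injective⟩
  exact Algebra.FiniteType.isNoetherianRing R _

variable (R) in
/-- A stable ideal is contained in the radical of the extension of its invariants. -/
lemma le_radical_map_comap_invariants [Finite G] {I : Ideal B} (hI : ∀ (g : G), ∀ b ∈ I, g • b ∈ I) :
    I ≤ ((I.comap (algebraMap (FixedPoints.subalgebra R B G) B)).map
      (algebraMap (FixedPoints.subalgebra R B G) B)).radical := by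
  intro b hb
  have := Fintype.ofFinite G
  set A := FixedPoints.subalgebra R B G
  have hinv : Algebra.IsInvariant A B G := ⟨fun b hb => ⟨⟨b, hb⟩, rfl⟩⟩
  -- Modulo I the polynomial ∏ (X - g b) is X^|G|, because every g b lies in I. So its lower
  -- coefficients are invariants lying in I, and P(b) = 0 expresses a power of b through them.
  set P := MulSemiringAction.charpoly G b with hP
  have hmonic : P.Monic := MulSemiringAction.monic_charpoly G b
  have heval : P.eval b = 0 := MulSemiringAction.eval_charpoly G b
  have hmap : P.map (Ideal.Quotient.mk I) = Polynomial.X ^ Fintype.card G := by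
    rw [hP, MulSemiringAction.charpoly, Polynomial.map_prod]
    have : ∀ g : G, Polynomial.map (Ideal.Quotient.mk I) (Polynomial.X - Polynomial.C (g • b)) =
        Polynomial.X := fun g => by
      rw [Polynomial.map_sub, Polynomial.map_X, Polynomial.map_C,
        Ideal.Quotient.eq_zero_iff_mem.mpr (hI g b hb), map_zero, sub_zero]
    simp [this]
  have hlift := Algebra.IsInvariant.charpoly_mem_lifts A B G b
  refine ⟨P.natDegree, ?_⟩
  have hcard : Nontrivial (B ⧸ I) → P.natDegree = Fintype.card G := fun _ => by
    rw [← hmonic.natDegree_map (Ideal.Quotient.mk I), hmap, Polynomial.natDegree_X_pow]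
  have hsum : b ^ P.natDegree = -∑ i ∈ Finset.range P.natDegree, P.coeff i * b ^ i := by
    rw [Polynomial.eval_eq_sum_range, Finset.sum_range_succ, hmonic.coeff_natDegree, one_mul]
      at heval
    exact eq_neg_of_add_eq_zero_right heval
  rw [hsum]
  refine neg_mem (Ideal.sum_mem _ fun i hi => Ideal.mul_mem_right _ _ ?_)
  obtain ⟨Q, hQ⟩ := hlift
  have hc : algebraMap A B (Q.coeff i) = P.coeff i := by
    rw [← Polynomial.coeff_map]
    exact congrArg (fun p => Polynomial.coeff p i) hQ
  rw [← hc]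
  refine Ideal.mem_map_of_mem _ ?_
  rw [Ideal.mem_comap, hc]
  rcases subsingleton_or_nontrivial (B ⧸ I) with h | h
  · rw [Ideal.Quotient.subsingleton_iff.mp h]; trivial
  · rw [← Ideal.Quotient.eq_zero_iff_mem, ← Polynomial.coeff_map, hmap, Polynomial.coeff_X_pow,
      if_neg]
    rw [← hcard h]
    exact (Finset.mem_range.mp hi).ne

/-- If all the level sections exist, then `M → M / I M` has an equivariant `R`-linear section. -/
theorem exists_section_of_levelSections [IsNoetherianRing R] [Algebra.FiniteType R B] [Finite G]
    [Module.Finite B M] {I : Ideal B} (hI : ∀ (g : G), ∀ b ∈ I, g • b ∈ I)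
    (γ : ∀ g : G, M →ₛₗ[MulSemiringAction.toRingHom G B g] M)
    (hfin : Module.Finite R (M ⧸ (I • ⊤ : Submodule B M)))
    (hs : ∀ n, 0 < n → HasLevelSection R I γ n) :
    ∃ S : M →ₗ[R] M, (∀ x ∈ (I • ⊤ : Submodule B M), S x = 0) ∧
      (∀ x, S x - x ∈ (I • ⊤ : Submodule B M)) ∧ (∀ g x, S (γ g x) = γ g (S x)) ∧
      ∃ T : Submodule R M, T.FG ∧ ∀ x, S x ∈ T := by
  -- Everything is linear over the invariant ring A: M is finite over A, and each `γ g` is A-linear.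
  -- With a presentation of M/IM over R, a section is a choice of lifts of the generators `p i`
  -- satisfying the relations `rel`. It is equivariant if `γ g` acts on the lifts through the
  -- coefficients `cf` that describe its action on the `p i`.
  classical
  obtain ⟨hA, hBA⟩ := invariants_noetherian_finite R G (B := B)
  set A := FixedPoints.subalgebra R B G with hAdef
  have := Module.Finite.trans (R := A) B M
  set J : Ideal A := I.comap (algebraMap A B) with hJ
  have : IsNoetherianRing B := Algebra.FiniteType.isNoetherianRing R B
  have := Fintype.ofFinite G
  obtain ⟨c, hc⟩ := Ideal.exists_pow_le_of_le_radical_of_fg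
    (le_radical_map_comap_invariants R hI) (IsNoetherian.noetherian I)
  set P := M ⧸ (I • ⊤ : Submodule B M)
  obtain ⟨m, π, hπ⟩ := Module.Finite.exists_fin' R P
  have : IsNoetherian R (Fin m → R) := inferInstance
  obtain ⟨q, rel, hrel⟩ := Submodule.fg_iff_exists_fin_generating_family.mp
    (IsNoetherian.noetherian (LinearMap.ker π))
  let p : Fin m → P := fun i => π (Pi.single i 1)
  have hπs : ∀ v, π v = ∑ i, v i • p i := fun v => by
    conv_lhs => rw [← Finset.univ_sum_single v]
    rw [map_sum]
    refine Finset.sum_congr rfl fun i _ => ?_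
    rw [← map_smul]
    congr 1
    rw [← Pi.single_smul, smul_eq_mul, mul_one]
  have hγI : ∀ g, (I • ⊤ : Submodule B M) ≤ (I • ⊤ : Submodule B M).comap (γ g) := fun g => by
    refine Submodule.smul_le.mpr fun b hb x _ => ?_
    rw [Submodule.mem_comap, (γ g).map_smulₛₗ]
    exact Submodule.smul_mem_smul (hI g b hb) trivial
  let γP : ∀ g, P →ₛₗ[MulSemiringAction.toRingHom G B g] P := fun g => Submodule.mapQ _ _ (γ g) (hγI g)
  choose cf hcf using fun (gi : G × Fin m) => hπ (γP gi.1 (p gi.2))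
  let γA : ∀ g, M →ₗ[A] M := fun g =>
    { toFun := γ g
      map_add' := map_add _
      map_smul' := fun a x => by
        refine ((γ g).map_smulₛₗ (a : B) x).trans ?_
        exact congrArg (· • γ g x) (a.2 g) }
  -- Zeros of `D` that lift `p` define equivariant sections. There are finitely many equations since
  -- G is finite.
  let D : (Fin m → M) →ₗ[A] (Fin q ⊕ (G × Fin m) → M) := LinearMap.pi fun j => Sum.rec
    (fun κ => ∑ i, rel κ i • LinearMap.proj i)
    (fun gi => γA gi.1 ∘ₗ LinearMap.proj gi.2 - ∑ i, cf gi i • LinearMap.proj i) j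
  have hDl : ∀ v κ, D v (Sum.inl κ) = ∑ i, rel κ i • v i := fun v κ => by
    simp [D]
  have hDr : ∀ v gi, D v (Sum.inr gi) = γ gi.1 (v gi.2) - ∑ i, cf gi i • v i := fun v gi => by
    simp [D, γA]
  -- Artin–Rees for the image of `D` and the J-adic filtration.
  obtain ⟨k, hk⟩ := Ideal.exists_pow_inf_eq_pow_smul J (LinearMap.range D)
  -- Since I^c ⊆ J B, this exponent puts I^N M into J^(k+1) M. The last `+ 1` only makes `N`
  -- positive.
  obtain ⟨N, hNdef⟩ : ∃ N, N = c * (k + 1) + 1 := ⟨_, rfl⟩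
  obtain ⟨s, hsI, hsec, hsγ⟩ := hs N (hNdef ▸ Nat.succ_pos _)
  have hN : I ^ N ≤ (J ^ (k + 1)).map (algebraMap A B) := by
    rw [Ideal.map_pow, hNdef]
    refine (Ideal.pow_le_pow_right (Nat.le_succ _)).trans ?_
    rw [pow_mul]
    exact Ideal.pow_right_mono hc _
  have hNM : ∀ x : M, x ∈ (I ^ N • ⊤ : Submodule B M) → x ∈ (J ^ (k + 1) • ⊤ : Submodule A M) := by
    intro x hx
    have := Ideal.smul_restrictScalars (S := B) (J ^ (k + 1)) (⊤ : Submodule B M)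
    rw [Submodule.restrictScalars_top] at this
    rw [← this]
    exact Submodule.smul_mono_left hN hx
  choose x hx using fun i => Submodule.Quotient.mk_surjective _ (p i)
  choose y hy using fun i => Submodule.Quotient.mk_surjective _ (s (x i))
  have hsum : ∀ v : Fin m → R, s (∑ i, v i • x i) = Submodule.Quotient.mk (∑ i, v i • y i) := by
    intro v
    rw [map_sum, ← Submodule.mkQ_apply, map_sum]
    refine Finset.sum_congr rfl fun i _ => ?_
    rw [map_smul, ← hy i]
    rfl
  have hxs : ∀ v : Fin m → R, Submodule.Quotient.mk (∑ i, v i • x i) = π v := by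
    intro v
    rw [hπs, ← Submodule.mkQ_apply, map_sum]
    refine Finset.sum_congr rfl fun i _ => ?_
    rw [← hx i]
    rfl
  have hs0 : ∀ z w : M, (Submodule.Quotient.mk z : P) = Submodule.Quotient.mk w → s z = s w := by
    intro z w h
    rw [← sub_eq_zero, ← map_sub]
    exact hsI _ ((Submodule.Quotient.eq _).mp h)
  -- The lifts `y` given by the section at level `N` solve the equations modulo I^N M.
  have hDy : ∀ j, D y j ∈ (I ^ N • ⊤ : Submodule B M) := by
    rintro (κ | gi)
    · rw [hDl, ← Submodule.Quotient.mk_eq_zero, ← hsum, hs0 _ 0, map_zero]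
      rw [hxs]
      have : rel κ ∈ LinearMap.ker π := by rw [← hrel]; exact Submodule.subset_span ⟨κ, rfl⟩
      simpa using this
    · rw [hDr, ← Submodule.Quotient.mk_eq_zero, Submodule.Quotient.mk_sub, ← hsum,
        ← hsγ gi.1 _ _ (hy gi.2).symm, sub_eq_zero]
      refine hs0 _ _ ?_
      rw [hxs, hcf, ← hx]
      rfl
  have hDJ : D y ∈ (J ^ (k + 1) • ⊤ : Submodule A (Fin q ⊕ (G × Fin m) → M)) := by
    rw [← Finset.univ_sum_single (D y)]
    refine Submodule.sum_mem _ fun j _ => ?_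
    have h := Submodule.mem_map_of_mem (f := LinearMap.single A (fun _ => M) j) (hNM _ (hDy j))
    rw [Submodule.map_smul''] at h
    exact (smul_mono_right _ le_top : _ ≤ J ^ (k + 1) • (⊤ : Submodule A _)) h
  -- By Artin–Rees the defect `D y` is the image under `D` of a vector with entries in J M.
  have hDJ2 : D y ∈ (J • LinearMap.range D : Submodule A _) := by
    have h : D y ∈ J ^ (k + 1) • ⊤ ⊓ LinearMap.range D := ⟨hDJ, ⟨y, rfl⟩⟩
    rw [hk (k + 1) (Nat.le_succ _), Nat.add_sub_cancel_left, pow_one] at h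
    exact (smul_mono_right J inf_le_right : _ ≤ J • LinearMap.range D) h
  obtain ⟨v, hv, hvD⟩ : ∃ v ∈ (J • ⊤ : Submodule A (Fin m → M)), D v = D y := by
    rw [← Submodule.map_top, ← Submodule.map_smul''] at hDJ2
    exact hDJ2
  have hvI : ∀ i, v i ∈ (I • ⊤ : Submodule B M) := by
    intro i
    have h := Submodule.mem_map_of_mem (f := LinearMap.proj (R := A) (φ := fun _ => M) i) hv
    rw [Submodule.map_smul''] at h
    have h2 := Ideal.smul_restrictScalars (S := B) J (⊤ : Submodule B M)
    rw [Submodule.restrictScalars_top] at h2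
    have h3 := (smul_mono_right J le_top : _ ≤ J • (⊤ : Submodule A M)) h
    rw [← h2] at h3
    exact Submodule.smul_mono_left Ideal.map_comap_le h3
  -- The corrected lifts solve the equations exactly and still lift `p`, because J M ⊆ I M.
  set φ : Fin m → M := y - v with hφ
  have hφD : D φ = 0 := by rw [hφ, map_sub, hvD, sub_self]
  have hφx : ∀ i, (Submodule.Quotient.mk (φ i) : P) = p i := by
    intro i
    rw [← hx i, eq_comm, Submodule.Quotient.eq]
    have : x i - φ i = (x i - y i) + v i := by rw [hφ, Pi.sub_apply]; abel
    rw [this]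
    exact add_mem (hsec _ _ (hy i).symm) (hvI i)
  let Φ : (Fin m → R) →ₗ[R] M := Fintype.linearCombination R φ
  have hΦ : ∀ v, Φ v = ∑ i, v i • φ i := fun v => Fintype.linearCombination_apply R φ v
  have hker : LinearMap.ker π ≤ LinearMap.ker Φ := by
    rw [← hrel, Submodule.span_le]
    rintro _ ⟨κ, rfl⟩
    rw [SetLike.mem_coe, LinearMap.mem_ker, hΦ, ← hDl, hφD]
    rfl
  have hmk : ∀ v, (Submodule.Quotient.mk (Φ v) : P) = π v := by
    intro v
    rw [hΦ, hπs, ← Submodule.mkQ_apply, map_sum]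
    refine Finset.sum_congr rfl fun i _ => ?_
    rw [← hφx i]
    rfl
  choose l hl using fun z : P => hπ z
  have key : ∀ z (w : Fin m → R), π w = z → Φ (l z) = Φ w := fun z w hw => by
    rw [← sub_eq_zero, ← map_sub]
    refine hker ?_
    rw [LinearMap.mem_ker, map_sub, hl, hw, sub_self]
  let S : M →ₗ[R] M :=
    { toFun := fun z => Φ (l (Submodule.Quotient.mk z))
      map_add' := fun z w => by
        rw [← map_add]
        exact key _ _ (by rw [map_add, hl, hl]; rfl)
      map_smul' := fun r z => by
        rw [← map_smul]
        exact key _ _ (by rw [map_smul, hl]; rfl) }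
  refine ⟨S, fun z hz => ?_, fun z => ?_, fun g z => ?_, ?_⟩
  · refine (key _ 0 ?_).trans (map_zero _)
    rw [map_zero, eq_comm]
    exact (Submodule.Quotient.mk_eq_zero _).mpr hz
  · rw [← Submodule.Quotient.eq]
    exact (hmk _).trans (hl _)
  · set w := l (Submodule.Quotient.mk z) with hw
    have e1 : γ g (Φ w) = Φ (∑ i, w i • cf (g, i)) := by
      rw [hΦ, map_sum, map_sum]
      refine Finset.sum_congr rfl fun i _ => ?_
      rw [semilinear_smul γ, map_smul, hΦ]
      congr 1
      have := congrFun hφD (Sum.inr (g, i))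
      rw [hDr] at this
      exact sub_eq_zero.mp this
    refine (key _ _ ?_).trans e1.symm
    rw [← hmk, ← e1]
    have : (Submodule.Quotient.mk z : P) = Submodule.Quotient.mk (Φ w) := by rw [hmk, hw, hl]
    exact (congrArg (γP g) this).symm
  · exact ⟨LinearMap.range Φ, LinearMap.range_eq_map Φ ▸ (IsNoetherian.noetherian _).map Φ,
      fun x => ⟨_, rfl⟩⟩
end EquivariantAlgebra

/-! ### The separability element of an unramified algebra and averaging. -/

section SeparabilityElement

open TensorProduct

variable {R A : Type*} [CommRing R] [CommRing A] [Algebra R A]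

/-- In front of `δ` the right factor of a tensor can be moved to the left, so a tensor acts on `δ`
only through its product in `A`. -/
lemma mul_of_separating {δ : A ⊗[R] A} (h : ∀ a : A, (1 ⊗ₜ[R] a) * δ = (a ⊗ₜ[R] 1) * δ)
    (t : A ⊗[R] A) : t * δ = (Algebra.TensorProduct.lmul' R t ⊗ₜ[R] 1) * δ := by
  induction t with
  | zero => simp
  | add x y hx hy => rw [add_mul, hx, hy, map_add, TensorProduct.add_tmul, add_mul]
  | tmul x y =>
    have e : x ⊗ₜ[R] y = (x ⊗ₜ[R] 1) * (1 ⊗ₜ[R] y) := by simp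
    rw [e, mul_assoc, h y, ← mul_assoc]
    simp

/-- Evaluating the product of `δ` and `ε` by `mul_of_separating`, once for each factor, gives both
`δ` and `ε`. -/
lemma eq_of_separating {δ ε : A ⊗[R] A} (h : ∀ a : A, (1 ⊗ₜ[R] a) * δ = (a ⊗ₜ[R] 1) * δ)
    (h1 : Algebra.TensorProduct.lmul' R δ = 1)
    (k : ∀ a : A, (1 ⊗ₜ[R] a) * ε = (a ⊗ₜ[R] 1) * ε)
    (k1 : Algebra.TensorProduct.lmul' R ε = 1) : δ = ε := by
  have e1 := mul_of_separating h ε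
  have e2 := mul_of_separating k δ
  rw [k1, ← Algebra.TensorProduct.one_def, one_mul] at e1
  rw [h1, ← Algebra.TensorProduct.one_def, one_mul] at e2
  rw [← e1, mul_comm, e2]

/-- Surjective endomorphisms preserve the separability element of an unramified algebra. -/
lemma map_unramified_elem [Algebra.FormallyUnramified R A] [Algebra.EssFiniteType R A]
    (g : A →ₐ[R] A) (hg : Function.Surjective g) :
    Algebra.TensorProduct.map g g (Algebra.FormallyUnramified.elem R A) =
      Algebra.FormallyUnramified.elem R A := by
  refine eq_of_separating (fun a => ?_) ?_ Algebra.FormallyUnramified.one_tmul_mul_elem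
    Algebra.FormallyUnramified.lmul_elem
  · obtain ⟨b, rfl⟩ := hg a
    have := congrArg (Algebra.TensorProduct.map g g)
      (Algebra.FormallyUnramified.one_tmul_mul_elem (R := R) b)
    simpa using this
  · have : (Algebra.TensorProduct.lmul' R).comp (Algebra.TensorProduct.map g g) =
        g.comp (Algebra.TensorProduct.lmul' R) := by
      ext <;> simp
    have h := DFunLike.congr_fun this (Algebra.FormallyUnramified.elem R A)
    simp only [AlgHom.comp_apply, Algebra.FormallyUnramified.lmul_elem, map_one] at h
    exact h

variable {B P Q : Type*} [CommRing B] [Algebra R B] [AddCommGroup P] [Module R P] [Module A P]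
  [IsScalarTower R A P] [AddCommGroup Q] [Module R Q] [Module B Q] [IsScalarTower R B Q]

/-- The map `x ⊗ y ↦ τ(x) s(y v)`. -/
def sandwich (τ : A →ₐ[R] B) (s : P →ₗ[R] Q) (v : P) : A ⊗[R] A →ₗ[R] Q :=
  TensorProduct.lift (LinearMap.mk₂ R (fun x y => τ x • s (y • v))
    (fun x x' y => by rw [map_add, add_smul])
    (fun r x y => by rw [map_smul, smul_assoc])
    (fun x y y' => by rw [add_smul, map_add, smul_add])
    (fun r x y => by rw [smul_assoc, map_smul, smul_algebra_smul_comm]))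

@[simp]
lemma sandwich_tmul (τ : A →ₐ[R] B) (s : P →ₗ[R] Q) (v : P) (x y : A) :
    sandwich τ s v (x ⊗ₜ y) = τ x • s (y • v) := rfl

/-- The average of a linear map over a separability element. -/
def average (τ : A →ₐ[R] B) (s : P →ₗ[R] Q) (δ : A ⊗[R] A) : P →ₗ[R] Q where
  toFun v := sandwich τ s v δ
  map_add' v w := by
    induction δ with
    | zero => simp
    | add x y hx hy => rw [map_add, map_add, map_add, hx, hy]; abel
    | tmul x y => simp
  map_smul' r v := by
    induction δ with
    | zero => simp
    | add x y hx hy => rw [map_add, map_add, hx, hy, smul_add]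
    | tmul x y => simp only [sandwich_tmul, RingHom.id_apply]
                  rw [smul_comm y r v, map_smul, smul_algebra_smul_comm]

lemma sandwich_mul_left (τ : A →ₐ[R] B) (s : P →ₗ[R] Q) (v : P) (a : A) (t : A ⊗[R] A) :
    sandwich τ s v ((a ⊗ₜ 1) * t) = τ a • sandwich τ s v t := by
  induction t with
  | zero => simp
  | add x y hx hy => rw [mul_add, map_add, hx, hy, map_add, smul_add]
  | tmul x y => simp [mul_smul]

lemma sandwich_smul (τ : A →ₐ[R] B) (s : P →ₗ[R] Q) (v : P) (a : A) (t : A ⊗[R] A) :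
    sandwich τ s (a • v) t = sandwich τ s v ((1 ⊗ₜ a) * t) := by
  induction t with
  | zero => simp
  | add x y hx hy => rw [mul_add, map_add, hx, hy, map_add]
  | tmul x y => simp [mul_smul, smul_comm a y]

/-- The relation for `δ` moves a scalar from the argument of `s` to the left factor, where it acts
on the value through `τ`. -/
lemma average_smul (τ : A →ₐ[R] B) (s : P →ₗ[R] Q) {δ : A ⊗[R] A}
    (h : ∀ a : A, (1 ⊗ₜ[R] a) * δ = (a ⊗ₜ[R] 1) * δ) (a : A) (v : P) :
    average τ s δ (a • v) = τ a • average τ s δ v := by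
  change sandwich τ s (a • v) δ = τ a • sandwich τ s v δ
  rw [sandwich_smul, h, sandwich_mul_left]

end SeparabilityElement

/-! ### Linearization and twisting of level sections. -/

section EquivariantAlgebra

variable {R B M : Type*} {G : Type*} [CommRing R] [CommRing B] [Algebra R B] [Group G]
  [MulSemiringAction G B] [SMulCommClass G R B]
  [AddCommGroup M] [Module R M] [Module B M] [IsScalarTower R B M]

/-- A level section over `M / I M` can be made linear along any equivariant ring section of
`B / I ^ n → B / I`. -/
lemma HasLevelSection.exists_linear {I : Ideal B} (hI : ∀ (g : G), ∀ b ∈ I, g • b ∈ I)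
    [Algebra.FormallyUnramified R (B ⧸ I)] [Algebra.EssFiniteType R (B ⧸ I)]
    {γ : ∀ g : G, M →ₛₗ[MulSemiringAction.toRingHom G B g] M} {n : ℕ} (hn : 0 < n)
    (τ : (B ⧸ I) →ₐ[R] B ⧸ I ^ n) (hτ : ∀ b b', τ (Ideal.Quotient.mk _ b) = Ideal.Quotient.mk _ b' →
      b - b' ∈ I)
    (hτg : ∀ (g : G) b b', τ (Ideal.Quotient.mk _ b) = Ideal.Quotient.mk _ b' →
      τ (Ideal.Quotient.mk _ (g • b)) = Ideal.Quotient.mk _ (g • b'))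
    (h : HasLevelSection R I γ n) :
    ∃ s : M ⧸ (I • ⊤ : Submodule B M) →ₗ[R] M ⧸ (I ^ n • ⊤ : Submodule B M),
      (∀ x y, s (Submodule.Quotient.mk x) = Submodule.Quotient.mk y →
        x - y ∈ (I • ⊤ : Submodule B M)) ∧
      (∀ g x y, s (Submodule.Quotient.mk x) = Submodule.Quotient.mk y →
        s (Submodule.Quotient.mk (γ g x)) = Submodule.Quotient.mk (γ g y)) ∧
      ∀ a v, s (a • v) = τ a • s v := by
  obtain ⟨s, hs0, hs1, hs2⟩ := h
  have hIn : I ^ n ≤ I := Ideal.pow_le_self hn.ne'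
  have hIng : ∀ (g : G), ∀ b ∈ I ^ n, g • b ∈ I ^ n := fun g => by
    have := Ideal.pow_right_mono (I := I) (J := I.comap (MulSemiringAction.toRingHom G B g))
      (fun b hb => hI g b hb) n
    exact fun b hb => Ideal.le_comap_pow _ _ (this hb)
  have hγ : ∀ g (J : Ideal B), (∀ b ∈ J, g • b ∈ J) →
      (J • ⊤ : Submodule B M) ≤ (J • ⊤ : Submodule B M).comap (γ g) := fun g J hJ => by
    refine Submodule.smul_le.mpr fun b hb x _ => ?_
    rw [Submodule.mem_comap, (γ g).map_smulₛₗ]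
    exact Submodule.smul_mem_smul (hJ b hb) trivial
  let s₀ : M ⧸ (I • ⊤ : Submodule B M) →ₗ[R] M ⧸ (I ^ n • ⊤ : Submodule B M) :=
    (Submodule.liftQ ((I • ⊤ : Submodule B M).restrictScalars R) s fun x hx => hs0 x hx) ∘ₗ
      (Submodule.Quotient.restrictScalarsEquiv R (I • ⊤ : Submodule B M)).symm.toLinearMap
  have hs₀ : ∀ x, s₀ (Submodule.Quotient.mk x) = s x := fun x => rfl
  let gA : G → (B ⧸ I) →ₐ[R] B ⧸ I := fun g =>
    Ideal.quotientMapₐ I (MulSemiringAction.toAlgHom R B g) (hI g)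
  have hgA : ∀ g b, gA g (Ideal.Quotient.mk I b) = Ideal.Quotient.mk I (g • b) := fun _ _ => rfl
  have hgAs : ∀ g, Function.Surjective (gA g) := fun g a => by
    obtain ⟨b, rfl⟩ := Ideal.Quotient.mk_surjective a
    exact ⟨Ideal.Quotient.mk I (g⁻¹ • b), by rw [hgA, smul_inv_smul]⟩
  let δ := Algebra.FormallyUnramified.elem R (B ⧸ I)
  have hδ : ∀ a : B ⧸ I, (1 ⊗ₜ[R] a) * δ = (a ⊗ₜ[R] 1) * δ :=
    Algebra.FormallyUnramified.one_tmul_mul_elem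
  let γn : ∀ g, _ →ₛₗ[MulSemiringAction.toRingHom G B g] M ⧸ (I ^ n • ⊤ : Submodule B M) :=
    fun g => Submodule.mapQ _ _ (γ g) (hγ g _ (hIng g))
  let ρ : M ⧸ (I ^ n • ⊤ : Submodule B M) →ₗ[B] M ⧸ (I • ⊤ : Submodule B M) :=
    Submodule.mapQ _ _ LinearMap.id (Submodule.smul_mono_left hIn)
  -- Averaging makes `s₀` linear along `τ`. The result is still a section because `δ` has product 1,
  -- and still equivariant because `δ` is fixed by every `gA g ⊗ gA g`.
  refine ⟨average τ s₀ δ, fun x y hxy => ?_, fun g x y hxy => ?_, average_smul τ s₀ hδ⟩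
  · have key : ∀ t, ρ (sandwich τ s₀ (Submodule.Quotient.mk x) t) =
        Algebra.TensorProduct.lmul' R t • Submodule.Quotient.mk x := by
      intro t
      induction t with
      | zero => simp
      | add a b ha hb => rw [map_add, map_add, ha, hb, map_add, add_smul]
      | tmul a b =>
        obtain ⟨a, rfl⟩ := Ideal.Quotient.mk_surjective a
        obtain ⟨b, rfl⟩ := Ideal.Quotient.mk_surjective b
        obtain ⟨a', ha'⟩ := Ideal.Quotient.mk_surjective (τ (Ideal.Quotient.mk _ a))
        obtain ⟨z, hz⟩ := Submodule.Quotient.mk_surjective _ (s (b • x))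
        have e1 : (Ideal.Quotient.mk I a) = Ideal.Quotient.mk I a' :=
          Ideal.Quotient.eq.mpr (hτ _ _ ha'.symm)
        have e2 : (Submodule.Quotient.mk (b • x) : M ⧸ (I • ⊤ : Submodule B M)) =
          Submodule.Quotient.mk z := (Submodule.Quotient.eq _).mpr (hs1 _ _ hz.symm)
        rw [sandwich_tmul, Algebra.TensorProduct.lmul'_apply_tmul, mul_smul, ← ha', e1]
        change ρ (Ideal.Quotient.mk _ a' • s (b • x)) = Ideal.Quotient.mk _ a' •
          Submodule.Quotient.mk (b • x)
        rw [e2, ← hz]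
        rfl
    have h1 := key δ
    rw [Algebra.FormallyUnramified.lmul_elem, one_smul] at h1
    have h2 : average τ s₀ δ (Submodule.Quotient.mk x) =
      sandwich τ s₀ (Submodule.Quotient.mk x) δ := rfl
    rw [← h2, hxy] at h1
    exact (Submodule.Quotient.eq _).mp h1.symm
  · have key : ∀ t, sandwich τ s₀ (Submodule.Quotient.mk (γ g x))
        (Algebra.TensorProduct.map (gA g) (gA g) t) =
        γn g (sandwich τ s₀ (Submodule.Quotient.mk x) t) := by
      intro t
      induction t with
      | zero => simp
      | add a b ha hb => rw [map_add, map_add, ha, hb, map_add, map_add]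
      | tmul a b =>
        obtain ⟨a, rfl⟩ := Ideal.Quotient.mk_surjective a
        obtain ⟨b, rfl⟩ := Ideal.Quotient.mk_surjective b
        obtain ⟨a', ha'⟩ := Ideal.Quotient.mk_surjective (τ (Ideal.Quotient.mk _ a))
        obtain ⟨z, hz⟩ := Submodule.Quotient.mk_surjective _ (s (b • x))
        rw [Algebra.TensorProduct.map_tmul, sandwich_tmul, sandwich_tmul, hgA, hgA,
          hτg g a a' ha'.symm, ← ha']
        change Ideal.Quotient.mk _ (g • a') • s ((g • b) • γ g x) =
          γn g (Ideal.Quotient.mk _ a' • s (b • x))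
        have e : (g • b) • γ g x = γ g (b • x) := ((γ g).map_smulₛₗ b x).symm
        rw [e, hs2 g _ _ hz.symm, ← hz]
        exact congrArg Submodule.Quotient.mk ((γ g).map_smulₛₗ a' z).symm
    have h1 := key δ
    rw [map_unramified_elem (gA g) (hgAs g)] at h1
    refine h1.trans ?_
    have h2 : average τ s₀ δ (Submodule.Quotient.mk x) =
      sandwich τ s₀ (Submodule.Quotient.mk x) δ := rfl
    rw [← h2, hxy]
    rfl

/-- Level sections for a twisted form of `B` and for `M` give level sections for twists of `M`. -/
theorem HasLevelSection.twist {I : Ideal B} (hI : ∀ (g : G), ∀ b ∈ I, g • b ∈ I)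
    [Algebra.FormallyEtale R (B ⧸ I)] [Algebra.EssFiniteType R (B ⧸ I)]
    {γ : ∀ g : G, M →ₛₗ[MulSemiringAction.toRingHom G B g] M} {n : ℕ} (hn : 0 < n) {c : G → B}
    (hL : HasLevelSection R I (fun g => c g • (MulSemiringAction.toRingHom G B g).toSemilinearMap) n)
    (hM : HasLevelSection R I γ n) (k : ℕ) :
    HasLevelSection R I (fun g => c g ^ k • γ g) n := by
  have hIn : I ^ n ≤ I := Ideal.pow_le_self hn.ne'
  have hIng : ∀ (g : G), ∀ b ∈ I ^ n, g • b ∈ I ^ n := fun g => by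
    have := Ideal.pow_right_mono (I := I) (J := I.comap (MulSemiringAction.toRingHom G B g))
      (fun b hb => hI g b hb) n
    exact fun b hb => Ideal.le_comap_pow _ _ (this hb)
  let p : (B ⧸ I ^ n) →ₐ[R] B ⧸ I := Ideal.Quotient.factorₐ R hIn
  have hpmk : ∀ b, p (Ideal.Quotient.mk _ b) = Ideal.Quotient.mk _ b := fun b => rfl
  have hps : Function.Surjective p := Ideal.Quotient.factor_surjective hIn
  have hker : IsNilpotent (RingHom.ker (p : (B ⧸ I ^ n) →+* B ⧸ I)) := by
    refine ⟨n, ?_⟩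
    rw [Ideal.zero_eq_bot, eq_bot_iff]
    have : RingHom.ker (p : (B ⧸ I ^ n) →+* B ⧸ I) ≤ I.map (Ideal.Quotient.mk (I ^ n)) := by
      intro x hx
      obtain ⟨b, rfl⟩ := Ideal.Quotient.mk_surjective x
      exact Ideal.mem_map_of_mem _ (Ideal.Quotient.eq_zero_iff_mem.mp hx)
    refine (Ideal.pow_right_mono this n).trans ?_
    rw [← Ideal.map_pow, Ideal.map_quotient_self]
  -- Formal smoothness lifts the identity of B/I along the nilpotent thickening B/I^n → B/I.
  let τ : (B ⧸ I) →ₐ[R] B ⧸ I ^ n :=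
    Algebra.FormallySmooth.liftOfSurjective (AlgHom.id R (B ⧸ I)) p hps hker
  have hτp : ∀ a, p (τ a) = a := fun a =>
    Algebra.FormallySmooth.liftOfSurjective_apply (AlgHom.id R (B ⧸ I)) p hps hker a
  have hτ : ∀ b b', τ (Ideal.Quotient.mk _ b) = Ideal.Quotient.mk _ b' → b - b' ∈ I := by
    intro b b' h
    rw [← Ideal.Quotient.eq, ← hpmk b', ← h, hτp]
  have hτg : ∀ (g : G) b b', τ (Ideal.Quotient.mk _ b) = Ideal.Quotient.mk _ b' →
      τ (Ideal.Quotient.mk _ (g • b)) = Ideal.Quotient.mk _ (g • b') := by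
    intro g b b' h
    let gA : (B ⧸ I) →ₐ[R] B ⧸ I :=
      Ideal.quotientMapₐ I (MulSemiringAction.toAlgHom R B g) (hI g)
    let gn : (B ⧸ I ^ n) →ₐ[R] B ⧸ I ^ n :=
      Ideal.quotientMapₐ _ (MulSemiringAction.toAlgHom R B g) (hIng g)
    -- Both sides lift `gA` along the thickening, and such lifts are unique because B/I is formally
    -- unramified.
    have : τ.comp gA = gn.comp τ := by
      refine Algebra.FormallyUnramified.lift_unique_of_ringHom (p : (B ⧸ I ^ n) →+* B ⧸ I) hker _ _ ?_
      ext b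
      obtain ⟨b', hb'⟩ := Ideal.Quotient.mk_surjective (τ (Ideal.Quotient.mk _ b))
      have e1 : p (τ (gA (Ideal.Quotient.mk _ b))) = p (gn (τ (Ideal.Quotient.mk _ b))) := by
        rw [hτp, ← hb']
        refine Ideal.Quotient.eq.mpr ?_
        have := hI g _ (hτ _ _ hb'.symm)
        rw [smul_sub] at this
        exact this
      exact e1
    have h2 := DFunLike.congr_fun this (Ideal.Quotient.mk _ b)
    exact h2.trans (congrArg gn h)
  obtain ⟨sL, hL1, hL2, hL3⟩ := hL.exists_linear hI hn τ hτ hτg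
  obtain ⟨s, h1, h2, h3⟩ := hM.exists_linear hI hn τ hτ hτg
  -- By linearity along `τ`, the section of the line bundle is b ↦ τ(b) u.
  obtain ⟨u, hu⟩ := Submodule.Quotient.mk_surjective _ (sL (Submodule.Quotient.mk 1))
  have huI : 1 - u ∈ I := by simpa using hL1 1 u hu.symm
  -- the cocycle relation `β_g(u) c_g = τ(c_g) u`
  have hcu : ∀ (g : G) t, τ (Ideal.Quotient.mk _ (c g)) = Ideal.Quotient.mk _ t →
      Ideal.Quotient.mk (I ^ n) (c g * g • u) = Ideal.Quotient.mk _ (t * u) := by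
    intro g t ht
    have e1 := hL2 g 1 u hu.symm
    have e2 : (c g • (MulSemiringAction.toRingHom G B g).toSemilinearMap) (1 : B) = c g • 1 := by
      simp
    have e3 : sL (Submodule.Quotient.mk (c g • (1 : B))) = Submodule.Quotient.mk (t • u) := by
      have := hL3 (Ideal.Quotient.mk _ (c g)) (Submodule.Quotient.mk 1)
      refine this.trans ?_
      rw [ht, ← hu]
      rfl
    rw [e2, e3] at e1
    have e4 := (Submodule.Quotient.eq _).mp e1
    rw [smul_eq_mul, Ideal.mul_top] at e4
    exact (Ideal.Quotient.eq.mpr e4).symm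
  have hpow : ∀ (m : ℕ) (z : M), (1 - u ^ m) • z ∈ (I • ⊤ : Submodule B M) := fun m z =>
    Submodule.smul_mem_smul
      (by simpa using I.mem_of_dvd (sub_dvd_pow_sub_pow 1 u m) huI) trivial
  -- The factor `u ^ k` absorbs the difference between τ(c_g)^k and c_g^k in the twisted
  -- equivariance.
  let sR : M →ₗ[R] M ⧸ (I ^ n • ⊤ : Submodule B M) :=
    { toFun := fun x => u ^ k • s (Submodule.Quotient.mk x)
      map_add' := fun x y => by rw [Submodule.Quotient.mk_add, map_add, smul_add]
      map_smul' := fun r x => by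
        rw [Submodule.Quotient.mk_smul, map_smul, RingHom.id_apply, smul_algebra_smul_comm] }
  refine ⟨sR, fun x hx => ?_, fun x y hxy => ?_, fun g x y hxy => ?_⟩
  · change u ^ k • s (Submodule.Quotient.mk x) = 0
    rw [(Submodule.Quotient.mk_eq_zero _).mpr hx, map_zero, smul_zero]
  · obtain ⟨z, hz⟩ := Submodule.Quotient.mk_surjective _ (s (Submodule.Quotient.mk x))
    have e1 := h1 x z hz.symm
    have e2 : (Submodule.Quotient.mk (u ^ k • z) : M ⧸ (I ^ n • ⊤ : Submodule B M)) =
        Submodule.Quotient.mk y := by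
      rw [← hxy, Submodule.Quotient.mk_smul, hz]
      rfl
    have e3 := Submodule.smul_mono_left hIn ((Submodule.Quotient.eq _).mp e2)
    have : x - y = (x - z) + ((1 - u ^ k) • z + (u ^ k • z - y)) := by
      rw [sub_smul, one_smul]; abel
    rw [this]
    exact add_mem e1 (add_mem (hpow k z) e3)
  · obtain ⟨z, hz⟩ := Submodule.Quotient.mk_surjective _ (s (Submodule.Quotient.mk x))
    obtain ⟨t, ht⟩ := Ideal.Quotient.mk_surjective (τ (Ideal.Quotient.mk _ (c g)))
    have e2 : (Submodule.Quotient.mk (u ^ k • z) : M ⧸ (I ^ n • ⊤ : Submodule B M)) =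
        Submodule.Quotient.mk y := by
      rw [← hxy, Submodule.Quotient.mk_smul, hz]
      rfl
    have hγ : ∀ w ∈ (I ^ n • ⊤ : Submodule B M), γ g w ∈ (I ^ n • ⊤ : Submodule B M) := by
      intro w hw
      have : (I ^ n • ⊤ : Submodule B M) ≤ (I ^ n • ⊤ : Submodule B M).comap (γ g) := by
        refine Submodule.smul_le.mpr fun b hb x _ => ?_
        rw [Submodule.mem_comap, (γ g).map_smulₛₗ]
        exact Submodule.smul_mem_smul (hIng g b hb) trivial
      exact this hw
    have e3 : (Submodule.Quotient.mk (γ g y) : M ⧸ (I ^ n • ⊤ : Submodule B M)) =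
        (g • u) ^ k • Submodule.Quotient.mk (γ g z) := by
      rw [← Submodule.Quotient.mk_smul]
      refine ((Submodule.Quotient.eq _).mpr ?_).symm
      have := hγ _ ((Submodule.Quotient.eq _).mp e2)
      rw [map_sub, (γ g).map_smulₛₗ, map_pow] at this
      exact this
    change u ^ k • s (Submodule.Quotient.mk (c g ^ k • γ g x)) =
      Submodule.Quotient.mk (c g ^ k • γ g y)
    have e4 : s (Submodule.Quotient.mk (c g ^ k • γ g x)) =
        t ^ k • Submodule.Quotient.mk (γ g z) := by
      have := h3 (Ideal.Quotient.mk _ (c g ^ k)) (Submodule.Quotient.mk (γ g x))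
      refine this.trans ?_
      rw [map_pow, map_pow, ← ht, h2 g x z hz.symm, ← map_pow]
      rfl
    -- What remains is the k-th power of the cocycle relation `hcu`, applied to the class of `γ g
    -- z`.
    rw [e4, Submodule.Quotient.mk_smul, e3, ← mul_smul, ← mul_smul, ← mul_pow, ← mul_pow]
    have e5 := congrArg (· ^ k) (hcu g t ht.symm)
    simp only [← map_pow] at e5
    rw [mul_comm u t]
    exact congrArg (fun q : B ⧸ I ^ n =>
      q • (Submodule.Quotient.mk (γ g z) : M ⧸ (I ^ n • ⊤ : Submodule B M))) e5.symm

end EquivariantAlgebra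

/-! ### Restriction and gluing of sections. -/

section Restriction

variable {X Y : Scheme.{u}} {M N : X.Modules} {U V W : X.Opens}

/-- Restriction of sections of a sheaf of modules to a smaller open set. -/
def res (h : V ≤ U) : Γ(M, U) →+ Γ(M, V) := (M.presheaf.map (homOfLE h).op).hom

/-- Restriction of functions to a smaller open set. -/
def rres (h : V ≤ U) : Γ(X, U) →+* Γ(X, V) := (X.presheaf.map (homOfLE h).op).hom

@[simp]
lemma res_res (h : V ≤ U) (h' : W ≤ V) (s : Γ(M, U)) : res h' (res h s) = res (h'.trans h) s := by
  change (M.presheaf.map _ ≫ M.presheaf.map _) s = _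
  rw [← Functor.map_comp]
  rfl

@[simp]
lemma rres_rres (h : V ≤ U) (h' : W ≤ V) (s : Γ(X, U)) :
    rres h' (rres h s) = rres (h'.trans h) s := by
  change (X.presheaf.map _ ≫ X.presheaf.map _) s = _
  rw [← Functor.map_comp]
  rfl

@[simp]
lemma res_rfl (h : U ≤ U) (s : Γ(M, U)) : res h s = s :=
  ConcreteCategory.congr_hom (M.presheaf.map_id (.op U)) s

@[simp]
lemma rres_rfl (h : U ≤ U) (s : Γ(X, U)) : rres h s = s :=
  ConcreteCategory.congr_hom (X.presheaf.map_id (.op U)) s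

lemma res_smul (h : V ≤ U) (r : Γ(X, U)) (s : Γ(M, U)) : res h (r • s) = rres h r • res h s :=
  Scheme.Modules.map_smul M (homOfLE h) r s

lemma app_res (φ : M ⟶ N) (h : V ≤ U) (s : Γ(M, U)) : φ.app V (res h s) = res h (φ.app U s) :=
  ConcreteCategory.congr_hom (φ.mapPresheaf.naturality (homOfLE h).op) s

lemma pushforward_app_res {f : X ⟶ Y} {K : Y.Modules} {U V : Y.Opens}
    (φ : K ⟶ (Scheme.Modules.pushforward f).obj M) (h : V ≤ U) (s : Γ(K, U)) :
    φ.app V (res h s) = res (M := M) (f.preimage_mono h) (φ.app U s) :=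
  app_res φ h s

lemma pushforward_app_smul {f : X ⟶ Y} {K : Y.Modules} {U : Y.Opens}
    (φ : K ⟶ (Scheme.Modules.pushforward f).obj M) (r : Γ(Y, U)) (s : Γ(K, U)) :
    φ.app U (r • s) = @HSMul.hSMul Γ(X, f ⁻¹ᵁ U) Γ(M, f ⁻¹ᵁ U) Γ(M, f ⁻¹ᵁ U) instHSMul
      (f.app U r) (φ.app U s) :=
  Scheme.Modules.Hom.app_smul φ r s

lemma app_rres (f : X ⟶ Y) {U V : Y.Opens} (h : V ≤ U) (s : Γ(Y, U)) :
    f.app V (rres h s) = rres (f.preimage_mono h) (f.app U s) :=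
  ConcreteCategory.congr_hom (f.naturality (homOfLE h).op) s

lemma res_tmul (h : V ≤ U) (m : Γ(M, U)) (n : Γ(N, U)) :
    res h (tmul m n) = tmul (res h m) (res h n) :=
  map_tmul (homOfLE h) m n

lemma section_ext {s t : Γ(M, U)} (h : ∀ x ∈ U, ∃ (V : X.Opens) (hV : V ≤ U), x ∈ V ∧
    res hV s = res hV t) : s = t := by
  choose V hV hx e using fun x : U => h x.1 x.2
  exact TopCat.Sheaf.eq_of_locally_eq' ⟨_, M.isSheaf⟩ V U (fun x => homOfLE (hV x))
    (fun x hxU => TopologicalSpace.Opens.mem_iSup.mpr ⟨⟨x, hxU⟩, hx _⟩) s t e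

lemma section_glue {ι : Type*} {V : ι → X.Opens} (hV : ∀ i, V i ≤ U)
    (hU : ∀ x ∈ U, ∃ i, x ∈ V i) (s : ∀ i, Γ(M, V i))
    (hs : ∀ i j, res (inf_le_left : V i ⊓ V j ≤ V i) (s i) = res inf_le_right (s j)) :
    ∃ t : Γ(M, U), ∀ i, res (hV i) t = s i :=
  (TopCat.Sheaf.existsUnique_gluing' ⟨_, M.isSheaf⟩ V U (fun i => homOfLE (hV i))
    (fun x hx => TopologicalSpace.Opens.mem_iSup.mpr (hU x hx)) s hs).exists

/-- A morphism of sheaves of abelian groups which is bijective on a neighbourhood basis of every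
point of `U` is bijective over `U`. -/
lemma bijective_of_locally {U : X.Opens} (f : ∀ V : X.Opens, V ≤ U → Γ(M, V) → Γ(N, V))
    (hf : ∀ (V W : X.Opens) (hV : V ≤ U) (hW : W ≤ V) (m : Γ(M, V)),
      res hW (f V hV m) = f W (hW.trans hV) (res hW m))
    (h : ∀ x ∈ U, ∃ V : X.Opens, x ∈ V ∧ ∀ (W : X.Opens) (hWU : W ≤ U), W ≤ V →
      Function.Bijective (f W hWU)) : Function.Bijective (f U le_rfl) := by
  choose V hxV hb using fun x : U => h x.1 x.2
  constructor
  · intro s t hst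
    refine section_ext fun x hx => ⟨V ⟨x, hx⟩ ⊓ U, inf_le_right, ⟨hxV ⟨x, hx⟩, hx⟩, ?_⟩
    refine (hb ⟨x, hx⟩ _ inf_le_right inf_le_left).1 ?_
    rw [← hf U _ le_rfl, ← hf U _ le_rfl, hst]
  · intro t
    choose s hs using fun x : U => (hb x (V x ⊓ U) inf_le_right inf_le_left).2 (res inf_le_right t)
    obtain ⟨s', hs'⟩ := section_glue (fun x => (inf_le_right : V x ⊓ U ≤ U))
      (fun x hx => ⟨⟨x, hx⟩, hxV ⟨x, hx⟩, hx⟩) s (fun x y => by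
        refine (hb x (V x ⊓ U ⊓ (V y ⊓ U)) (inf_le_left.trans inf_le_right)
          (inf_le_left.trans inf_le_left)).1 ?_
        rw [← hf _ _ inf_le_right, ← hf _ _ inf_le_right, hs, hs, res_res, res_res])
    refine ⟨s', section_ext fun x hx => ⟨V ⟨x, hx⟩ ⊓ U, inf_le_right, ⟨hxV ⟨x, hx⟩, hx⟩, ?_⟩⟩
    rw [hf U _ le_rfl, hs', hs]

end Restriction

/-! ### Tensoring with a locally free sheaf of rank one. -/

section Generator

variable {X : Scheme.{u}} {M N : X.Modules} {U V W : X.Opens}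

lemma IsGenerator.bijective {ℓ : Γ(M, V)} (h : IsGenerator ℓ V le_rfl) (hW : W ≤ V) :
    Function.Bijective fun r : Γ(X, W) => r • res hW ℓ := h W hW

lemma IsGenerator.res {ℓ : Γ(M, V)} (h : IsGenerator ℓ V le_rfl) (hW : W ≤ V) :
    IsGenerator (res hW ℓ) W le_rfl := by
  intro W' hW'
  have := h W' (hW'.trans hW)
  have e : M.presheaf.map (homOfLE (hW'.trans hW)).op ℓ = EquivSurj.res hW' (EquivSurj.res hW ℓ) :=
    (res_res hW hW' ℓ).symm
  rw [e] at this
  exact this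

/-- Multiplication by a generator as an isomorphism `𝒪(W) ≃ M(W)`. -/
def IsGenerator.equiv {ℓ : Γ(M, V)} (h : IsGenerator ℓ V le_rfl) : Γ(X, V) ≃ₗ[Γ(X, V)] Γ(M, V) :=
  LinearEquiv.ofBijective
    { toFun := fun r => r • ℓ
      map_add' := fun r s => add_smul r s ℓ
      map_smul' := fun r s => mul_smul r s ℓ }
    (by simpa using! h.bijective le_rfl)

lemma IsGenerator.tensor_exists {ℓ : Γ(M, V)} (h : IsGenerator ℓ V le_rfl)
    (t : TensorProduct Γ(X, V) Γ(M, V) Γ(N, V)) :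
    ∃ n : Γ(N, V), t = TensorProduct.tmul _ ℓ n := by
  induction t with
  | zero => exact ⟨0, (TensorProduct.tmul_zero _ _).symm⟩
  | add x y hx hy =>
    obtain ⟨n, rfl⟩ := hx
    obtain ⟨n', rfl⟩ := hy
    exact ⟨n + n', (TensorProduct.tmul_add _ _ _).symm⟩
  | tmul x y =>
    obtain ⟨r, rfl⟩ := h.equiv.surjective x
    exact ⟨r • y, TensorProduct.smul_tmul r ℓ y⟩

lemma IsGenerator.tensor_injective {ℓ : Γ(M, V)} (h : IsGenerator ℓ V le_rfl) {n : Γ(N, V)}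
    (hn : TensorProduct.tmul Γ(X, V) ℓ n = 0) : n = 0 := by
  let e : TensorProduct Γ(X, V) Γ(M, V) Γ(N, V) →ₗ[Γ(X, V)] Γ(N, V) :=
    (TensorProduct.lid Γ(X, V) Γ(N, V)).toLinearMap ∘ₗ
      (TensorProduct.congr h.equiv.symm (LinearEquiv.refl Γ(X, V) Γ(N, V))).toLinearMap
  have h1 : e (TensorProduct.tmul Γ(X, V) ℓ n) = n := by
    have : h.equiv.symm ℓ = 1 := by
      rw [LinearEquiv.symm_apply_eq]
      exact (one_smul _ _).symm
    simp [e, this]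
  rw [← h1, hn, map_zero]

/-- The map to the sheafification is locally injective and, by the next lemma, locally surjective.
Thus local questions on `tensor` become questions on ordinary tensor products of modules. -/
lemma toTensor_locally_injective {t : TensorProduct Γ(X, V) Γ(M, V) Γ(N, V)}
    (ht : (toTensor M N).app (.op V) t = 0) : ∀ x ∈ V, ∃ (W : X.Opens) (hW : W ≤ V), x ∈ W ∧
      (presheafTensor M N).map (homOfLE hW).op t = 0 := by
  have : Presheaf.IsLocallyInjective (Opens.grothendieckTopology X)
    (CategoryTheory.toSheafify (Opens.grothendieckTopology X) (presheafTensor M N).presheaf) :=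
    inferInstance
  have h := Presheaf.equalizerSieve_mem (Opens.grothendieckTopology X)
    (CategoryTheory.toSheafify (Opens.grothendieckTopology X) (presheafTensor M N).presheaf)
    (X := .op V) t 0 (by
      rw [map_zero]
      exact ht)
  intro x hx
  obtain ⟨W, f, hf, hxW⟩ := h x hx
  refine ⟨W, leOfHom f, hxW, ?_⟩
  have h2 : (presheafTensor M N).presheaf.map f.op t = (presheafTensor M N).presheaf.map f.op 0 := hf
  rw [map_zero] at h2
  exact h2

lemma toTensor_locally_surjective (s : Γ(tensor M N, V)) : ∀ x ∈ V, ∃ (W : X.Opens) (hW : W ≤ V),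
    x ∈ W ∧ ∃ t : TensorProduct Γ(X, W) Γ(M, W) Γ(N, W),
      (toTensor M N).app (.op W) t = res hW s := by
  have : Presheaf.IsLocallySurjective (Opens.grothendieckTopology X)
    (CategoryTheory.toSheafify (Opens.grothendieckTopology X) (presheafTensor M N).presheaf) :=
    inferInstance
  have h := Presheaf.imageSieve_mem (Opens.grothendieckTopology X)
    (CategoryTheory.toSheafify (Opens.grothendieckTopology X) (presheafTensor M N).presheaf)
    (U := .op V) s
  intro x hx
  obtain ⟨W, f, ⟨t, ht⟩, hxW⟩ := h x hx
  exact ⟨W, leOfHom f, hxW, t, ht⟩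

/-- If `ℓ` generates `M` freely on `V`, then `n ↦ ℓ ⊗ n` is a bijection `N(W) → (M ⊗ N)(W)` for
all `W ≤ V`. -/
theorem IsGenerator.tmul_bijective {ℓ : Γ(M, V)} (h : IsGenerator ℓ V le_rfl) (hW : W ≤ V) :
    Function.Bijective fun n : Γ(N, W) => tmul (EquivSurj.res hW ℓ) n := by
  have inj : ∀ (W : X.Opens) (hW : W ≤ V), Function.Injective
      fun n : Γ(N, W) => tmul (EquivSurj.res hW ℓ) n := by
    intro W hW
    have h0 : ∀ n : Γ(N, W), tmul (EquivSurj.res hW ℓ) n = 0 → n = 0 := by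
      intro n hn
      refine section_ext fun x hx => ?_
      obtain ⟨W', hW', hxW', e⟩ := toTensor_locally_injective (M := M) (N := N) hn x hx
      refine ⟨W', hW', hxW', ?_⟩
      rw [map_zero]
      refine (h.res (hW'.trans hW)).tensor_injective ?_
      rw [← res_res hW hW']
      exact e
    intro n n' e
    have e' : tmul (EquivSurj.res hW ℓ) n = tmul (EquivSurj.res hW ℓ) n' := e
    have := h0 (n - n') (by
      have e2 := tmul_add (EquivSurj.res hW ℓ) (n - n') n'
      rw [sub_add_cancel, e'] at e2
      exact left_eq_add.mp (e2.trans (add_comm _ _)) )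
    exact sub_eq_zero.mp this
  refine ⟨inj W hW, fun s => ?_⟩
  have loc : ∀ x : W, ∃ (W' : X.Opens) (hW' : W' ≤ W), x.1 ∈ W' ∧ ∃ n : Γ(N, W'),
      tmul (EquivSurj.res (hW'.trans hW) ℓ) n = EquivSurj.res hW' s := by
    intro x
    obtain ⟨W', hW', hx, t, ht⟩ := toTensor_locally_surjective s x.1 x.2
    obtain ⟨n, rfl⟩ := (h.res (hW'.trans hW)).tensor_exists t
    exact ⟨W', hW', hx, n, ht⟩
  choose W' hW' hx n hn using loc
  -- Injectivity on the overlaps forces the locally found preimages to agree there.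
  obtain ⟨t, ht⟩ := section_glue hW' (fun x hxW => ⟨⟨x, hxW⟩, hx _⟩) n (fun x y => by
    refine inj (W' x ⊓ W' y) (inf_le_left.trans ((hW' x).trans hW)) ?_
    have e1 := res_tmul (inf_le_left : W' x ⊓ W' y ≤ W' x)
      (EquivSurj.res ((hW' x).trans hW) ℓ) (n x)
    have e2 := res_tmul (inf_le_right : W' x ⊓ W' y ≤ W' y)
      (EquivSurj.res ((hW' y).trans hW) ℓ) (n y)
    rw [hn, res_res, res_res] at e1 e2
    exact e1.symm.trans e2)
  refine ⟨t, section_ext fun x hxW => ⟨W' ⟨x, hxW⟩, hW' _, hx _, ?_⟩⟩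
  rw [res_tmul, res_res, ht, hn]

end Generator

/-! ### Quasi-coherence of inverse images and of twists. -/

section Quasicoherent

variable {X Y : Scheme.{u}}

/-- Transport of a presentation along an isomorphism. -/
def presentationOfIso {M N : X.Modules} (e : M ≅ N) (p : M.Presentation) : N.Presentation :=
  have : IsIso (C := SheafOfModules X.ringCatSheaf) e.hom := e.isIso_hom
  SheafOfModules.Presentation.ofIsIso.{u, u, u} e.hom p

/-- The image of a presentation under a functor that preserves colimits and structure sheaves. -/
def presentationMap (Φ : Y.Modules ⥤ X.Modules) (hΦ : PreservesColimitsOfSize.{u, u} Φ)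
    (η : SheafOfModules.unit X.ringCatSheaf ≅ Φ.obj (SheafOfModules.unit Y.ringCatSheaf))
    {M : Y.Modules} (p : M.Presentation) : (Φ.obj M).Presentation :=
  let Φ' : SheafOfModules.{u} Y.ringCatSheaf ⥤ SheafOfModules.{u} X.ringCatSheaf := Φ
  have : PreservesColimitsOfSize.{u, u} Φ' := hΦ
  p.map Φ' η

/-- Taking preimages preserves the largest open set; finality is what identifies the inverse image
of the structure sheaf in `pullbackUnitIso`. -/
instance (a : X ⟶ Y) : (TopologicalSpace.Opens.map a.base).Final :=
  have : PreservesLimit (Functor.empty.{0} Y.Opens) (TopologicalSpace.Opens.map a.base) :=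
    preservesTerminal_of_iso _
      ((TopologicalSpace.Opens.map a.base).mapIso (terminalIsTerminal.uniqueUpToIso isTerminalTop) ≪≫
        (isTerminalTop (α := X.Opens)).uniqueUpToIso terminalIsTerminal)
  inferInstance

/-- The inverse image of the structure sheaf. -/
def pullbackUnitIso (a : X ⟶ Y) :
    (Scheme.Modules.pullback a).obj (SheafOfModules.unit Y.ringCatSheaf) ≅
      SheafOfModules.unit X.ringCatSheaf :=
  have : (SheafOfModules.pushforward.{u} a.toRingCatSheafHom).IsRightAdjoint :=
    inferInstanceAs (Scheme.Modules.pushforward a).IsRightAdjoint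
  have : IsIso (SheafOfModules.pullbackObjUnitToUnit.{u} a.toRingCatSheafHom) :=
    SheafOfModules.instIsIsoPullbackObjUnitToUnitOfFinal _
  (asIso (SheafOfModules.pullbackObjUnitToUnit.{u} a.toRingCatSheafHom) :)

/-- The inverse image of a presentation. -/
def presentationPullback (a : X ⟶ Y) {M : Y.Modules} (p : M.Presentation) :
    ((Scheme.Modules.pullback a).obj M).Presentation :=
  presentationMap (Scheme.Modules.pullback a)
   (Scheme.Modules.pullbackPushforwardAdjunction a).leftAdjoint_preservesColimits
    (pullbackUnitIso a).symm p

/-- A sheaf of modules which locally has a presentation is quasi-coherent. -/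
lemma isQuasicoherent_of_local_presentation (N : X.Modules)
    (h : ∀ x : X, ∃ U : X.Opens, x ∈ U ∧ Nonempty (N.restrict U.ι).Presentation) :
    N.IsQuasicoherent := by
  choose U hxU pres using h
  refine SheafOfModules.QuasicoherentData.isQuasicoherent (M := N)
    { I := X, X := U, coversTop := ?_, presentation := fun x => ?_ }
  · rw [Opens.coversTop_iff]
    exact top_le_iff.mp fun x _ => TopologicalSpace.Opens.mem_iSup.mpr ⟨x, hxU x⟩
  · let e := Scheme.Modules.overEquiv (U x)
    let i2 : e.inverse.obj (N.restrict (U x).ι) ≅ N.over (U x) :=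
      e.inverse.mapIso ((Scheme.Modules.overFunctorEquiv (U x)).symm.app N) ≪≫
        e.unitIso.symm.app (N.over (U x))
    let Φ : SheafOfModules.{u} (U x).toScheme.ringCatSheaf ⥤
      SheafOfModules.{u} (X.ringCatSheaf.over (U x)) := e.inverse
    have : PreservesColimitsOfSize.{u, u} Φ := e.symm.toAdjunction.leftAdjoint_preservesColimits
    exact SheafOfModules.Presentation.ofIsIso.{u, u, u} i2.hom
      ((pres x).some.map Φ
        (TopologicalSpace.Opens.sheafOfModulesEquivOverInverseUnit (U x) X.ringCatSheaf).symm)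

/-- The inverse image of the restriction to an open subset. -/
def pullbackRestrictIso (a : X ⟶ Y) (V : Y.Opens) (M : Y.Modules) :
    (Scheme.Modules.pullback (a ∣_ V)).obj (M.restrict V.ι) ≅
      ((Scheme.Modules.pullback a).obj M).restrict (a ⁻¹ᵁ V).ι :=
  (Scheme.Modules.pullback (a ∣_ V)).mapIso ((Scheme.Modules.restrictFunctorIsoPullback V.ι).app M)
    ≪≫ (Scheme.Modules.pullbackComp (a ∣_ V) V.ι).app M ≪≫
    (Scheme.Modules.pullbackCongr (morphismRestrict_ι a V)).app M ≪≫
    ((Scheme.Modules.pullbackComp (a ⁻¹ᵁ V).ι a).app M).symm ≪≫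
    ((Scheme.Modules.restrictFunctorIsoPullback (a ⁻¹ᵁ V).ι).app _).symm

/-- The inverse image of a quasi-coherent sheaf is quasi-coherent. -/
instance isQuasicoherent_pullback (a : X ⟶ Y) (M : Y.Modules) [M.IsQuasicoherent] :
    ((Scheme.Modules.pullback a).obj M).IsQuasicoherent := by
  obtain ⟨ι, U, pres, hU, -⟩ := M.exists_isOpenCover_presentation
  refine isQuasicoherent_of_local_presentation _ fun x => ?_
  obtain ⟨i, hi⟩ := TopologicalSpace.Opens.mem_iSup.mp
    ((show iSup U = ⊤ from hU) ▸ TopologicalSpace.Opens.mem_top (a x) : a x ∈ iSup U)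
  exact ⟨a ⁻¹ᵁ U i, hi, ⟨presentationOfIso (pullbackRestrictIso a (U i) M)
    (presentationPullback _ (pres i))⟩⟩

/-- A compatible family of linear maps on sections is a morphism of sheaves of modules. -/
def homMk {M N : X.Modules} (φ : ∀ U : X.Opens, Γ(M, U) →ₗ[Γ(X, U)] Γ(N, U))
    (hφ : ∀ {U V : X.Opens} (h : V ≤ U) (s : Γ(M, U)), φ V (res h s) = res h (φ U s)) : M ⟶ N :=
  ⟨{ app := fun U => ModuleCat.ofHom (φ U.unop)
     naturality := fun {U V} j => by
      ext s
      exact hφ (leOfHom j.unop) s }⟩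

/-- Tensoring with a generator of `L` identifies the restrictions of `F` and `L ⊗ F`. -/
def IsGenerator.restrictIso {L F : X.Modules} {V : X.Opens} {ℓ : Γ(L, V)}
    (h : IsGenerator ℓ V le_rfl) : F.restrict V.ι ≅ (tensor L F).restrict V.ι := by
  have hle : ∀ U : V.toScheme.Opens, V.ι ''ᵁ U ≤ V := fun U => V.ι_image_le U
  let φ : F.restrict V.ι ⟶ (tensor L F).restrict V.ι :=
    homMk (fun U =>
      { toFun := fun n => tmul (U := V.ι ''ᵁ U) (EquivSurj.res (hle U) ℓ) n
        map_add' := fun n n' => tmul_add (U := V.ι ''ᵁ U) _ _ _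
        map_smul' := fun r n => tmul_smul (U := V.ι ''ᵁ U) _ _ _ })
      (fun {U W} hW s => by
        have e := res_tmul (V.ι.image_mono hW) (EquivSurj.res (hle U) ℓ) (show Γ(F, V.ι ''ᵁ U) from s)
        rw [res_res] at e
        exact e.symm)
  have : IsIso φ := by
    rw [Scheme.Modules.Hom.isIso_iff_isIso_app]
    intro U
    rw [ConcreteCategory.isIso_iff_bijective]
    exact h.tmul_bijective (hle U)
  exact asIso φ

/-- Where `L` has a generator, `L ⊗ F` is isomorphic to `F`, so presentations of `F` carry over. -/
lemma isQuasicoherent_tensor {L F : X.Modules} [F.IsQuasicoherent] (hL : IsLineBundle L) :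
    (tensor L F).IsQuasicoherent := by
  obtain ⟨ι, U, pres, hU, -⟩ := F.exists_isOpenCover_presentation
  refine isQuasicoherent_of_local_presentation _ fun x => ?_
  obtain ⟨i, hi⟩ := TopologicalSpace.Opens.mem_iSup.mp
    ((show iSup U = ⊤ from hU) ▸ TopologicalSpace.Opens.mem_top x : x ∈ iSup U)
  obtain ⟨V, ℓ, hxV, hℓ⟩ := hL x
  refine ⟨V ⊓ U i, ⟨hxV, hi⟩, ⟨?_⟩⟩
  let j : (V ⊓ U i).toScheme ⟶ (U i).toScheme := X.homOfLE inf_le_right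
  exact presentationOfIso ((Scheme.Modules.restrictFunctorComp j (U i).ι).symm.app F ≪≫
    (Scheme.Modules.restrictFunctorCongr (by simp [j])).app F ≪≫
      (hℓ.res inf_le_left).restrictIso) (Scheme.Modules.presentationRestrict j (pres i))

end Quasicoherent

/-! ### Morphisms from quasi-coherent sheaves on affine opens. -/

section Affine

variable {X : Scheme.{u}} {R : CommRingCat.{u}}

/-- The counit of the tilde adjunction is an isomorphism at a quasi-coherent sheaf, so morphisms out
of it amount to linear maps on global sections. -/
lemma spec_hom_ext {K E : (Spec R).Modules} [K.IsQuasicoherent] {φ χ : K ⟶ E}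
    (h : ∀ s, φ.app ⊤ s = χ.app ⊤ s) : φ = χ := by
  have : IsIso (tilde.adjunction.counit.app K) :=
    inferInstanceAs (IsIso K.fromTildeΓ)
  have e : moduleSpecΓFunctor.map φ = moduleSpecΓFunctor.map χ := by
    ext s
    exact h s
  rw [← cancel_epi (tilde.adjunction.counit.app K)]
  have h1 := tilde.adjunction.counit.naturality φ
  have h2 := tilde.adjunction.counit.naturality χ
  dsimp at h1 h2
  rw [← h1, ← h2, e]

lemma spec_hom_exists {K E : (Spec R).Modules} [K.IsQuasicoherent]
    (l : Γ(K, (⊤ : (Spec R).Opens)) →ₗ[R] Γ(E, (⊤ : (Spec R).Opens))) :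
    ∃ φ : K ⟶ E, ∀ s, φ.app ⊤ s = l s := by
  have : IsIso (tilde.adjunction.counit.app K) :=
    inferInstanceAs (IsIso K.fromTildeΓ)
  let l' : moduleSpecΓFunctor.obj K ⟶ moduleSpecΓFunctor.obj E :=
    show (modulesSpecToSheaf.obj K).obj.obj (.op ⊤) ⟶ (modulesSpecToSheaf.obj E).obj.obj (.op ⊤)
    from ModuleCat.ofHom (X := (modulesSpecToSheaf.obj K).obj.obj (.op ⊤))
      (Y := (modulesSpecToSheaf.obj E).obj.obj (.op ⊤)) l
  let φ : K ⟶ E := inv (tilde.adjunction.counit.app K) ≫ (tilde.adjunction.homEquiv _ _).symm l'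
  have e : moduleSpecΓFunctor.map φ = l' := by
    have h := (tilde.adjunction.homEquiv _ _).apply_symm_apply l'
    rw [Adjunction.homEquiv_unit] at h
    have h3 := tilde.adjunction.right_triangle_components K
    rw [← h]
    dsimp only [φ]
    rw [Functor.map_comp]
    congr 1
    rw [Functor.map_inv]
    exact IsIso.inv_eq_of_inv_hom_id h3
  exact ⟨φ, fun s => (congrArg (fun q => q.hom s) e : _)⟩

variable {W : X.Opens} (hW : IsAffineOpen W)

lemma fromSpec_image_top : hW.fromSpec ''ᵁ ⊤ = W := by
  rw [Scheme.Hom.image_top_eq_opensRange, hW.opensRange_fromSpec]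

lemma top_le_fromSpec_preimage : ⊤ ≤ hW.fromSpec ⁻¹ᵁ W := hW.fromSpec_preimage_self.ge

lemma fromSpec_appIso_inv (r : Γ(X, W)) :
    (hW.fromSpec.appIso ⊤).inv ((Scheme.ΓSpecIso Γ(X, W)).inv r) =
      rres (fromSpec_image_top hW).le r := by
  rw [← ConcreteCategory.comp_apply]
  have h := hW.fromSpec.appLE_appIso_inv (top_le_fromSpec_preimage hW)
  have h2 : hW.fromSpec.appLE W ⊤ (top_le_fromSpec_preimage hW) = (Scheme.ΓSpecIso Γ(X, W)).inv := by
    rw [Scheme.Hom.appLE, hW.fromSpec_app_self, Category.assoc, ← Functor.map_comp]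
    exact ((Scheme.ΓSpecIso Γ(X, W)).inv ≫= (Spec Γ(X, W)).presheaf.map_id _).trans
      (Category.comp_id _)
  rw [← h2, h]
  rfl

lemma spec_smul_top {E : (Spec R).Modules} (r : R) (s : Γ(E, (⊤ : (Spec R).Opens))) :
    r • s = (Scheme.ΓSpecIso R).inv r • s := by
  rw [Scheme.Modules.smul_Spec_def]
  congr 1

/-- A morphism from a quasi-coherent sheaf to a direct image from an affine open subset is
determined by its effect on the sections over that open subset. -/
lemma affine_hom_ext {K : X.Modules} [K.IsQuasicoherent] {E : (Spec Γ(X, W)).Modules}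
    {φ χ : K ⟶ (Scheme.Modules.pushforward hW.fromSpec).obj E}
    (h : ∀ s, φ.app W s = χ.app W s) : φ = χ := by
  apply ((Scheme.Modules.restrictAdjunction hW.fromSpec).homEquiv _ _).symm.injective
  refine spec_hom_ext fun s => ?_
  rw [Adjunction.homEquiv_counit, Adjunction.homEquiv_counit]
  simp only [Scheme.Modules.Hom.comp_app]
  have h2 : ∀ (W' : X.Opens) (e : W' = W) (s : Γ(K, W')), φ.app W' s = χ.app W' s := by
    rintro W' rfl
    exact h
  have h3 : ((Scheme.Modules.restrictFunctor hW.fromSpec).map φ).app ⊤ s =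
    ((Scheme.Modules.restrictFunctor hW.fromSpec).map χ).app ⊤ s := h2 _ (fromSpec_image_top hW) s
  exact congrArg _ h3

/-- A linear map from the sections over an affine open subset of a quasi-coherent sheaf extends
to a morphism to the direct image. -/
lemma affine_hom_exists {K : X.Modules} [K.IsQuasicoherent] {E : (Spec Γ(X, W)).Modules}
    (l : Γ(K, W) →ₗ[Γ(X, W)] Γ(E, (⊤ : (Spec Γ(X, W)).Opens))) :
    ∃ φ : K ⟶ (Scheme.Modules.pushforward hW.fromSpec).obj E,
      ∀ s, res (M := E) (top_le_fromSpec_preimage hW) (φ.app W s) = l s := by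
  let l' : Γ(K.restrict hW.fromSpec, (⊤ : (Spec Γ(X, W)).Opens)) →ₗ[Γ(X, W)]
      Γ(E, (⊤ : (Spec Γ(X, W)).Opens)) :=
    { toFun := fun s => l (res (M := K) (fromSpec_image_top hW).ge s)
      map_add' := fun s t => by
        have := map_add (res (M := K) (fromSpec_image_top hW).ge) s t
        exact (congrArg l this).trans (map_add l _ _)
      map_smul' := fun r s => by
        rw [spec_smul_top]
        have := res_smul (M := K) (fromSpec_image_top hW).ge
          ((hW.fromSpec.appIso ⊤).inv ((Scheme.ΓSpecIso Γ(X, W)).inv r)) s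
        rw [fromSpec_appIso_inv, rres_rres, rres_rfl] at this
        refine (congrArg l ?_).trans (map_smul l r _)
        rw [← this, ← fromSpec_appIso_inv]
        rfl }
  obtain ⟨φ, hφ⟩ := spec_hom_exists l'
  refine ⟨(Scheme.Modules.restrictAdjunction hW.fromSpec).homEquiv _ _ φ, fun s => ?_⟩
  rw [Adjunction.homEquiv_unit]
  have h0 : ((Scheme.Modules.restrictAdjunction hW.fromSpec).unit.app K ≫
      (Scheme.Modules.pushforward hW.fromSpec).map φ).app W s =
      φ.app (hW.fromSpec ⁻¹ᵁ W) (res (M := K) (hW.fromSpec.image_preimage_le W) s) := rfl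
  rw [h0]
  refine (app_res φ (top_le_fromSpec_preimage hW) _).symm.trans ?_
  refine (hφ _).trans (congrArg l ?_)
  refine Eq.trans ?_ (res_rfl le_rfl s)
  have h1 := res_res (M := K) (hW.fromSpec.image_preimage_le W)
    (hW.fromSpec.image_mono (top_le_fromSpec_preimage hW)) s
  have h2 := res_res (M := K) ((hW.fromSpec.image_mono (top_le_fromSpec_preimage hW)).trans
    (hW.fromSpec.image_preimage_le W)) (fromSpec_image_top hW).ge s
  rw [← h2, ← h1]
  rfl

end Affine

/-! ### Inverse images along closed immersions: i^* M is M/IM on affine opens. -/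

section PullbackAffine

variable {A X : Scheme.{u}} (i : A ⟶ X) {U : X.Opens} (hU : IsAffineOpen U)
  (hV : IsAffineOpen (i ⁻¹ᵁ U)) (M : X.Modules) [M.IsQuasicoherent]

lemma SpecMap_app_fromSpec :
    Spec.map (i.app U) ≫ hU.fromSpec = hV.fromSpec ≫ i := by
  rw [← hU.SpecMap_appLE_fromSpec i hV le_rfl, Scheme.Hom.app_eq_appLE]

/-- The canonical isomorphism between two direct images. -/
def pushforwardSquareIso (E : (Spec Γ(A, i ⁻¹ᵁ U)).Modules) :
    (Scheme.Modules.pushforward i).obj ((Scheme.Modules.pushforward hV.fromSpec).obj E) ≅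
      (Scheme.Modules.pushforward hU.fromSpec).obj
        ((Scheme.Modules.pushforward (Spec.map (i.app U))).obj E) :=
  (Scheme.Modules.pushforwardComp hV.fromSpec i).app E ≪≫
    (Scheme.Modules.pushforwardCongr (SpecMap_app_fromSpec i hU hV).symm).app E ≪≫
    ((Scheme.Modules.pushforwardComp (Spec.map (i.app U)) hU.fromSpec).app E).symm

/-- The unit `M ⟶ i_* i^* M`. -/
abbrev unitOf (M : X.Modules) :
    M ⟶ (Scheme.Modules.pushforward i).obj ((Scheme.Modules.pullback i).obj M) :=
  (Scheme.Modules.pullbackPushforwardAdjunction i).unit.app M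

/-- The map `M(U) → (i^* M)(i⁻¹ U)`. -/
def unitApp (M : X.Modules) (U : X.Opens) :
    Γ(M, U) →+ Γ((Scheme.Modules.pullback i).obj M, i ⁻¹ᵁ U) :=
  ((unitOf i M).app U).hom

lemma unitApp_smul (M : X.Modules) {U : X.Opens} (r : Γ(X, U)) (m : Γ(M, U)) :
    unitApp i M U (r • m) = i.app U r • unitApp i M U m :=
  pushforward_app_smul (unitOf i M) r m

lemma res_unitApp (M : X.Modules) {U V : X.Opens} (h : V ≤ U) (m : Γ(M, U)) :
    res (i.preimage_mono h) (unitApp i M U m) = unitApp i M V (res h m) :=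
  (pushforward_app_res (unitOf i M) h m).symm

lemma smul_pushforward_SpecMap {R S : CommRingCat.{u}} (φ : R ⟶ S) {E : (Spec S).Modules} (r : R)
    (s : Γ(E, (⊤ : (Spec S).Opens))) :
    (r • (show Γ((Scheme.Modules.pushforward (Spec.map φ)).obj E, (⊤ : (Spec R).Opens)) from s)) =
      (φ r • s : Γ(E, (⊤ : (Spec S).Opens))) := by
  rw [spec_smul_top, spec_smul_top]
  have : (Spec.map φ).app ⊤ ((Scheme.ΓSpecIso R).inv r) = (Scheme.ΓSpecIso S).inv (φ r) :=
    congr($(Scheme.ΓSpecIso_inv_naturality φ) r).symm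
  rw [← this]
  rfl

lemma res_injective_of_eq {X : Scheme.{u}} {M : X.Modules} {U V : X.Opens} (h : V ≤ U)
    (e : V = U) : Function.Injective (res (M := M) h) := by
  subst e
  intro s t hst
  simpa using hst

lemma exists_sheaf_of_module (R : CommRingCat.{u}) (Q : Type u) [AddCommGroup Q] [Module R Q] :
    ∃ E : (Spec R).Modules, Nonempty (Q ≃ₗ[R] Γ(E, (⊤ : (Spec R).Opens))) :=
  ⟨tilde (ModuleCat.of R Q), ⟨(tilde.isoTop (ModuleCat.of R Q)).toLinearEquiv⟩⟩

include hU hV in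
/-- Along a closed immersion, the unit is surjective on sections over affine open subsets. -/
lemma unit_surjective (hs : Function.Surjective (i.app U)) :
    Function.Surjective (unitApp i M U) := by
  -- The image `T` is a submodule over O(i⁻¹U) because `i.app U` is surjective. The projection P →
  -- P/T extends to a morphism `χ` out of i^* M. Its adjoint vanishes on M(U), so `χ` is zero and
  -- P/T = 0.
  let P := Γ((Scheme.Modules.pullback i).obj M, i ⁻¹ᵁ U)
  let T : Submodule Γ(A, i ⁻¹ᵁ U) P :=
    { carrier := {p | ∃ m : Γ(M, U), unitApp i M U m = p}
      add_mem' := by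
        rintro _ _ ⟨m, rfl⟩ ⟨m', rfl⟩
        exact ⟨m + m', map_add (unitApp i M U) m m'⟩
      zero_mem' := ⟨0, map_zero (unitApp i M U)⟩
      smul_mem' := by
        rintro c _ ⟨m, rfl⟩
        obtain ⟨b, rfl⟩ := hs c
        exact ⟨b • m, unitApp_smul i M b m⟩ }
  obtain ⟨E, ⟨e⟩⟩ := exists_sheaf_of_module Γ(A, i ⁻¹ᵁ U) (P ⧸ T)
  obtain ⟨χ, hχ⟩ := affine_hom_exists hV (K := (Scheme.Modules.pullback i).obj M) (E := E)
    (e.toLinearMap ∘ₗ T.mkQ)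
  have h0 : unitOf i M ≫ (Scheme.Modules.pushforward i).map χ = 0 := by
    rw [← cancel_mono (pushforwardSquareIso i hU hV E).hom]
    refine affine_hom_ext hU fun s => ?_
    have h1 : χ.app (i ⁻¹ᵁ U) (unitApp i M U s) = 0 := by
      refine res_injective_of_eq (top_le_fromSpec_preimage hV) hV.fromSpec_preimage_self.symm ?_
      have : T.mkQ (unitApp i M U s) = 0 := (Submodule.Quotient.mk_eq_zero T).mpr ⟨s, rfl⟩
      exact (hχ _).trans ((congrArg e this).trans ((map_zero e).trans (map_zero (res _)).symm))
    exact congrArg (fun t => (pushforwardSquareIso i hU hV E).hom.app U t) h1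
  have h1 : χ = 0 := by
    apply ((Scheme.Modules.pullbackPushforwardAdjunction i).homEquiv _ _).injective
    rw [Adjunction.homEquiv_unit, h0, Adjunction.homEquiv_unit, Functor.map_zero, comp_zero]
  intro p
  have h2 := hχ p
  rw [h1] at h2
  have h3 : T.mkQ p = 0 := by
    apply e.injective
    rw [map_zero]
    exact h2.symm.trans (map_zero _)
  exact (Submodule.Quotient.mk_eq_zero T).mp h3

include hU hV in
/-- Along a closed immersion with ideal `I`, the kernel of the unit on sections over an affine
open subset is `I M(U)`. -/
lemma unit_eq_zero_iff (hs : Function.Surjective (i.app U)) (m : Γ(M, U)) :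
    unitApp i M U m = 0 ↔
      m ∈ (RingHom.ker (i.app U).hom • ⊤ : Submodule Γ(X, U) Γ(M, U)) := by
  constructor
  · intro hm
    let I := RingHom.ker (i.app U).hom
    let Q := Γ(M, U) ⧸ (I • ⊤ : Submodule Γ(X, U) Γ(M, U))
    let ε := RingHom.quotientKerEquivOfSurjective (f := (i.app U).hom) hs
    -- M(U)/I M(U) is a module over O(i⁻¹U) = O(U)/I. By adjunction the projection onto it factors
    -- through the unit, whose kernel is therefore contained in I M(U).
    let _ : Module Γ(A, i ⁻¹ᵁ U) Q := Module.compHom Q ε.symm.toRingHom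
    have hsm : ∀ (b : Γ(X, U)) (m : Γ(M, U)), (i.app U b) • (Submodule.Quotient.mk m : Q) =
        Submodule.Quotient.mk (b • m) := by
      intro b m
      have : ε.symm (i.app U b) = Ideal.Quotient.mk I b := by
        rw [RingEquiv.symm_apply_eq]
        rfl
      change ε.symm (i.app U b) • (Submodule.Quotient.mk m : Q) = _
      rw [this]
      rfl
    obtain ⟨E, ⟨e⟩⟩ := exists_sheaf_of_module Γ(A, i ⁻¹ᵁ U) Q
    let E' := (Scheme.Modules.pushforward (Spec.map (i.app U))).obj E
    let l : Γ(M, U) →ₗ[Γ(X, U)] Γ(E', (⊤ : (Spec Γ(X, U)).Opens)) :=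
      { toFun := fun m => e (Submodule.Quotient.mk m)
        map_add' := fun m m' => map_add e (Submodule.Quotient.mk m) (Submodule.Quotient.mk m')
        map_smul' := fun b m => by
          refine (congrArg e (hsm b m).symm).trans ((map_smul e _ _).trans ?_)
          exact (smul_pushforward_SpecMap (i.app U) b (e (Submodule.Quotient.mk m))).symm }
    obtain ⟨φ, hφ⟩ := affine_hom_exists hU (K := M) (E := E') l
    let χ := ((Scheme.Modules.pullbackPushforwardAdjunction i).homEquiv _ _).symm
      (φ ≫ (pushforwardSquareIso i hU hV E).inv)
    have h1 : unitOf i M ≫ (Scheme.Modules.pushforward i).map χ ≫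
        (pushforwardSquareIso i hU hV E).hom = φ := by
      have := ((Scheme.Modules.pullbackPushforwardAdjunction i).homEquiv _ _).apply_symm_apply
        (φ ≫ (pushforwardSquareIso i hU hV E).inv)
      rw [Adjunction.homEquiv_unit] at this
      rw [← Category.assoc, this, Category.assoc, Iso.inv_hom_id, Category.comp_id]
    have h2 : φ.app U m = 0 := by
      rw [← h1]
      refine Eq.trans (b := (pushforwardSquareIso i hU hV E).hom.app U (χ.app (i ⁻¹ᵁ U)
        (unitApp i M U m))) rfl ?_
      rw [hm]
      exact (congrArg _ (map_zero (χ.app (i ⁻¹ᵁ U)).hom)).trans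
        (map_zero ((pushforwardSquareIso i hU hV E).hom.app U).hom)
    have h3 : e (Submodule.Quotient.mk m) = 0 := by
      refine (hφ m).symm.trans ?_
      rw [h2]
      exact map_zero _
    rw [map_eq_zero_iff _ e.injective] at h3
    exact (Submodule.Quotient.mk_eq_zero _).mp h3
  · intro hm
    induction hm using Submodule.smul_induction_on' with
    | smul r hr n hn =>
      have : i.app U r = 0 := hr
      rw [unitApp_smul, this, zero_smul]
    | add x hx y hy ex ey => rw [map_add, ex, ey, add_zero]

end PullbackAffine

/-! ### Sections over principal open subsets. -/

section Localization

variable {X : Scheme.{u}} {W : X.Opens} (hW : IsAffineOpen W) (M : X.Modules) [M.IsQuasicoherent]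

omit [M.IsQuasicoherent] in
lemma restrict_fromSpec_smul (r : Γ(X, W)) (V : (Spec Γ(X, W)).Opens)
    (s : Γ(M.restrict hW.fromSpec, V)) (h : hW.fromSpec ''ᵁ V ≤ W) :
    (r • s : Γ(M.restrict hW.fromSpec, V)) =
      (rres h r • (show Γ(M, hW.fromSpec ''ᵁ V) from s) : Γ(M, hW.fromSpec ''ᵁ V)) := by
  rw [Scheme.Modules.smul_Spec_def]
  refine congrArg (fun t : Γ(X, hW.fromSpec ''ᵁ V) => t • (show Γ(M, hW.fromSpec ''ᵁ V) from s)) ?_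
  have h1 := ConcreteCategory.congr_hom (hW.fromSpec.appIso_inv_naturality (homOfLE le_top : V ⟶ ⊤).op)
    ((Scheme.ΓSpecIso Γ(X, W)).inv r)
  refine h1.trans ?_
  have h2 := fromSpec_appIso_inv hW r
  refine (congrArg (X.presheaf.map _) h2).trans ?_
  exact rres_rres (fromSpec_image_top hW).le (hW.fromSpec.image_mono le_top) r

include hW in
/-- Sections of a quasi-coherent sheaf over a principal open subset are localizations. -/
lemma isLocalizedModule_aux (c : Γ(X, W)) :
    IsLocalizedModule (.powers c) ((modulesSpecToSheaf.obj (M.restrict hW.fromSpec)).obj.map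
      (PrimeSpectrum.basicOpen c).leTop.op).hom :=
  (isIso_fromTildeΓ_iff_isLocalizing (M.restrict hW.fromSpec)).mp inferInstance c

include hW in
lemma exists_pow_smul_eq_zero {c : Γ(X, W)} {m : Γ(M, W)}
    (hm : res (X.basicOpen_le c) m = 0) : ∃ n : ℕ, c ^ n • m = 0 := by
  have hloc := isLocalizedModule_aux hW M c
  have e1 := fromSpec_image_top hW
  have e2 := hW.fromSpec_image_basicOpen c
  let m' : Γ(M.restrict hW.fromSpec, (⊤ : (Spec Γ(X, W)).Opens)) := res (M := M) e1.le m
  have h0 : ((modulesSpecToSheaf.obj (M.restrict hW.fromSpec)).obj.map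
      (PrimeSpectrum.basicOpen c).leTop.op).hom m' =
      ((modulesSpecToSheaf.obj (M.restrict hW.fromSpec)).obj.map
      (PrimeSpectrum.basicOpen c).leTop.op).hom 0 := by
    rw [map_zero]
    have := res_res (M := M) e1.le (W := hW.fromSpec ''ᵁ (PrimeSpectrum.basicOpen c))
      (hW.fromSpec.image_mono le_top) m
    refine this.trans ?_
    rw [← res_res (M := M) (X.basicOpen_le c) e2.le, hm]
    exact map_zero _
  obtain ⟨⟨_, n, rfl⟩, hn⟩ := (IsLocalizedModule.eq_iff_exists (.powers c) _).mp h0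
  refine ⟨n, res_injective_of_eq e1.le e1 ?_⟩
  rw [map_zero, res_smul]
  have h1 : (c ^ n • m' : Γ(M.restrict hW.fromSpec, (⊤ : (Spec Γ(X, W)).Opens))) = 0 := by
    refine hn.trans ?_
    exact smul_zero _
  rw [restrict_fromSpec_smul hW M (c ^ n) ⊤ m' e1.le] at h1
  exact h1

include hW in
lemma exists_extend_pow_smul {c : Γ(X, W)} (m : Γ(M, X.basicOpen c)) :
    ∃ (n : ℕ) (m' : Γ(M, W)),
      res (X.basicOpen_le c) m' = rres (X.basicOpen_le c) c ^ n • m := by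
  obtain ⟨D, hD⟩ : ∃ D : (Spec Γ(X, W)).Opens, D = PrimeSpectrum.basicOpen c := ⟨_, rfl⟩
  have hloc : IsLocalizedModule (.powers c)
      ((modulesSpecToSheaf.obj (M.restrict hW.fromSpec)).obj.map D.leTop.op).hom := by
    subst hD
    exact isLocalizedModule_aux hW M c
  have e1 := fromSpec_image_top hW
  have e2 : hW.fromSpec ''ᵁ D = X.basicOpen c := hD ▸ hW.fromSpec_image_basicOpen c
  let m' : Γ(M.restrict hW.fromSpec, D) := res (M := M) e2.le m
  obtain ⟨⟨t, ⟨_, n, rfl⟩⟩, hn⟩ := hloc.surj m'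
  refine ⟨n, res (M := M) e1.ge t, res_injective_of_eq e2.le e2 ?_⟩
  let t' : Γ(M, hW.fromSpec ''ᵁ ⊤) := t
  change res e2.le (res (X.basicOpen_le c) (res e1.ge t')) = _
  rw [res_res, res_res, res_smul]
  have h1 := restrict_fromSpec_smul hW M (c ^ n) _ m' (e2.le.trans (X.basicOpen_le c))
  rw [← map_pow, rres_rres]
  exact hn.symm.trans h1

end Localization

/-! ### Finiteness of sections over affine opens. -/

section Finite

variable {X : Scheme.{u}} (M : X.Modules)

/-- The quotient by the span defines a sheaf, and the morphism from `K` to it vanishes after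
composition with the epimorphism `σ.π` from a free sheaf. Hence the quotient is zero. -/
lemma span_generatingSections_eq_top {R : CommRingCat.{u}} {K : (Spec R).Modules}
    [K.IsQuasicoherent] (σ : K.GeneratingSections) :
    Submodule.span R (Set.range fun i => (show Γ(K, (⊤ : (Spec R).Opens)) from
      (σ.s i).val (.op ⊤))) = ⊤ := by
  set T := Submodule.span R (Set.range fun i => (show Γ(K, (⊤ : (Spec R).Opens)) from
      (σ.s i).val (.op ⊤))) with hT
  obtain ⟨E, ⟨e⟩⟩ := exists_sheaf_of_module R (Γ(K, (⊤ : (Spec R).Opens)) ⧸ T)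
  obtain ⟨χ, hχ⟩ := spec_hom_exists (e.toLinearMap ∘ₗ T.mkQ)
  let z : K ⟶ E := 0
  have h0 : σ.π ≫ χ = σ.π ≫ z := by
    apply (E.freeHomEquiv).injective
    funext i
    refine (SheafOfModules.freeHomEquiv_comp_apply σ.π χ i).trans
      (Eq.trans ?_ (SheafOfModules.freeHomEquiv_comp_apply σ.π z i).symm)
    rw [Equiv.apply_symm_apply]
    refine PresheafOfModules.sections_ext _ _ fun U => ?_
    have h1 : χ.app ⊤ ((σ.s i).val (.op ⊤)) = 0 := by
      have : T.mkQ ((σ.s i).val (.op ⊤)) = 0 :=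
        (Submodule.Quotient.mk_eq_zero T).mpr (Submodule.subset_span ⟨i, rfl⟩)
      exact (hχ _).trans ((congrArg e this).trans (map_zero e))
    have h2 := app_res χ (le_top : U.unop ≤ ⊤) ((σ.s i).val (.op ⊤))
    rw [h1, map_zero] at h2
    have h3 : res (M := K) (le_top : U.unop ≤ ⊤) ((σ.s i).val (.op ⊤)) = (σ.s i).val U :=
      (σ.s i).property (homOfLE le_top : U.unop ⟶ ⊤).op
    rw [h3] at h2
    exact h2
  have h1 : χ = z := σ.epi.left_cancellation _ _ h0
  rw [eq_top_iff]
  intro p _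
  have h2 := hχ p
  rw [h1] at h2
  have h3 : T.mkQ p = 0 := by
    apply e.injective
    rw [map_zero]
    exact h2.symm
  exact (Submodule.Quotient.mk_eq_zero T).mp h3

/-- Restriction to a smaller affine open preserves an epimorphism from a finite free sheaf, and
there `span_generatingSections_eq_top` applies. -/
lemma exists_finite_of_isFiniteType [M.IsQuasicoherent] [M.IsFiniteType] (x : X) :
    ∃ W : X.Opens, x ∈ W ∧ ∀ V : X.Opens, IsAffineOpen V → V ≤ W →
      ∃ (ι : Type u) (_ : Finite ι) (s : ι → Γ(M, V)),
        Submodule.span Γ(X, V) (Set.range s) = ⊤ := by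
  obtain ⟨σ, hσ⟩ := SheafOfModules.IsFiniteType.exists_localGeneratorsData M
  have hc := σ.coversTop
  rw [Opens.coversTop_iff] at hc
  obtain ⟨i, hi⟩ := TopologicalSpace.Opens.mem_iSup.mp
    (hc ▸ TopologicalSpace.Opens.mem_top x : x ∈ iSup σ.X)
  refine ⟨σ.X i, hi, fun V hV hle => ?_⟩
  let u := hV.isoSpec.inv ≫ X.homOfLE hle
  have h1 : PreservesColimitsOfSize.{u, u} (Scheme.Modules.restrictFunctor u) :=
    (Scheme.Modules.restrictAdjunction u).leftAdjoint_preservesColimits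
  have h2 : PreservesColimitsOfSize.{u, u} (Scheme.Modules.overEquiv (σ.X i)).functor :=
    inferInstance
  let Φ : SheafOfModules.{u} (X.ringCatSheaf.over (σ.X i)) ⥤
      SheafOfModules.{u} (Spec Γ(X, V)).ringCatSheaf :=
    (Scheme.Modules.overEquiv (σ.X i)).functor ⋙ Scheme.Modules.restrictFunctor u
  have : PreservesColimitsOfSize.{u, u} Φ :=
    @comp_preservesColimits _ _ _ _ _ _ (Scheme.Modules.overEquiv (σ.X i)).functor
      (Scheme.Modules.restrictFunctor u) h2 h1
  let iso : SheafOfModules.overFunctor X.ringCatSheaf _ ⋙ Φ ≅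
      Scheme.Modules.restrictFunctor hV.fromSpec := (Functor.associator _ _ _).symm ≪≫
        Functor.isoWhiskerRight (Scheme.Modules.overFunctorEquiv _) _ ≪≫
        (Scheme.Modules.restrictFunctorComp _ _).symm ≪≫
        (Scheme.Modules.restrictFunctorCongr (by
          rw [Category.assoc, Scheme.homOfLE_ι]
          exact hV.isoSpec_inv_ι))
  have hepi : Epi (C := SheafOfModules (Spec Γ(X, V)).ringCatSheaf) (iso.app M).hom :=
    have : IsIso (iso.app M).hom := (iso.app M).isIso_hom
    inferInstanceAs (Epi (iso.app M).hom)
  let τ : SheafOfModules.GeneratingSections (M.restrict hV.fromSpec) :=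
    ((σ.generators i).map Φ (Scheme.Modules.restrictUnitIso _).symm).ofEpi (iso.app M).hom
  have hτ := span_generatingSections_eq_top τ
  have hfin : Finite (σ.generators i).I := (hσ.isFiniteType i).finite
  have e1 := fromSpec_image_top hV
  refine ⟨τ.I, hfin, fun j => res (M := M) e1.ge ((τ.s j).val (.op ⊤)), ?_⟩
  rw [eq_top_iff]
  intro m _
  have key : ∀ t ∈ Submodule.span Γ(X, V) (Set.range fun i =>
      (show Γ(M.restrict hV.fromSpec, (⊤ : (Spec Γ(X, V)).Opens)) from (τ.s i).val (.op ⊤))),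
      res (M := M) e1.ge t ∈ Submodule.span Γ(X, V)
        (Set.range fun j => res (M := M) e1.ge ((τ.s j).val (.op ⊤))) := by
    intro t ht
    induction ht using Submodule.span_induction with
    | mem t ht =>
      obtain ⟨j, rfl⟩ := ht
      exact Submodule.subset_span ⟨j, rfl⟩
    | zero =>
      exact (map_zero (res (M := M) e1.ge)).symm ▸ Submodule.zero_mem _
    | add a b _ _ ha hb =>
      exact (map_add (res (M := M) e1.ge) a b).symm ▸ Submodule.add_mem _ ha hb
    | smul r a _ ha =>
      rw [restrict_fromSpec_smul hV M r ⊤ a e1.le, res_smul, rres_rres, rres_rfl]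
      exact Submodule.smul_mem _ r ha
  have := key (res (M := M) e1.le m) (hτ ▸ Submodule.mem_top)
  rw [res_res, res_rfl] at this
  exact this

/-- The sections over an affine open subset of a quasi-coherent sheaf of finite type form a
finite module. -/
lemma finite_sections [M.IsQuasicoherent] [M.IsFiniteType] {U : X.Opens} (hU : IsAffineOpen U) :
    Module.Finite Γ(X, U) Γ(M, U) := by
  -- Finitely many generators on a basic open set of `c` are extended to U after multiplication by
  -- powers of `c`. Up to a further power of `c`, every section over U lies in their span.
  have loc : ∀ x ∈ U, ∃ c : Γ(X, U), x ∈ X.basicOpen c ∧ ∃ S : Finset Γ(M, U),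
      ∀ m : Γ(M, U), ∃ n : ℕ, c ^ n • m ∈ Submodule.span Γ(X, U) (S : Set Γ(M, U)) := by
    intro x hx
    obtain ⟨W, hxW, hW⟩ := exists_finite_of_isFiniteType M x
    obtain ⟨c, hc, hxc⟩ := hU.exists_basicOpen_le (⟨x, ⟨hxW, hx⟩⟩ : (W ⊓ U : X.Opens)) hx
    obtain ⟨ι, hι, s, hs⟩ := hW (X.basicOpen c) (hU.basicOpen c) (hc.trans inf_le_left)
    have := Fintype.ofFinite ι
    classical
    choose n t ht using fun j => exists_extend_pow_smul hU M (s j)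
    refine ⟨c, hxc, Finset.univ.image t, fun m => ?_⟩
    have key : ∀ p ∈ Submodule.span Γ(X, X.basicOpen c) (Set.range s), ∃ (k : ℕ),
        ∃ q ∈ Submodule.span Γ(X, U) ((Finset.univ.image t : Finset _) : Set Γ(M, U)),
          res (X.basicOpen_le c) q = rres (X.basicOpen_le c) c ^ k • p := by
      intro p hp
      induction hp using Submodule.span_induction with
      | mem p hp =>
        obtain ⟨j, rfl⟩ := hp
        exact ⟨n j, t j, Submodule.subset_span (by simp), ht j⟩
      | zero => exact ⟨0, 0, Submodule.zero_mem _, by simp⟩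
      | add a b _ _ ha hb =>
        obtain ⟨k, q, hq, e⟩ := ha
        obtain ⟨k', q', hq', e'⟩ := hb
        refine ⟨k + k', c ^ k' • q + c ^ k • q', Submodule.add_mem _ (Submodule.smul_mem _ _ hq)
          (Submodule.smul_mem _ _ hq'), ?_⟩
        rw [map_add, res_smul, res_smul, e, e', map_pow, map_pow, smul_smul, smul_smul, smul_add,
          pow_add, mul_comm (_ ^ k')]
      | smul r a _ ha =>
        obtain ⟨k, q, hq, e⟩ := ha
        have := hU.isLocalization_basicOpen c
        obtain ⟨⟨r', _, l, rfl⟩, hr⟩ := IsLocalization.surj (.powers c) r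
        refine ⟨l + k, r' • q, Submodule.smul_mem _ _ hq, ?_⟩
        have hr' : r * rres (X.basicOpen_le c) c ^ l = rres (X.basicOpen_le c) r' := by
          rw [← map_pow]
          exact hr
        rw [res_smul, e, ← hr', smul_smul, smul_smul, pow_add]
        congr 1
        ring
    obtain ⟨k, q, hq, e⟩ := key (res (X.basicOpen_le c) m) (hs ▸ Submodule.mem_top)
    obtain ⟨l, hl⟩ := exists_pow_smul_eq_zero hU M (c := c) (m := q - c ^ k • m) (by
      rw [map_sub, e, res_smul, map_pow, sub_self])
    refine ⟨l + k, ?_⟩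
    rw [smul_sub, sub_eq_zero, smul_smul, ← pow_add] at hl
    rw [← hl]
    exact Submodule.smul_mem _ _ hq
  choose c hc S hS using fun x : U => loc x.1 x.2
  have htop : Ideal.span (Set.range c) = ⊤ := by
    rw [← hU.iSup_basicOpen_eq_self_iff]
    refine le_antisymm (iSup_le fun f => X.basicOpen_le _) fun x hx => ?_
    exact TopologicalSpace.Opens.mem_iSup.mpr ⟨⟨_, ⟨⟨x, hx⟩, rfl⟩⟩, hc ⟨x, hx⟩⟩
  obtain ⟨T, hTs, hT⟩ := (Ideal.span_eq_top_iff_finite _).mp htop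
  choose y hy using fun b : T => hTs b.2
  classical
  refine ⟨⟨T.attach.biUnion fun b => S (y b), ?_⟩⟩
  rw [eq_top_iff]
  intro m _
  refine Submodule.mem_of_span_eq_top_of_smul_pow_mem _ _ hT m fun b => ?_
  obtain ⟨n, hn⟩ := hS (y b) m
  rw [hy b] at hn
  refine ⟨n, Submodule.span_mono ?_ hn⟩
  intro p hp
  simp only [Finset.coe_biUnion, Set.mem_iUnion]
  exact ⟨b, Finset.mem_coe.mpr (Finset.mem_attach _ _), hp⟩

end Finite

/-! ### Multiplication by sections of powers of L. -/

section Multiplication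

variable {X : Scheme.{u}}

/-- The tensor product of two morphisms. -/
def tensorHom {M M' N N' : X.Modules} (φ : M ⟶ M') (χ : N ⟶ N') : tensor M N ⟶ tensor M' N' :=
  tensorOver (𝟙 X) (φ ≫ (Scheme.Modules.pushforwardId X).inv.app M')
    (χ ≫ (Scheme.Modules.pushforwardId X).inv.app N') ≫
    (Scheme.Modules.pushforwardId X).hom.app (tensor M' N')

lemma tensorHom_tmul {M M' N N' : X.Modules} (φ : M ⟶ M') (χ : N ⟶ N') {U : X.Opens}
    (m : Γ(M, U)) (n : Γ(N, U)) :
    (tensorHom φ χ).app U (tmul m n) = tmul (φ.app U m) (χ.app U n) :=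
  tensorOver_tmul (𝟙 X) (φ ≫ (Scheme.Modules.pushforwardId X).inv.app M')
    (χ ≫ (Scheme.Modules.pushforwardId X).inv.app N') m n

variable (X) in
/-- The structure sheaf as a sheaf of modules. -/
abbrev unitSheaf : X.Modules := SheafOfModules.unit X.ringCatSheaf

/-- The morphism `𝒪_X ⟶ M` given by a global section. -/
def homOfSection {M : X.Modules} (s : Γ(M, (⊤ : X.Opens))) :
    unitSheaf X ⟶ M :=
  homMk (fun U =>
    { toFun := fun r : Γ(X, U) => r • res le_top s
      map_add' := fun r r' : Γ(X, U) => add_smul r r' _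
      map_smul' := fun r r' : Γ(X, U) => mul_smul r r' _ })
    (fun {U V} h (r : Γ(X, U)) => by
      have := res_smul h r (res le_top s)
      rw [res_res] at this
      exact this.symm)

lemma homOfSection_app {M : X.Modules} (s : Γ(M, (⊤ : X.Opens))) {U : X.Opens} (r : Γ(X, U)) :
    (homOfSection s).app U r = r • res le_top s := rfl

variable {L F : X.Modules}

/-- The `k`-th power of a section of `L`. -/
def powSec {V : X.Opens} (ℓ : Γ(L, V)) : ∀ k : ℕ, Γ(tensorPow L k, V)
  | 0 => (1 : Γ(X, V))
  | k + 1 => tmul ℓ (powSec ℓ k)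

lemma res_powSec {U V : X.Opens} (h : V ≤ U) (ℓ : Γ(L, U)) (k : ℕ) :
    res h (powSec ℓ k) = powSec (res h ℓ) k := by
  induction k with
  | zero => exact map_one (rres h)
  | succ k ih =>
    have := res_tmul h ℓ (powSec ℓ k)
    rw [ih] at this
    exact this

lemma IsGenerator.tmul {M N : X.Modules} {V : X.Opens} {ℓ : Γ(M, V)} {n : Γ(N, V)}
    (h : IsGenerator ℓ V le_rfl) (h' : IsGenerator n V le_rfl) :
    IsGenerator (tmul ℓ n) V le_rfl := by
  intro W hW
  have e : (fun r : Γ(X, W) => r • (tensor M N).presheaf.map (homOfLE (hW.trans le_rfl)).op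
      (EquivSurj.tmul ℓ n)) =
      (fun n' => EquivSurj.tmul (EquivSurj.res hW ℓ) n') ∘ fun r : Γ(X, W) => r • EquivSurj.res hW n := by
    funext r
    have h1 : (tensor M N).presheaf.map (homOfLE (hW.trans le_rfl)).op (EquivSurj.tmul ℓ n) =
      EquivSurj.tmul (EquivSurj.res hW ℓ) (EquivSurj.res hW n) := res_tmul hW ℓ n
    rw [h1, Function.comp_apply, tmul_smul]
  rw [e]
  exact (h.tmul_bijective hW).comp (h'.bijective hW)

lemma IsGenerator.powSec {V : X.Opens} {ℓ : Γ(L, V)} (h : IsGenerator ℓ V le_rfl) (k : ℕ) :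
    IsGenerator (powSec ℓ k) V le_rfl := by
  induction k with
  | zero =>
    intro W hW
    have e : ∀ r : Γ(X, W), r * rres hW 1 = r := fun r => by rw [map_one, mul_one]
    have : Function.Bijective fun r : Γ(X, W) => r * rres hW 1 := by
      simp only [e]
      exact Function.bijective_id
    exact this
  | succ k ih => exact h.tmul ih

lemma IsLineBundle.tensorPow (hL : IsLineBundle L) (k : ℕ) : IsLineBundle (tensorPow L k) :=
  fun x => by
    obtain ⟨V, ℓ, hx, hℓ⟩ := hL x
    exact ⟨V, EquivSurj.powSec ℓ k, hx, hℓ.powSec k⟩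

/-- Multiplication by a section of `L^{⊗ r}`. -/
def mulPow {r : ℕ} (s : Γ(tensorPow L r, (⊤ : X.Opens))) :
    ∀ k : ℕ, tensorPow L k ⟶ tensorPow L (r + k)
  | 0 => homOfSection s
  | k + 1 => tensorHom (𝟙 L) (mulPow s k)

/-- Sections of powers of `L` are handled through their coordinates with respect to powers of a
local generator; in these terms `mulPow s` is multiplication by the coordinate of `s`. -/
lemma mulPow_powSec {r : ℕ} {s : Γ(tensorPow L r, (⊤ : X.Opens))} {V : X.Opens} {ℓ : Γ(L, V)}
    {c : Γ(X, V)} (h : res le_top s = c • powSec ℓ r) (k : ℕ) :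
    (mulPow s k).app V (powSec ℓ k) = c • powSec ℓ (r + k) := by
  induction k with
  | zero =>
    refine (homOfSection_app s (1 : Γ(X, V))).trans ?_
    rw [one_smul, h]
    rfl
  | succ k ih =>
    refine (tensorHom_tmul (𝟙 L) (mulPow s k) ℓ (powSec ℓ k)).trans ?_
    rw [ih]
    exact tmul_smul c ℓ (powSec ℓ (r + k))

variable (L F) in
/-- The twists of `F` by the powers of `L`, described by charts `F(V) ≃ (L^{⊗ k} ⊗ F)(V)` for every
generator of `L` on `V` and by the action of the sections of the powers of `L`. -/
structure Twists where
  /-- the twist by `L^{⊗ k}` -/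
  obj : ℕ → X.Modules
  /-- multiplication by the `k`-th power of a local section of `L` -/
  chart : ∀ {V : X.Opens} (_ : Γ(L, V)) (k : ℕ), Γ(F, V) →ₗ[Γ(X, V)] Γ(obj k, V)
  bijective : ∀ {V : X.Opens} {ℓ : Γ(L, V)}, IsGenerator ℓ V le_rfl → ∀ k : ℕ,
    Function.Bijective (chart ℓ k)
  res_chart : ∀ {U V : X.Opens} (h : V ≤ U) (ℓ : Γ(L, U)) (k : ℕ) (f : Γ(F, U)),
    res h (chart ℓ k f) = chart (res h ℓ) k (res h f)
  exists_mul : ∀ {r : ℕ} (s : Γ(tensorPow L r, (⊤ : X.Opens))) (k : ℕ),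
    ∃ μ : obj k ⟶ obj (r + k), ∀ {V : X.Opens} {ℓ : Γ(L, V)} {c : Γ(X, V)} (f : Γ(F, V)),
      res le_top s = c • powSec ℓ r → μ.app V (chart ℓ k f) = chart ℓ (r + k) (c • f)

variable (L F) in
/-- The twists `L^{⊗ k} ⊗ F`. -/
def tensorTwists : Twists L F where
  obj k := tensor (tensorPow L k) F
  chart ℓ k :=
    { toFun := fun f => tmul (powSec ℓ k) f
      map_add' := fun f f' => tmul_add _ f f'
      map_smul' := fun c f => tmul_smul c _ f }
  bijective h k := by
    have := (h.powSec k).tmul_bijective (N := F) le_rfl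
    rw [res_rfl] at this
    exact this
  res_chart h ℓ k f := by
    have := res_tmul h (powSec ℓ k) f
    rw [res_powSec] at this
    exact this
  exists_mul s k := ⟨tensorHom (mulPow s k) (𝟙 F), fun f h => by
    refine (tensorHom_tmul (mulPow s k) (𝟙 F) _ f).trans ?_
    rw [mulPow_powSec h k, smul_tmul]
    exact (tmul_smul _ _ f).symm⟩

variable (L) in
/-- The powers `L^{⊗ k}`, as twists of the structure sheaf. -/
def powTwists : Twists L (unitSheaf X) where
  obj k := tensorPow L k
  chart {V} ℓ k :=
    { toFun := fun f : Γ(X, V) => f • powSec ℓ k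
      map_add' := fun f f' : Γ(X, V) => add_smul f f' _
      map_smul' := fun c f : Γ(X, V) => mul_smul c f _ }
  bijective h k := by
    have := (h.powSec k).bijective le_rfl
    rw [res_rfl] at this
    exact this
  res_chart {U V} h ℓ k (f : Γ(X, U)) := by
    have := res_smul h f (powSec ℓ k)
    rw [res_powSec] at this
    exact this
  exists_mul {r} s k := ⟨mulPow s k, fun {V ℓ c} (f : Γ(X, V)) h => by
    refine ((mulPow s k).app_smul f (powSec ℓ k)).trans ?_
    rw [mulPow_powSec h k, smul_smul, mul_comm]
    rfl⟩

namespace Twists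

variable (T : Twists L F)

lemma exists_mul_pow {r : ℕ} (s : Γ(tensorPow L r, (⊤ : X.Opens))) (q : ℕ) {k K : ℕ}
    (hK : K = r * q + k) :
    ∃ μ : T.obj k ⟶ T.obj K, ∀ {V : X.Opens} {ℓ : Γ(L, V)} {c : Γ(X, V)} (f : Γ(F, V)),
      res le_top s = c • powSec ℓ r → μ.app V (T.chart ℓ k f) = T.chart ℓ K (c ^ q • f) := by
  induction q generalizing K with
  | zero =>
    obtain rfl : K = k := by simpa using hK
    exact ⟨𝟙 _, fun f h => by simp⟩
  | succ q ih =>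
    obtain ⟨μ, hμ⟩ := ih rfl
    obtain rfl : K = r + (r * q + k) := by rw [hK]; ring
    obtain ⟨ν, hν⟩ := T.exists_mul s (r * q + k)
    refine ⟨μ ≫ ν, fun {V ℓ c} f h => ?_⟩
    have h1 : (μ ≫ ν).app V (T.chart ℓ k f) = ν.app V (μ.app V (T.chart ℓ k f)) := rfl
    rw [h1, hμ f h, hν _ h, smul_smul, pow_succ']

end Twists

/-- The product is `mulPow s` applied to `t`, which avoids comparing L^r ⊗ L^r' with L^(r + r'). -/
lemma exists_mul_section {r r' : ℕ} (s : Γ(tensorPow L r, (⊤ : X.Opens)))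
    (t : Γ(tensorPow L r', (⊤ : X.Opens))) :
    ∃ w : Γ(tensorPow L (r + r'), (⊤ : X.Opens)), ∀ {V : X.Opens} {ℓ : Γ(L, V)} {c d : Γ(X, V)},
      res le_top s = c • powSec ℓ r → res le_top t = d • powSec ℓ r' →
        res le_top w = (c * d) • powSec ℓ (r + r') := by
  refine ⟨(mulPow s r').app ⊤ t, fun {V ℓ c d} hs ht => ?_⟩
  rw [← app_res, ht, Scheme.Modules.Hom.app_smul, mulPow_powSec hs, smul_smul, mul_comm]

lemma exists_pow_section {r : ℕ} (s : Γ(tensorPow L r, (⊤ : X.Opens))) (q : ℕ) {N : ℕ}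
    (hN : N = r * q) :
    ∃ w : Γ(tensorPow L N, (⊤ : X.Opens)), ∀ {V : X.Opens} {ℓ : Γ(L, V)} {c : Γ(X, V)},
      res le_top s = c • powSec ℓ r → res le_top w = c ^ q • powSec ℓ N := by
  induction q generalizing N with
  | zero =>
    obtain rfl : N = 0 := by simpa using hN
    refine ⟨(1 : Γ(X, ⊤)), fun {V ℓ c} h => ?_⟩
    have h1 : res (M := tensorPow L 0) (le_top : V ≤ ⊤) (1 : Γ(X, ⊤)) = (1 : Γ(X, V)) :=
      map_one (rres le_top)
    rw [h1, pow_zero, one_smul]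
    rfl
  | succ q ih =>
    obtain ⟨w, hw⟩ := ih rfl
    obtain rfl : N = r + r * q := by rw [hN]; ring
    obtain ⟨w', hw'⟩ := exists_mul_section s w
    refine ⟨w', fun {V ℓ c} h => ?_⟩
    rw [hw' h (hw h), pow_succ']

end Multiplication

/-! ### The locus where a section does not vanish. -/

section Nonvanishing

variable {X : Scheme.{u}} {M : X.Modules}

/-- The open set `X_s` where a global section generates. -/
def nonvanishingOpen (s : Γ(M, (⊤ : X.Opens))) : X.Opens :=
  ⟨nonvanishing s, isOpen_iff_forall_mem_open.mpr fun _ ⟨V, hx, hV⟩ =>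
    ⟨V, fun _ hy => ⟨V, hy, hV⟩, V.isOpen, hx⟩⟩

lemma IsGenerator.of_top {s : Γ(M, (⊤ : X.Opens))} {V : X.Opens} (h : IsGenerator s V le_top) :
    IsGenerator (EquivSurj.res (le_top : V ≤ ⊤) s) V le_rfl := by
  intro W hW
  have := h W hW
  have e : M.presheaf.map (homOfLE (hW.trans le_top)).op s =
      EquivSurj.res hW (EquivSurj.res (le_top : V ≤ ⊤) s) := (res_res le_top hW s).symm
  rw [e] at this
  exact this

lemma IsGenerator.to_top {s : Γ(M, (⊤ : X.Opens))} {V : X.Opens}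
    (h : IsGenerator (EquivSurj.res (le_top : V ≤ ⊤) s) V le_rfl) : IsGenerator s V le_top := by
  intro W hW
  have := h W hW
  have e : M.presheaf.map (homOfLE (hW.trans le_top)).op s =
      EquivSurj.res hW (EquivSurj.res (le_top : V ≤ ⊤) s) := (res_res le_top hW s).symm
  rw [e]
  exact this

lemma IsGenerator.smul_unit {V : X.Opens} {ℓ : Γ(M, V)} (h : IsGenerator ℓ V le_rfl)
    {c : Γ(X, V)} (hc : IsUnit c) : IsGenerator (c • ℓ) V le_rfl := by
  intro W hW
  have e : (fun r : Γ(X, W) => r • M.presheaf.map (homOfLE (hW.trans le_rfl)).op (c • ℓ)) =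
      (fun r : Γ(X, W) => r • EquivSurj.res hW ℓ) ∘ fun r => r * rres hW c := by
    funext r
    have : M.presheaf.map (homOfLE (hW.trans le_rfl)).op (c • ℓ) =
      rres hW c • EquivSurj.res hW ℓ := res_smul hW c ℓ
    rw [this, Function.comp_apply, smul_smul]
  rw [e]
  exact (h.bijective hW).comp (IsUnit.isUnit_iff_mulRight_bijective.mp (hc.map (rres hW)))

lemma IsGenerator.isUnit {V : X.Opens} {ℓ : Γ(M, V)} (h : IsGenerator ℓ V le_rfl)
    {c : Γ(X, V)} (h' : IsGenerator (c • ℓ) V le_rfl) : IsUnit c := by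
  obtain ⟨d, hd⟩ := (h'.bijective le_rfl).2 ℓ
  simp only [res_rfl, smul_smul] at hd
  refine .of_mul_eq_one_right d ((h.bijective le_rfl).1 ?_)
  simp only [res_rfl, one_smul]
  exact hd

/-- If `s` generates near `x`, its coordinate is a unit there; conversely `c` is invertible on its
basic open set, so that `c • ℓ` generates. -/
lemma mem_nonvanishing_iff {s : Γ(M, (⊤ : X.Opens))} {V : X.Opens} {ℓ : Γ(M, V)}
    (h : IsGenerator ℓ V le_rfl) {c : Γ(X, V)} (hs : res le_top s = c • ℓ) {x : X} (hx : x ∈ V) :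
    x ∈ nonvanishingOpen s ↔ x ∈ X.basicOpen c := by
  constructor
  · rintro ⟨V', hxV', hV'⟩
    have h1 : IsUnit (rres (inf_le_right : V' ⊓ V ≤ V) c) := by
      refine (h.res inf_le_right).isUnit ?_
      rw [← res_smul, ← hs, res_res, ← res_res (le_top : V' ≤ ⊤) inf_le_left]
      exact hV'.of_top.res inf_le_left
    have h2 := (RingedSpace.isUnit_res_basicOpen X.toRingedSpace c)
    have h3 : X.basicOpen (rres (inf_le_right : V' ⊓ V ≤ V) c) = V' ⊓ V :=
      X.basicOpen_of_isUnit h1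
    have h4 : X.basicOpen (rres (inf_le_right : V' ⊓ V ≤ V) c) = V' ⊓ V ⊓ X.basicOpen c :=
      X.basicOpen_res c (homOfLE inf_le_right).op
    have h5 : x ∈ V' ⊓ V ⊓ X.basicOpen c := by
      rw [← h4, h3]
      exact ⟨hxV', hx⟩
    exact h5.2
  · intro hxc
    refine ⟨X.basicOpen c, hxc, IsGenerator.to_top ?_⟩
    rw [← res_res (le_top : V ≤ ⊤) (X.basicOpen_le c), hs, res_smul]
    exact (h.res (X.basicOpen_le c)).smul_unit (RingedSpace.isUnit_res_basicOpen _ c)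

lemma isGenerator_nonvanishingOpen (s : Γ(M, (⊤ : X.Opens))) :
    IsGenerator (res (le_top : nonvanishingOpen s ≤ ⊤) s) (nonvanishingOpen s) le_rfl := by
  intro W hW
  refine bijective_of_locally (M := unitSheaf X) (N := M)
    (fun V (hV : V ≤ W) (r : Γ(X, V)) => r • res (hV.trans hW) (res (le_top : nonvanishingOpen s ≤ ⊤) s))
    (fun V V' hV hV' (r : Γ(X, V)) => ?_) (fun x hx => ?_)
  · rw [res_smul, res_res]
    rfl
  · obtain ⟨V, hxV, hV⟩ := hW hx
    refine ⟨V, hxV, fun W' hW' hV' => ?_⟩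
    rw [res_res]
    exact hV W' hV'

end Nonvanishing

/-! ### Sections over X_s: annihilation and extension by powers of s. -/

section Extension

variable {X : Scheme.{u}} {L F : X.Modules}

lemma IsLineBundle.exists_affine_cover [CompactSpace X] (hL : IsLineBundle L) :
    ∃ (ι : Type u) (_ : Finite ι) (V : ι → X.Opens) (ℓ : ∀ i, Γ(L, V i)),
      (∀ i, IsAffineOpen (V i)) ∧ (∀ i, IsGenerator (ℓ i) (V i) le_rfl) ∧ ∀ x, ∃ i, x ∈ V i := by
  have loc : ∀ x : X, ∃ (V : X.Opens) (ℓ : Γ(L, V)), IsAffineOpen V ∧ IsGenerator ℓ V le_rfl ∧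
      x ∈ V := by
    intro x
    obtain ⟨V, ℓ, hx, hℓ⟩ := hL x
    obtain ⟨W, hW, hxW, hWV⟩ := TopologicalSpace.Opens.isBasis_iff_nbhd.mp X.isBasis_affineOpens hx
    exact ⟨W, res hWV ℓ, hW, hℓ.res hWV, hxW⟩
  choose V ℓ hV hℓ hx using loc
  obtain ⟨t, ht⟩ := isCompact_univ.elim_finite_subcover (fun x => (V x : Set X))
    (fun x => (V x).isOpen) (fun x _ => Set.mem_iUnion.mpr ⟨x, hx x⟩)
  refine ⟨t, inferInstance, fun i => V i, fun i => ℓ i, fun i => hV i, fun i => hℓ i, fun x => ?_⟩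
  obtain ⟨i, hi, hxi⟩ := Set.mem_iUnion₂.mp (ht (Set.mem_univ x))
  exact ⟨⟨i, hi⟩, hxi⟩

lemma exists_coord {M : X.Modules} (s : Γ(M, (⊤ : X.Opens))) {V : X.Opens} {ℓ : Γ(M, V)}
    (h : IsGenerator ℓ V le_rfl) : ∃ c : Γ(X, V), res le_top s = c • ℓ := by
  obtain ⟨c, hc⟩ := (h.bijective le_rfl).2 (res le_top s)
  rw [res_rfl] at hc
  exact ⟨c, hc.symm⟩

lemma basicOpen_eq_inf {M : X.Modules} {s : Γ(M, (⊤ : X.Opens))} {V : X.Opens} {ℓ : Γ(M, V)}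
    (h : IsGenerator ℓ V le_rfl) {c : Γ(X, V)} (hs : res le_top s = c • ℓ) :
    X.basicOpen c = V ⊓ nonvanishingOpen s := by
  ext x
  constructor
  · intro hx
    exact ⟨X.basicOpen_le c hx, (mem_nonvanishing_iff h hs (X.basicOpen_le c hx)).mpr hx⟩
  · intro hx
    exact (mem_nonvanishing_iff h hs hx.1).mp hx.2

namespace Twists

variable (T : Twists L F)

/-- The morphism `μ` is the multiplication by `s ^ q`. -/
def IsMul {r : ℕ} (s : Γ(tensorPow L r, (⊤ : X.Opens))) (q : ℕ) {k K : ℕ}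
    (μ : T.obj k ⟶ T.obj K) : Prop :=
  ∀ (V : X.Opens) (ℓ : Γ(L, V)) (c : Γ(X, V)) (f : Γ(F, V)),
    res le_top s = c • powSec ℓ r → μ.app V (T.chart ℓ k f) = T.chart ℓ K (c ^ q • f)

lemma exists_isMul {r : ℕ} (s : Γ(tensorPow L r, (⊤ : X.Opens))) (q : ℕ) {k K : ℕ}
    (hK : K = r * q + k) : ∃ μ : T.obj k ⟶ T.obj K, T.IsMul s q μ := by
  obtain ⟨μ, hμ⟩ := T.exists_mul_pow s q hK
  exact ⟨μ, fun V ℓ c f => hμ f⟩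

variable [F.IsQuasicoherent] {r : ℕ} (s : Γ(tensorPow L r, (⊤ : X.Opens)))

/-- In the chart given by `ℓ`, multiplication by s^q is c^q and V ∩ X_s is the basic open set of
`c`; the claim becomes one on the localization of F(V) at `c`. -/
lemma exists_mul_eq_zero_local {V : X.Opens} (hV : IsAffineOpen V) {ℓ : Γ(L, V)}
    (hℓ : IsGenerator ℓ V le_rfl) {k : ℕ} {m : Γ(T.obj k, V)}
    (hm : res (inf_le_left : V ⊓ nonvanishingOpen s ≤ V) m = 0) :
    ∃ n : ℕ, ∀ q : ℕ, n ≤ q → ∀ (K : ℕ) (μ : T.obj k ⟶ T.obj K), T.IsMul s q μ →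
      μ.app V m = 0 := by
  obtain ⟨c, hc⟩ := exists_coord s (hℓ.powSec r)
  obtain ⟨f, rfl⟩ := (T.bijective hℓ k).2 m
  have e := basicOpen_eq_inf (hℓ.powSec r) hc
  have hf : res (inf_le_left : V ⊓ nonvanishingOpen s ≤ V) f = 0 := by
    apply (T.bijective (hℓ.res inf_le_left) k).1
    rw [← T.res_chart, hm, map_zero]
  have hf' : res (X.basicOpen_le c) f = 0 := by
    rw [← res_res (inf_le_left : V ⊓ nonvanishingOpen s ≤ V) e.le, hf, map_zero]
  obtain ⟨n, hn⟩ := exists_pow_smul_eq_zero hV F hf'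
  refine ⟨n, fun q hq K μ hμ => ?_⟩
  rw [hμ V ℓ c f hc, ← Nat.sub_add_cancel hq, pow_add, mul_smul, hn, smul_zero, map_zero]

/-- A section which vanishes on `X_s` is annihilated by a power of `s`. -/
theorem exists_mul_eq_zero [CompactSpace X] (hL : IsLineBundle L) {k : ℕ}
    {m : Γ(T.obj k, (⊤ : X.Opens))} (hm : res (le_top : nonvanishingOpen s ≤ ⊤) m = 0) :
    ∃ n : ℕ, ∀ q : ℕ, n ≤ q → ∀ (K : ℕ) (μ : T.obj k ⟶ T.obj K), T.IsMul s q μ →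
      μ.app ⊤ m = 0 := by
  obtain ⟨ι, hι, V, ℓ, hV, hℓ, hcov⟩ := hL.exists_affine_cover
  have := Fintype.ofFinite ι
  have h1 := fun i => T.exists_mul_eq_zero_local s (hV i) (hℓ i) (k := k) (m := res le_top m) (by
    rw [res_res, ← res_res (le_top : nonvanishingOpen s ≤ ⊤) inf_le_right, hm, map_zero])
  choose n hn using h1
  refine ⟨Finset.univ.sup n, fun q hq K μ hμ => section_ext fun x _ => ?_⟩
  obtain ⟨i, hi⟩ := hcov x
  refine ⟨V i, le_top, hi, ?_⟩
  rw [← app_res, map_zero]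
  exact hn i q ((Finset.le_sup (Finset.mem_univ i)).trans hq) K μ hμ

/-- A section over `X_s` extends to `X` after multiplication by a power of `s`. -/
theorem exists_extend_mul [CompactSpace X] [X.IsSeparated] (hL : IsLineBundle L) {k : ℕ}
    (m : Γ(T.obj k, nonvanishingOpen s)) :
    ∃ n : ℕ, ∀ q : ℕ, n ≤ q → ∀ (K : ℕ) (μ : T.obj k ⟶ T.obj K), K = r * q + k → T.IsMul s q μ →
      ∃ w : Γ(T.obj K, (⊤ : X.Opens)), res le_top w = μ.app (nonvanishingOpen s) m := by
  obtain ⟨ι, hι, V, ℓ, hV, hℓ, hcov⟩ := hL.exists_affine_cover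
  have := Fintype.ofFinite ι
  choose c hc using fun i => exists_coord s ((hℓ i).powSec r)
  have e := fun i => basicOpen_eq_inf ((hℓ i).powSec r) (hc i)
  choose f hf using fun i => (T.bijective ((hℓ i).res (inf_le_left : V i ⊓ nonvanishingOpen s ≤ V i))
    k).2 (res inf_le_right m)
  choose a f' hf' using fun i => exists_extend_pow_smul (hV i) F (res (e i).le (f i))
  -- One exponent serves all charts: `t i` extends s^n m from V i ∩ X_s to V i.
  let n := Finset.univ.sup a
  have han : ∀ i, a i ≤ n := fun i => Finset.le_sup (Finset.mem_univ i)
  let t : ∀ i, Γ(T.obj (r * n + k), V i) := fun i => T.chart (ℓ i) _ (c i ^ (n - a i) • f' i)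
  obtain ⟨μ₀, hμ₀⟩ := T.exists_isMul s n (k := k) rfl
  have hci : ∀ i, res (le_top : V i ⊓ nonvanishingOpen s ≤ ⊤) s =
      rres (inf_le_left : V i ⊓ nonvanishingOpen s ≤ V i) (c i) •
        powSec (res (inf_le_left : V i ⊓ nonvanishingOpen s ≤ V i) (ℓ i)) r := fun i => by
    rw [← res_powSec, ← res_smul, ← hc i, res_res]
  have ht : ∀ i, res (inf_le_left : V i ⊓ nonvanishingOpen s ≤ V i) (t i) =
      res inf_le_right (μ₀.app (nonvanishingOpen s) m) := by
    intro i
    rw [← app_res, ← hf i, hμ₀ _ _ _ _ (hci i), T.res_chart]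
    congr 1
    apply res_injective_of_eq (e i).le (e i)
    have h1 := hf' i
    rw [res_smul, res_smul, res_res, res_smul]
    rw [h1, rres_rres, map_pow, map_pow, rres_rres, smul_smul, ← pow_add, Nat.sub_add_cancel (han i)]
  -- On the overlaps, affine by separatedness, the differences of the `t i` vanish on X_s, so a
  -- further power of `s` kills them and allows gluing.
  have h2 := fun i j => T.exists_mul_eq_zero_local s ((hV i).inf (hV j))
    ((hℓ i).res (inf_le_left : V i ⊓ V j ≤ V i)) (k := r * n + k)
    (m := res inf_le_left (t i) - res inf_le_right (t j)) (by
      rw [map_sub, sub_eq_zero, res_res, res_res]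
      rw [← res_res (inf_le_left : V i ⊓ nonvanishingOpen s ≤ V i)
        (le_inf (inf_le_left.trans inf_le_left) inf_le_right), ht i,
        ← res_res (inf_le_left : V j ⊓ nonvanishingOpen s ≤ V j)
        (le_inf (inf_le_left.trans inf_le_right) inf_le_right), ht j, res_res, res_res])
  choose b hb using h2
  let b₀ := Finset.univ.sup fun p : ι × ι => b p.1 p.2
  have hb₀ : ∀ i j, b i j ≤ b₀ := fun i j =>
    Finset.le_sup (f := fun p : ι × ι => b p.1 p.2) (Finset.mem_univ (i, j))
  refine ⟨n + b₀, fun q hq K μ hK hμ => ?_⟩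
  obtain ⟨ν, hν⟩ := T.exists_isMul s (q - n) (k := r * n + k) (K := K) (by
    rw [hK, ← add_assoc, ← mul_add, Nat.sub_add_cancel (by omega)])
  obtain ⟨w, hw⟩ := section_glue (fun i => (le_top : V i ≤ ⊤)) (fun x _ => hcov x)
    (fun i => ν.app (V i) (t i)) (fun i j => by
      rw [← app_res, ← app_res, ← sub_eq_zero, ← map_sub]
      exact hb i j (q - n) (by have := hb₀ i j; omega) K ν hν)
  refine ⟨w, section_ext fun x hx => ?_⟩
  obtain ⟨i, hi⟩ := hcov x
  refine ⟨V i ⊓ nonvanishingOpen s, inf_le_right, ⟨hi, hx⟩, ?_⟩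
  rw [res_res, ← res_res (le_top : V i ≤ ⊤) inf_le_left, hw, ← app_res, ht, ← app_res, ← app_res,
    ← hf i, hμ₀ _ _ _ _ (hci i), hν _ _ _ _ (hci i), hμ _ _ _ _ (hci i), smul_smul, ← pow_add,
    Nat.sub_add_cancel (by omega)]

end Twists

end Extension

/-! ### Products, powers and sums of sections; affineness of their loci. -/

section NonvanishingLoci

variable {X : Scheme.{u}} {L : X.Modules}

lemma isUnit_of_basicOpen_eq {U : X.Opens} {c : Γ(X, U)} (h : X.basicOpen c = U) : IsUnit c := by
  have key : ∀ (V : X.Opens) (e : V = U), IsUnit (rres e.le c) → IsUnit c := by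
    rintro V rfl hc
    rwa [rres_rfl] at hc
  exact key _ h (RingedSpace.isUnit_res_basicOpen X.toRingedSpace c)

/-- `w` is a section of `L^{⊗ N}` with the local coordinates of `s t`. -/
def IsProduct {r r' N : ℕ} (s : Γ(tensorPow L r, (⊤ : X.Opens)))
    (t : Γ(tensorPow L r', (⊤ : X.Opens))) (w : Γ(tensorPow L N, (⊤ : X.Opens))) : Prop :=
  ∀ (V : X.Opens) (ℓ : Γ(L, V)) (c d : Γ(X, V)), res le_top s = c • powSec ℓ r →
    res le_top t = d • powSec ℓ r' → res le_top w = (c * d) • powSec ℓ N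

/-- `w` is a section of `L^{⊗ N}` with the local coordinates of `s ^ q`. -/
def IsPower {r N : ℕ} (s : Γ(tensorPow L r, (⊤ : X.Opens))) (q : ℕ)
    (w : Γ(tensorPow L N, (⊤ : X.Opens))) : Prop :=
  ∀ (V : X.Opens) (ℓ : Γ(L, V)) (c : Γ(X, V)), res le_top s = c • powSec ℓ r →
    res le_top w = c ^ q • powSec ℓ N

lemma exists_isProduct {r r' : ℕ} (s : Γ(tensorPow L r, (⊤ : X.Opens)))
    (t : Γ(tensorPow L r', (⊤ : X.Opens))) {N : ℕ} (hN : N = r + r') :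
    ∃ w : Γ(tensorPow L N, (⊤ : X.Opens)), IsProduct s t w := by
  subst hN
  obtain ⟨w, hw⟩ := exists_mul_section s t
  exact ⟨w, fun _ _ _ _ => hw⟩

lemma exists_isPower {r : ℕ} (s : Γ(tensorPow L r, (⊤ : X.Opens))) (q : ℕ) {N : ℕ}
    (hN : N = r * q) : ∃ w : Γ(tensorPow L N, (⊤ : X.Opens)), IsPower s q w := by
  obtain ⟨w, hw⟩ := exists_pow_section s q hN
  exact ⟨w, fun _ _ _ => hw⟩

/-- Passing to the residue field turns statements on loci of products, powers and sums into
statements on elements of a field. -/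
lemma mem_nonvanishing_iff_evaluation {r : ℕ} {s : Γ(tensorPow L r, (⊤ : X.Opens))} {V : X.Opens}
    {ℓ : Γ(L, V)} (hℓ : IsGenerator ℓ V le_rfl) {c : Γ(X, V)}
    (hc : res le_top s = c • powSec ℓ r) {x : X} (hx : x ∈ V) :
    x ∈ nonvanishingOpen s ↔ X.evaluation V x hx c ≠ 0 := by
  rw [mem_nonvanishing_iff (hℓ.powSec r) hc hx, X.evaluation_ne_zero_iff_mem_basicOpen]

lemma IsProduct.nonvanishing (hL : IsLineBundle L) {r r' N : ℕ}
    {s : Γ(tensorPow L r, (⊤ : X.Opens))} {t : Γ(tensorPow L r', (⊤ : X.Opens))}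
    {w : Γ(tensorPow L N, (⊤ : X.Opens))} (h : IsProduct s t w) :
    nonvanishingOpen w = nonvanishingOpen s ⊓ nonvanishingOpen t := by
  ext x
  obtain ⟨V, ℓ, hx, hℓ⟩ := hL x
  obtain ⟨c, hc⟩ := exists_coord s (hℓ.powSec r)
  obtain ⟨d, hd⟩ := exists_coord t (hℓ.powSec r')
  change x ∈ nonvanishingOpen w ↔ x ∈ nonvanishingOpen s ∧ x ∈ nonvanishingOpen t
  rw [mem_nonvanishing_iff_evaluation hℓ hc hx, mem_nonvanishing_iff_evaluation hℓ hd hx,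
    mem_nonvanishing_iff_evaluation hℓ (h V ℓ c d hc hd) hx, map_mul, mul_ne_zero_iff]

lemma IsPower.nonvanishing (hL : IsLineBundle L) {r N q : ℕ} (hq : q ≠ 0)
    {s : Γ(tensorPow L r, (⊤ : X.Opens))}
    {w : Γ(tensorPow L N, (⊤ : X.Opens))} (h : IsPower s q w) :
    nonvanishingOpen w = nonvanishingOpen s := by
  ext x
  obtain ⟨V, ℓ, hx, hℓ⟩ := hL x
  obtain ⟨c, hc⟩ := exists_coord s (hℓ.powSec r)
  change x ∈ nonvanishingOpen w ↔ x ∈ nonvanishingOpen s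
  rw [mem_nonvanishing_iff_evaluation hℓ hc hx,
    mem_nonvanishing_iff_evaluation hℓ (h V ℓ c hc) hx, map_pow, pow_ne_zero_iff hq]

/-- Unlike in `IsPower.nonvanishing`, the exponent may be zero; this case occurs in
`isAffineOpen_inf` for a section `t` of L^0. -/
lemma IsPower.le_nonvanishing (hL : IsLineBundle L) {r N q : ℕ}
    {s : Γ(tensorPow L r, (⊤ : X.Opens))}
    {w : Γ(tensorPow L N, (⊤ : X.Opens))} (h : IsPower s q w) :
    nonvanishingOpen s ≤ nonvanishingOpen w := by
  intro x hxs
  obtain ⟨V, ℓ, hx, hℓ⟩ := hL x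
  obtain ⟨c, hc⟩ := exists_coord s (hℓ.powSec r)
  change x ∈ nonvanishingOpen s at hxs
  change x ∈ nonvanishingOpen w
  rw [mem_nonvanishing_iff_evaluation hℓ hc hx] at hxs
  rw [mem_nonvanishing_iff_evaluation hℓ (h V ℓ c hc) hx, map_pow]
  exact pow_ne_zero _ hxs

/-- If `X_s` is affine, where `s` is a section of a positive power of `L`, then so is
`X_s ∩ X_t`. -/
lemma isAffineOpen_inf (hL : IsLineBundle L) {r r' : ℕ} (hr : r ≠ 0)
    (s : Γ(tensorPow L r, (⊤ : X.Opens))) (t : Γ(tensorPow L r', (⊤ : X.Opens)))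
    (hs : IsAffineOpen (nonvanishingOpen s)) :
    IsAffineOpen (nonvanishingOpen s ⊓ nonvanishingOpen t) := by
  -- The powers t^r and s^r' have the same degree. On X_s the second one generates, so the first is
  -- a function times it, and X_s ∩ X_t is the basic open set of that function.
  obtain ⟨w, hw⟩ := exists_isPower t r rfl
  obtain ⟨w', hw'⟩ := exists_isPower s r' (mul_comm r' r)
  have hgen := (isGenerator_nonvanishingOpen w').res (hw'.le_nonvanishing hL)
  rw [res_res] at hgen
  obtain ⟨c, hc⟩ := exists_coord w hgen
  rw [← hw.nonvanishing hL hr, ← basicOpen_eq_inf hgen hc]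
  exact hs.basicOpen c

lemma mem_nonvanishing_sum (hL : IsLineBundle L) {ι : Type*} [Fintype ι] {N : ℕ}
    (s : ι → Γ(tensorPow L N, (⊤ : X.Opens))) {x : X} (i : ι) (hi : x ∈ nonvanishingOpen (s i))
    (hi' : ∀ j, j ≠ i → x ∉ nonvanishingOpen (s j)) : x ∈ nonvanishingOpen (∑ j, s j) := by
  obtain ⟨V, ℓ, hx, hℓ⟩ := hL x
  choose c hc using fun j => exists_coord (s j) (hℓ.powSec N)
  have hsum : res le_top (∑ j, s j) = (∑ j, c j) • powSec ℓ N := by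
    rw [map_sum, Finset.sum_smul]
    exact Finset.sum_congr rfl fun j _ => hc j
  rw [mem_nonvanishing_iff_evaluation hℓ hsum hx, map_sum, Finset.sum_eq_single i]
  · rwa [mem_nonvanishing_iff_evaluation hℓ (hc i) hx] at hi
  · intro j _ hj
    have := hi' j hj
    rwa [mem_nonvanishing_iff_evaluation hℓ (hc j) hx, not_not] at this
  · exact fun h => absurd (Finset.mem_univ i) h

/-- If all `X_{s_j}` are affine, then so is `X_s` for `s = ∑ s_j`. -/
lemma isAffineOpen_sum (hL : IsLineBundle L) {ι : Type*} [Fintype ι] {N : ℕ} (hN : N ≠ 0)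
    (s : ι → Γ(tensorPow L N, (⊤ : X.Opens))) (hs : ∀ i, IsAffineOpen (nonvanishingOpen (s i))) :
    IsAffineOpen (nonvanishingOpen (∑ j, s j)) := by
  have hgen := isGenerator_nonvanishingOpen (∑ j, s j)
  -- Relative to the generator ∑ s_j the summands have coordinates `c j` with sum 1, and the basic
  -- open sets of the `c j` are affine.
  choose c hc using fun j => exists_coord (s j) hgen
  refine isAffineOpen_of_isAffineOpen_basicOpen _ (Set.range c) ?_ ?_
  · rw [Ideal.eq_top_iff_one]
    have : ∑ j, c j = 1 := by
      apply (hgen.bijective le_rfl).1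
      simp only [res_rfl, one_smul, Finset.sum_smul]
      rw [map_sum]
      exact Finset.sum_congr rfl fun j _ => by rw [← map_sum, hc j]
    rw [← this]
    exact Ideal.sum_mem _ fun j _ => Ideal.subset_span ⟨j, rfl⟩
  · rintro _ ⟨j, rfl⟩
    rw [basicOpen_eq_inf hgen (hc j), inf_comm]
    exact isAffineOpen_inf hL hN _ _ (hs j)

/-- If `X_s` is affine, then every principal open subset of `X_s` is of the form `X_w`. -/
lemma exists_nonvanishing_eq_basicOpen [CompactSpace X] [X.IsSeparated] (hL : IsLineBundle L)
    [(unitSheaf X).IsQuasicoherent] {r : ℕ} (hr : r ≠ 0) (s : Γ(tensorPow L r, (⊤ : X.Opens)))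
    (b : Γ(X, nonvanishingOpen s)) :
    ∃ (N : ℕ) (w : Γ(tensorPow L N, (⊤ : X.Opens))), N ≠ 0 ∧
      nonvanishingOpen w = X.basicOpen b := by
  -- The function `b`, multiplied by a power of `s`, extends to a section `w`. Multiplying once more
  -- by `s` confines the locus to X_s and makes the degree positive.
  let T := powTwists L
  obtain ⟨n, hn⟩ := T.exists_extend_mul s hL (k := 0) b
  obtain ⟨μ, hμ⟩ := T.exists_isMul s n (k := 0) rfl
  let b₀ : Γ(T.obj 0, nonvanishingOpen s) := b
  obtain ⟨w, hw⟩ : ∃ w : Γ(tensorPow L (r * n + 0), (⊤ : X.Opens)),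
    res le_top w = μ.app (nonvanishingOpen s) b₀ := hn n le_rfl _ μ rfl hμ
  obtain ⟨w', hw'⟩ := exists_isProduct s w rfl
  refine ⟨_, w', by omega, ?_⟩
  rw [hw'.nonvanishing hL]
  ext x
  change x ∈ nonvanishingOpen s ∧ x ∈ nonvanishingOpen w ↔ x ∈ X.basicOpen b
  have key : ∀ hxs : x ∈ nonvanishingOpen s, x ∈ nonvanishingOpen w ↔ x ∈ X.basicOpen b := by
    intro hxs
    obtain ⟨V, ℓ, hx, hℓ⟩ := hL x
    obtain ⟨c, hc⟩ := exists_coord s (hℓ.powSec r)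
    have hle := (inf_le_right : V ⊓ nonvanishingOpen s ≤ nonvanishingOpen s)
    have hle' := (inf_le_left : V ⊓ nonvanishingOpen s ≤ V)
    have hℓ' := hℓ.res hle'
    have hx' : x ∈ V ⊓ nonvanishingOpen s := ⟨hx, hxs⟩
    have hc' : res le_top s = rres hle' c • powSec (res hle' ℓ) r := by
      rw [← res_powSec, ← res_smul, ← hc, res_res]
    have hwV : res le_top w = (rres hle' c ^ n * rres hle b) • powSec (res hle' ℓ) (r * n + 0) := by
      refine (res_res le_top hle w).symm.trans ((congrArg (res hle) hw).trans
        ((app_res μ hle b₀).symm.trans ?_))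
      have h1 := hμ _ (res hle' ℓ) _ (rres hle b) hc'
      have h2 : T.chart (res hle' ℓ) 0 (rres hle b) = res hle b₀ := by
        have : (rres hle b) * 1 = rres hle b := mul_one _
        exact this
      rw [h2] at h1
      exact h1
    rw [mem_nonvanishing_iff_evaluation hℓ' hwV hx', map_mul, map_pow, mul_ne_zero_iff]
    rw [mem_nonvanishing_iff_evaluation hℓ' hc' hx'] at hxs
    rw [X.evaluation_ne_zero_iff_mem_basicOpen]
    have h3 : X.basicOpen (rres hle b) = (V ⊓ nonvanishingOpen s) ⊓ X.basicOpen b :=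
      X.basicOpen_res b (homOfLE hle).op
    rw [h3]
    exact ⟨fun h => h.2.2, fun h => ⟨pow_ne_zero _ hxs, hx', h⟩⟩
  exact ⟨fun h => (key h.1).mp h.2, fun h => ⟨X.basicOpen_le b h, (key (X.basicOpen_le b h)).mpr h⟩⟩

/-- On an open subset where sections `s` of `L^{⊗ N}` and `t` of `L^{⊗ (N q + 1)}` do not vanish,
the line bundle `L` is trivial. -/
lemma exists_generator (hL : IsLineBundle L) {N q M : ℕ} (hM : M = N * q + 1)
    (s : Γ(tensorPow L N, (⊤ : X.Opens))) (t : Γ(tensorPow L M, (⊤ : X.Opens))) {U : X.Opens}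
    (hs : U ≤ nonvanishingOpen s) (ht : U ≤ nonvanishingOpen t) :
    ∃ ℓ : Γ(L, U), IsGenerator ℓ U le_rfl := by
  obtain ⟨μ, hμ⟩ : ∃ μ : tensorPow L 1 ⟶ tensorPow L M, ∀ (V : X.Opens) (ℓ : Γ(L, V))
      (c h : Γ(X, V)), res le_top s = c • powSec ℓ N →
        μ.app V (h • powSec ℓ 1) = (c ^ q * h) • powSec ℓ M := by
    obtain ⟨μ, hμ⟩ := (powTwists L).exists_isMul s q hM
    exact ⟨μ, fun V ℓ c h => hμ V ℓ c h⟩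
  -- Where `s` is invertible, multiplication by s^q identifies L with L^M; the generator sought is t
  -- / s^q.
  have bij : ∀ W ≤ U, Function.Bijective fun ℓ : Γ(L, W) => μ.app W (powSec ℓ 1) := by
    intro W hW
    refine bijective_of_locally (M := L) (N := tensorPow L M)
      (fun V _ ℓ => μ.app V (powSec ℓ 1)) (fun V V' _ hV' ℓ => ?_) (fun x hx => ?_)
    · refine (app_res μ hV' (powSec ℓ 1)).symm.trans ?_
      exact congrArg (μ.app V') (res_powSec hV' ℓ 1)
    · obtain ⟨V, ℓ, hxV, hℓ⟩ := hL x
      refine ⟨V, hxV, fun W' hW' hV' => ?_⟩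
      have hℓ' := hℓ.res hV'
      obtain ⟨c, hc⟩ := exists_coord s (hℓ'.powSec N)
      have hcu : IsUnit c := by
        have h1 := basicOpen_eq_inf (hℓ'.powSec N) hc
        rw [inf_eq_left.mpr ((hW'.trans hW).trans hs)] at h1
        exact isUnit_of_basicOpen_eq h1
      have e : (fun p : Γ(L, W') => μ.app W' (powSec p 1)) ∘
          (fun h : Γ(X, W') => h • res hV' ℓ) =
          (fun h : Γ(X, W') => h • powSec (res hV' ℓ) M) ∘ fun h => h * c ^ q := by
        funext h
        have h1 := hμ _ _ _ h hc
        have h2 : powSec (h • res hV' ℓ) 1 = h • powSec (res hV' ℓ) 1 := smul_tmul h _ _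
        simp only [Function.comp_apply]
        rw [h2, h1, mul_comm]
      have hb1 : Function.Bijective (fun h : Γ(X, W') => h • res hV' ℓ) := by
        simpa only [res_rfl] using hℓ'.bijective le_rfl
      refine (Function.Bijective.of_comp_iff _ hb1).mp ?_
      rw [e]
      refine Function.Bijective.comp ?_ (IsUnit.isUnit_iff_mulRight_bijective.mp (hcu.pow q))
      simpa only [res_rfl] using (hℓ'.powSec M).bijective le_rfl
  obtain ⟨ℓ, hℓ⟩ := (bij U le_rfl).2 (res le_top t)
  refine ⟨ℓ, fun W hW => ?_⟩
  have hgen := (isGenerator_nonvanishingOpen t).bijective (hW.trans ht)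
  have e : (fun r : Γ(X, W) => r • res (hW.trans ht) (res (le_top : nonvanishingOpen t ≤ ⊤) t)) =
      (fun p : Γ(L, W) => μ.app W (powSec p 1)) ∘ fun r => r • res hW ℓ := by
    funext r
    simp only [Function.comp_apply]
    have h2 : powSec (r • res hW ℓ) 1 = r • powSec (res hW ℓ) 1 := smul_tmul r _ _
    rw [h2, Scheme.Modules.Hom.app_smul, ← res_powSec, app_res, res_res]
    have h3 : μ.app U (powSec ℓ 1) = res le_top t := hℓ
    exact congrArg (r • ·) (((congrArg (res hW) h3).trans (res_res _ _ _)).symm)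
  rw [e] at hgen
  exact (Function.Bijective.of_comp_iff' (bij W hW) _).mp hgen

end NonvanishingLoci

/-! ### Affine neighbourhoods of finite sets of points that trivialize L. -/

section Points

variable {X : Scheme.{u}}

/-- The structure sheaf is the inverse image of that of the affine scheme Spec Γ(X, O_X). -/
instance isQuasicoherent_unitSheaf : (unitSheaf X).IsQuasicoherent := by
  have h : (unitSheaf (Spec Γ(X, ⊤))).IsQuasicoherent :=
    (isQuasicoherent_iff_isIso_fromTildeΓ _).mpr inferInstance
  exact (SheafOfModules.isQuasicoherent X.ringCatSheaf).prop_of_iso (pullbackUnitIso X.toSpecΓ)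
    (isQuasicoherent_pullback X.toSpecΓ (unitSheaf (Spec Γ(X, ⊤))))

variable {L : X.Modules}

/-- For finitely many points without specializations between them, there are sections of a common
power of an ample line bundle with affine non-vanishing loci trivializing `L`, each containing
precisely one of the points. -/
lemma IsAmple.exists_separating_sections [CompactSpace X] [X.IsSeparated] (hL : IsAmple L)
    {ι : Type*} [Fintype ι] (y : ι → X) (hy : ∀ j l, j ≠ l → y j ∉ closure {y l}) :
    ∃ (N : ℕ) (s : ι → Γ(tensorPow L N, (⊤ : X.Opens))), N ≠ 0 ∧ ∀ j,
      IsAffineOpen (nonvanishingOpen (s j)) ∧ y j ∈ nonvanishingOpen (s j) ∧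
      (∀ l, l ≠ j → y l ∉ nonvanishingOpen (s j)) ∧
      ∃ ℓ : Γ(L, nonvanishingOpen (s j)), IsGenerator ℓ (nonvanishingOpen (s j)) le_rfl := by
  classical
  have hLB := hL.isLineBundle
  have loc : ∀ j, ∃ (N : ℕ) (s : Γ(tensorPow L N, (⊤ : X.Opens))), N ≠ 0 ∧
      IsAffineOpen (nonvanishingOpen s) ∧ y j ∈ nonvanishingOpen s ∧
      (∀ l, l ≠ j → y l ∉ nonvanishingOpen s) ∧
      ∃ (V : X.Opens) (ℓ : Γ(L, V)), nonvanishingOpen s ≤ V ∧ IsGenerator ℓ V le_rfl := by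
    intro j
    obtain ⟨n, hn, u, U, hU, hUa, hyU⟩ := hL.exists_affine (y j)
    obtain rfl : U = nonvanishingOpen u := TopologicalSpace.Opens.ext hU
    obtain ⟨V, ℓ, hyV, hℓ⟩ := hLB (y j)
    -- The complement of the closures of the other points; it contains `y j` by hypothesis.
    let C : X.Opens := ⟨⋂ l ∈ {l | l ≠ j}, (closure {y l})ᶜ,
      Set.Finite.isOpen_biInter (Set.toFinite _) fun l _ => isClosed_closure.isOpen_compl⟩
    have hyC : y j ∈ C := Set.mem_iInter₂.mpr fun l hl => hy j l (Ne.symm hl)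
    obtain ⟨b, hb, hyb⟩ := hUa.exists_basicOpen_le (⟨y j, ⟨hyV, hyC⟩⟩ : (V ⊓ C : X.Opens)) hyU
    obtain ⟨N, w, hN, hw⟩ := exists_nonvanishing_eq_basicOpen hLB (by omega) u b
    refine ⟨N, w, hN, ?_, ?_, ?_, V, ℓ, ?_, hℓ⟩
    · rw [hw]
      exact hUa.basicOpen b
    · rw [hw]
      exact hyb
    · intro l hl h
      rw [hw] at h
      exact (Set.mem_iInter₂.mp (hb h).2 l hl) (subset_closure rfl)
    · rw [hw]
      exact hb.trans inf_le_left
  choose n u hn hua huy hul V ℓ hV hℓ using loc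
  -- Passing to powers gives all sections the common degree ∏ n i without changing their loci.
  have hq : ∀ j, ∃ q, q ≠ 0 ∧ ∏ i, n i = n j * q := by
    intro j
    obtain ⟨q, hq⟩ := Finset.dvd_prod_of_mem n (Finset.mem_univ j)
    refine ⟨q, ?_, hq⟩
    rintro rfl
    rw [mul_zero, Finset.prod_eq_zero_iff] at hq
    obtain ⟨i, -, hi⟩ := hq
    exact hn i hi
  choose q hq0 hq using hq
  choose s hs using fun j => exists_isPower (u j) (q j) (hq j)
  refine ⟨∏ i, n i, s, Finset.prod_ne_zero_iff.mpr fun i _ => hn i, fun j => ?_⟩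
  have e := (hs j).nonvanishing hLB (hq0 j)
  rw [e]
  exact ⟨hua j, huy j, hul j, res (hV j) (ℓ j), (hℓ j).res (hV j)⟩

/-- Finitely many points without specializations between them lie in an affine open subset `X_v`
on which the ample line bundle `L` is trivial. -/
lemma IsAmple.exists_section_of_points [CompactSpace X] [X.IsSeparated] (hL : IsAmple L)
    {ι : Type*} [Fintype ι] (y : ι → X) (hy : ∀ j l, j ≠ l → y j ∉ closure {y l}) :
    ∃ (N : ℕ) (v : Γ(tensorPow L N, (⊤ : X.Opens))), N ≠ 0 ∧ IsAffineOpen (nonvanishingOpen v) ∧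
      (∀ j, y j ∈ nonvanishingOpen v) ∧
      ∃ ℓ : Γ(L, nonvanishingOpen v), IsGenerator ℓ (nonvanishingOpen v) le_rfl := by
  have hLB := hL.isLineBundle
  obtain ⟨N, s, hN, hs⟩ := hL.exists_separating_sections y hy
  choose hsa hsy hsl ℓ hℓ using hs
  choose n hn using fun j => (powTwists L).exists_extend_mul (s j) hLB (k := 1) (powSec (ℓ j) 1)
  let q := Finset.univ.sup n
  have hw : ∀ j, ∃ w : Γ(tensorPow L (N * q + 1), (⊤ : X.Opens)),
      nonvanishingOpen (s j) ≤ nonvanishingOpen w := by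
    intro j
    obtain ⟨μ, hμ⟩ : ∃ μ : tensorPow L 1 ⟶ tensorPow L (N * q + 1),
        (powTwists L).IsMul (s j) q (k := 1) (K := N * q + 1) μ :=
      (powTwists L).exists_isMul (s j) q (k := 1) rfl
    obtain ⟨w, hw⟩ : ∃ w : Γ(tensorPow L (N * q + 1), (⊤ : X.Opens)),
        res le_top w = μ.app (nonvanishingOpen (s j)) (powSec (ℓ j) 1) :=
      hn j q (Finset.le_sup (Finset.mem_univ j)) (N * q + 1) μ rfl hμ
    obtain ⟨c, hc⟩ := exists_coord (s j) ((hℓ j).powSec N)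
    have hwc : res le_top w = c ^ q • powSec (ℓ j) (N * q + 1) := by
      have h1 : μ.app _ ((1 : Γ(X, nonvanishingOpen (s j))) • powSec (ℓ j) 1) =
        (c ^ q * 1) • powSec (ℓ j) (N * q + 1) := hμ _ (ℓ j) c (1 : Γ(X, nonvanishingOpen (s j))) hc
      rw [one_smul, mul_one] at h1
      exact hw.trans h1
    refine ⟨w, fun x hx => ?_⟩
    have hx' : x ∈ nonvanishingOpen (s j) := hx
    change x ∈ nonvanishingOpen w
    rw [mem_nonvanishing_iff_evaluation (hℓ j) hc hx] at hx'
    rw [mem_nonvanishing_iff_evaluation (hℓ j) hwc hx, map_pow]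
    exact pow_ne_zero _ hx'
  choose w hw using hw
  -- `w j` extends s_j^q ℓ_j and may be nonzero outside X_{s_j}; the extra factor `s j` makes `t j`
  -- vanish there. The degree is 1 modulo N, as required by `exists_generator`.
  choose t ht using fun j => exists_isProduct (s j) (w j)
    (show N * (q + 1) + 1 = N + (N * q + 1) by ring)
  have het : ∀ j, nonvanishingOpen (t j) = nonvanishingOpen (s j) := fun j => by
    rw [(ht j).nonvanishing hLB]
    exact inf_eq_left.mpr (hw j)
  -- At each of the points exactly one summand of either sum is nonzero, so neither sum vanishes
  -- there.
  obtain ⟨v, hv⟩ := exists_isProduct (∑ j, s j) (∑ j, t j) rfl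
  have hev := hv.nonvanishing hLB
  refine ⟨_, v, by omega, ?_, fun j => ?_, ?_⟩
  · rw [hev]
    exact isAffineOpen_inf hLB hN _ _ (isAffineOpen_sum hLB hN s hsa)
  · rw [hev]
    refine ⟨mem_nonvanishing_sum hLB s j (hsy j) fun l hl => hsl l j hl.symm,
      mem_nonvanishing_sum hLB t j ?_ fun l hl => ?_⟩
    · rw [het]
      exact hsy j
    · rw [het]
      exact hsl l j hl.symm
  · rw [hev]
    exact exists_generator hLB rfl (∑ j, s j) (∑ j, t j) inf_le_left inf_le_right

end Points

/-! ### Inverse images of functions and sections. -/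

section Pull

variable {X Y A : Scheme.{u}}

/-- The inverse image of functions. -/
def rpull (r : X ⟶ Y) {V : Y.Opens} {W : X.Opens} (h : W ≤ r ⁻¹ᵁ V) : Γ(Y, V) →+* Γ(X, W) :=
  (rres h).comp (r.app V).hom

/-- The inverse image of sections given by a morphism `N ⟶ r_* M`. -/
def pull {r : X ⟶ Y} {N : Y.Modules} {M : X.Modules}
    (φ : N ⟶ (Scheme.Modules.pushforward r).obj M) {V : Y.Opens} {W : X.Opens} (h : W ≤ r ⁻¹ᵁ V) :
    Γ(N, V) →+ Γ(M, W) :=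
  (res h).comp (φ.app V).hom

section

variable {r : X ⟶ Y} {V V' : Y.Opens} {W W' : X.Opens}

lemma rres_rpull (h : W ≤ r ⁻¹ᵁ V) (h' : W' ≤ W) (c : Γ(Y, V)) :
    rres h' (rpull r h c) = rpull r (h'.trans h) c :=
  rres_rres h h' _

lemma rpull_rres (h : W ≤ r ⁻¹ᵁ V) (h' : V ≤ V') (c : Γ(Y, V')) :
    rpull r h (rres h' c) = rpull r (h.trans (r.preimage_mono h')) c :=
  (congrArg (rres h) (app_rres r h' c)).trans (rres_rres _ _ _)

lemma basicOpen_rpull (h : W ≤ r ⁻¹ᵁ V) (c : Γ(Y, V)) :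
    X.basicOpen (rpull r h c) = W ⊓ r ⁻¹ᵁ (Y.basicOpen c) := by
  have h1 : X.basicOpen (rpull r h c) = W ⊓ X.basicOpen (r.app V c) :=
    X.basicOpen_res _ (homOfLE h).op
  rw [h1, ← Scheme.preimage_basicOpen]

variable {N N' : Y.Modules} {M M' : X.Modules} (φ : N ⟶ (Scheme.Modules.pushforward r).obj M)
  (χ : N' ⟶ (Scheme.Modules.pushforward r).obj M')

lemma pull_smul (h : W ≤ r ⁻¹ᵁ V) (c : Γ(Y, V)) (n : Γ(N, V)) :
    pull φ h (c • n) = rpull r h c • pull φ h n :=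
  (congrArg (res h) (pushforward_app_smul φ c n)).trans (res_smul h _ _)

lemma res_pull (h : W ≤ r ⁻¹ᵁ V) (h' : W' ≤ W) (n : Γ(N, V)) :
    res h' (pull φ h n) = pull φ (h'.trans h) n :=
  res_res h h' _

lemma pull_res (h : W ≤ r ⁻¹ᵁ V) (h' : V ≤ V') (n : Γ(N, V')) :
    pull φ h (res h' n) = pull φ (h.trans (r.preimage_mono h')) n :=
  (congrArg (res h) (pushforward_app_res φ h' n)).trans (res_res _ _ _)

lemma pull_le_rfl (n : Γ(N, V)) : pull φ le_rfl n = φ.app V n :=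
  res_rfl _ _

lemma pull_tmul (h : W ≤ r ⁻¹ᵁ V) (n : Γ(N, V)) (n' : Γ(N', V)) :
    pull (tensorOver r φ χ) h (tmul n n') = tmul (pull φ h n) (pull χ h n') :=
  (congrArg (res h) (tensorOver_tmul r φ χ n n')).trans (res_tmul h _ _)

lemma pull_powSec (h : W ≤ r ⁻¹ᵁ V) (n : Γ(N, V)) (k : ℕ) :
    pull (tensorPowOver r φ k) h (powSec n k) = powSec (pull φ h n) k := by
  induction k with
  | zero => exact map_one (rpull r h)
  | succ k ih =>
    have h1 := pull_tmul φ (tensorPowOver r φ k) h n (powSec n k)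
    rw [ih] at h1
    exact h1

end

lemma res_eq_res {M : X.Modules} {U V W : X.Opens} {s : Γ(M, U)} {t : Γ(M, V)} (hV : U ≤ V)
    (e : s = res hV t) (hW : W ≤ U) : res hW s = res (hW.trans hV) t := by
  rw [e, res_res]

lemma pullbackOver_app_unit {B : Scheme.{u}} {h : A ⟶ B} {a : A ⟶ X} {b : B ⟶ Y} {r : X ⟶ Y}
    (sq : h ≫ b = a ≫ r) {F : Y.Modules} {E : X.Modules}
    (φ : F ⟶ (Scheme.Modules.pushforward r).obj E) {V : Y.Opens}
    (hV : h ⁻¹ᵁ b ⁻¹ᵁ V ≤ a ⁻¹ᵁ r ⁻¹ᵁ V) (s : Γ(F, V)) :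
    (pullbackOver sq φ).app (b ⁻¹ᵁ V) ((unitOf b F).app V s) =
      res (M := (Scheme.Modules.pullback a).obj E) hV
        ((unitOf a E).app (r ⁻¹ᵁ V) (φ.app V s)) := by
  have e := (Adjunction.homEquiv_unit (Scheme.Modules.pullbackPushforwardAdjunction b) F _
    (pullbackOver sq φ)).symm.trans (Equiv.apply_symm_apply _ _)
  generalize pullbackOver sq φ = P at e ⊢
  have e' := congrArg (fun q => Scheme.Modules.Hom.app q V) e
  simp only [Scheme.Modules.Hom.comp_app, Scheme.Modules.pushforwardComp_hom_app_app,
    Scheme.Modules.pushforwardComp_inv_app_app, Scheme.Modules.pushforwardCongr_hom_app_app] at e'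
  exact ConcreteCategory.congr_hom e' s

/-- The inverse images of sections are compatible with the functoriality of inverse images of
sheaves. -/
lemma pull_pullbackOver {B : Scheme.{u}} {h : A ⟶ B} {a : A ⟶ X} {b : B ⟶ Y} {r : X ⟶ Y}
    (sq : h ≫ b = a ≫ r) {F : Y.Modules} {E : X.Modules}
    (φ : F ⟶ (Scheme.Modules.pushforward r).obj E) {V : Y.Opens} {V' : B.Opens} {W : X.Opens}
    {W' : A.Opens} (h₁ : V' ≤ b ⁻¹ᵁ V) (h₂ : W' ≤ h ⁻¹ᵁ V') (h₃ : W ≤ r ⁻¹ᵁ V)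
    (h₄ : W' ≤ a ⁻¹ᵁ W) (s : Γ(F, V)) :
    pull (pullbackOver sq φ) h₂ (pull (unitOf b F) h₁ s) =
      pull (unitOf a E) h₄ (pull φ h₃ s) := by
  have hV : h ⁻¹ᵁ b ⁻¹ᵁ V ≤ a ⁻¹ᵁ r ⁻¹ᵁ V := by
    rw [← Scheme.Hom.comp_preimage, ← Scheme.Hom.comp_preimage, sq]
  have e2 := pullbackOver_app_unit sq φ hV s
  generalize pullbackOver sq φ = P at e2 ⊢
  have e3 : pull P h₂ (pull (unitOf b F) h₁ s) =
      pull P (h₂.trans (h.preimage_mono h₁)) ((unitOf b F).app V s) := pull_res P h₂ h₁ _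
  have e4 : pull (unitOf a E) h₄ (pull φ h₃ s) =
      pull (unitOf a E) (h₄.trans (a.preimage_mono h₃)) (φ.app V s) := pull_res _ h₄ h₃ _
  refine e3.trans (Eq.trans ?_ e4.symm)
  exact res_eq_res (M := (Scheme.Modules.pullback a).obj E) hV e2 _

end Pull

/-! ### Composition laws for g^* on functions and sections. -/

section Equivariant

variable {X : Scheme.{u}} {G : Type v} [Group G] {ρ : G →* Aut X} {M : X.Modules}

lemma le_preimage_mul {g h : G} {V V' W : X.Opens} (hV : V' ≤ (ρ g).hom ⁻¹ᵁ V)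
    (hW : W ≤ (ρ h).hom ⁻¹ᵁ V') : W ≤ (ρ (g * h)).hom ⁻¹ᵁ V := by
  rw [map_mul]
  exact hW.trans ((ρ h).hom.preimage_mono hV)

lemma le_preimage_one {V W : X.Opens} (h : W ≤ V) : W ≤ (ρ 1).hom ⁻¹ᵁ V := by
  rw [map_one]
  exact h

lemma rpull_congr {Y : Scheme.{u}} {r r' : X ⟶ Y} (e : r = r') {V : Y.Opens} {W : X.Opens}
    (h : W ≤ r ⁻¹ᵁ V) (c : Γ(Y, V)) : rpull r h c = rpull r' (e ▸ h) c := by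
  subst e
  rfl

lemma rpull_comp {Y T : Scheme.{u}} (r : X ⟶ Y) (q : Y ⟶ T) {V : T.Opens} {V' : Y.Opens}
    {W : X.Opens} (hV : V' ≤ q ⁻¹ᵁ V) (hW : W ≤ r ⁻¹ᵁ V') (c : Γ(T, V)) :
    rpull r hW (rpull q hV c) = rpull (r ≫ q) (hW.trans (r.preimage_mono hV)) c := by
  refine (rpull_rres hW hV _).trans ?_
  change rres _ _ = rres _ _
  congr 1

lemma rpull_id {V W : X.Opens} (h : W ≤ V) (c : Γ(X, V)) : rpull (𝟙 X) h c = rres h c := by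
  change rres _ _ = rres _ _
  simp

lemma rpull_mul {g h : G} {V V' W : X.Opens} (hV : V' ≤ (ρ g).hom ⁻¹ᵁ V)
    (hW : W ≤ (ρ h).hom ⁻¹ᵁ V') (c : Γ(X, V)) :
    rpull (ρ h).hom hW (rpull (ρ g).hom hV c) =
      rpull (ρ (g * h)).hom (le_preimage_mul hV hW) c := by
  rw [rpull_comp]
  exact rpull_congr (by rw [map_mul]; rfl) _ _

lemma rpull_one {V W : X.Opens} (h : W ≤ V) (c : Γ(X, V)) :
    rpull (ρ 1).hom (le_preimage_one h) c = rres h c := by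
  rw [← rpull_id]
  exact rpull_congr (by rw [map_one]; rfl) _ _

namespace EquivariantStructure

variable (φ : EquivariantStructure ρ M)

lemma pull_mul {g h : G} {V V' W : X.Opens} (hV : V' ≤ (ρ g).hom ⁻¹ᵁ V)
    (hW : W ≤ (ρ h).hom ⁻¹ᵁ V') (m : Γ(M, V)) :
    pull (φ.lift h) hW (pull (φ.lift g) hV m) =
      pull (φ.lift (g * h)) (le_preimage_mul hV hW) m := by
  refine (pull_res _ _ _ _).trans ?_
  have e := congrArg (fun q => Scheme.Modules.Hom.app q V) (φ.lift_mul g h)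
  simp only [Scheme.Modules.Hom.comp_app, Scheme.Modules.pushforwardComp_hom_app_app,
    Scheme.Modules.pushforwardCongr_hom_app_app] at e
  have e1 := ConcreteCategory.congr_hom e m
  have hV : (ρ (g * h)).hom ⁻¹ᵁ V = (ρ h).hom ⁻¹ᵁ (ρ g).hom ⁻¹ᵁ V := by
    rw [map_mul]
    rfl
  have e2 : (φ.lift (g * h)).app V m = res (M := M) hV.le
      ((φ.lift h).app ((ρ g).hom ⁻¹ᵁ V) ((φ.lift g).app V m)) := e1
  exact (res_eq_res (M := M) hV.le e2 _).symm

lemma pull_one {V W : X.Opens} (h : W ≤ V) (m : Γ(M, V)) :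
    pull (φ.lift 1) (le_preimage_one h) m = res h m := by
  have e := congrArg (fun q => Scheme.Modules.Hom.app q V) φ.lift_one
  simp only [Scheme.Modules.Hom.comp_app, Scheme.Modules.pushforwardId_inv_app_app,
    Scheme.Modules.pushforwardCongr_hom_app_app] at e
  have hV : (ρ 1).hom ⁻¹ᵁ V = V := by
    rw [map_one]
    rfl
  have e2 : (φ.lift 1).app V m = res (M := M) hV.le m := ConcreteCategory.congr_hom e m
  exact res_eq_res (M := M) hV.le e2 _

/-- The inverse image of a generator is a generator. -/
lemma isGenerator_pull {V W : X.Opens} {ℓ : Γ(M, V)} (hℓ : IsGenerator ℓ V le_rfl) (g : G)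
    (hW : W ≤ (ρ g).hom ⁻¹ᵁ V) : IsGenerator (pull (φ.lift g) hW ℓ) W le_rfl := by
  intro W' hW'
  let V' : X.Opens := (ρ g⁻¹).hom ⁻¹ᵁ W'
  have hVW : V' ≤ (ρ g⁻¹).hom ⁻¹ᵁ W' := le_rfl
  have hid : ∀ U : X.Opens, (ρ g).hom ⁻¹ᵁ (ρ g⁻¹).hom ⁻¹ᵁ U = U := by
    intro U
    rw [← Scheme.Hom.comp_preimage, show (ρ g).hom ≫ (ρ g⁻¹).hom = 𝟙 X by
      rw [map_inv]; exact (ρ g).hom_inv_id]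
    rfl
  have hid' : ∀ U : X.Opens, (ρ g⁻¹).hom ⁻¹ᵁ (ρ g).hom ⁻¹ᵁ U = U := by
    intro U
    rw [← Scheme.Hom.comp_preimage, show (ρ g⁻¹).hom ≫ (ρ g).hom = 𝟙 X by
      rw [map_inv]; exact (ρ g).inv_hom_id]
    rfl
  have hWV : W' ≤ (ρ g).hom ⁻¹ᵁ V' := (hid W').ge
  have hVV : V' ≤ V := by
    rw [← hid' V]
    exact (ρ g⁻¹).hom.preimage_mono (hW'.trans hW)
  have hb := hℓ.bijective hVV
  have hres : M.presheaf.map (homOfLE (hW'.trans le_rfl)).op (pull (φ.lift g) hW ℓ) =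
      pull (φ.lift g) hWV (res hVV ℓ) := by
    rw [pull_res]
    exact res_pull _ hW hW' ℓ
  rw [hres]
  have one_res : ∀ {k : G} (_ : k = 1) (h : W' ≤ (ρ k).hom ⁻¹ᵁ W') (m : Γ(M, W')),
      pull (φ.lift k) h m = m := by
    rintro k rfl h m
    exact (φ.pull_one le_rfl m).trans (res_rfl _ _)
  have one_res' : ∀ {k : G} (_ : k = 1) (h : V' ≤ (ρ k).hom ⁻¹ᵁ V') (m : Γ(M, V')),
      pull (φ.lift k) h m = m := by
    rintro k rfl h m
    exact (φ.pull_one le_rfl m).trans (res_rfl _ _)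
  have one_rres : ∀ {k : G} (_ : k = 1) (h : W' ≤ (ρ k).hom ⁻¹ᵁ W') (m : Γ(X, W')),
      rpull (ρ k).hom h m = m := by
    rintro k rfl h m
    exact (rpull_one le_rfl m).trans (rres_rfl _ _)
  have one_rres' : ∀ {k : G} (_ : k = 1) (h : V' ≤ (ρ k).hom ⁻¹ᵁ V') (m : Γ(X, V')),
      rpull (ρ k).hom h m = m := by
    rintro k rfl h m
    exact (rpull_one le_rfl m).trans (rres_rfl _ _)
  have hbM : Function.Bijective (pull (φ.lift g) hWV) := by
    refine Function.bijective_iff_has_inverse.mpr ⟨pull (φ.lift g⁻¹) hVW, fun m => ?_, fun m => ?_⟩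
    · rw [φ.pull_mul]
      exact one_res' (mul_inv_cancel g) _ m
    · rw [φ.pull_mul]
      exact one_res (inv_mul_cancel g) _ m
  have hbX : Function.Bijective (rpull (ρ g⁻¹).hom hVW) := by
    refine Function.bijective_iff_has_inverse.mpr ⟨rpull (ρ g).hom hWV, fun m => ?_, fun m => ?_⟩
    · rw [rpull_mul]
      exact one_rres (inv_mul_cancel g) _ m
    · rw [rpull_mul]
      exact one_rres' (mul_inv_cancel g) _ m
  -- Via the bijections g^*, multiplication by the pulled back section corresponds to multiplication
  -- by `ℓ`.
  have e : (fun r : Γ(X, W') => r • pull (φ.lift g) hWV (res hVV ℓ)) =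
      pull (φ.lift g) hWV ∘ (fun r => r • res hVV ℓ) ∘ rpull (ρ g⁻¹).hom hVW := by
    funext r
    simp only [Function.comp_apply]
    rw [pull_smul, rpull_mul, one_rres (inv_mul_cancel g)]
  rw [e]
  exact hbM.comp (hb.comp hbX)

end EquivariantStructure

end Equivariant

/-! ### Invariant sections as norms. -/

section Norm

variable {X : Scheme.{u}} {G : Type v} [Group G] {ρ : G →* Aut X} {L : X.Modules}
  (φ : EquivariantStructure ρ L)

lemma top_le_preimage {Y : Scheme.{u}} (r : X ⟶ Y) : (⊤ : X.Opens) ≤ r ⁻¹ᵁ ⊤ := fun _ _ => trivial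

/-- The inverse image `g^* v` of a global section of `L^{⊗ d}`. -/
def pullPow {d : ℕ} (v : Γ(tensorPow L d, (⊤ : X.Opens))) (g : G) :
    Γ(tensorPow L d, (⊤ : X.Opens)) :=
  pull (tensorPowOver (ρ g).hom (φ.lift g) d) (top_le_preimage _) v

lemma res_pullPow {d : ℕ} {v : Γ(tensorPow L d, (⊤ : X.Opens))} {V W : X.Opens} {ℓ : Γ(L, V)}
    {c : Γ(X, V)} (hc : res le_top v = c • powSec ℓ d) (g : G) (hW : W ≤ (ρ g).hom ⁻¹ᵁ V) :
    res le_top (pullPow φ v g) = rpull (ρ g).hom hW c • powSec (pull (φ.lift g) hW ℓ) d := by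
  refine (res_pull _ _ _ v).trans ?_
  refine (pull_res (tensorPowOver (ρ g).hom (φ.lift g) d) hW le_top v).symm.trans ?_
  rw [hc, pull_smul, pull_powSec]

lemma nonvanishing_pullPow (hL : IsLineBundle L) {d : ℕ} (v : Γ(tensorPow L d, (⊤ : X.Opens)))
    (g : G) : nonvanishingOpen (pullPow φ v g) = (ρ g).hom ⁻¹ᵁ nonvanishingOpen v := by
  ext x
  obtain ⟨V, ℓ, hx, hℓ⟩ := hL ((ρ g).hom x)
  obtain ⟨c, hc⟩ := exists_coord v (hℓ.powSec d)
  have h1 := res_pullPow φ hc g le_rfl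
  have h2 := φ.isGenerator_pull hℓ g le_rfl
  have hx' : x ∈ (ρ g).hom ⁻¹ᵁ V := hx
  change x ∈ nonvanishingOpen (pullPow φ v g) ↔ (ρ g).hom x ∈ nonvanishingOpen v
  rw [mem_nonvanishing_iff (h2.powSec d) h1 hx', mem_nonvanishing_iff (hℓ.powSec d) hc hx,
    basicOpen_rpull]
  exact ⟨fun h => h.2, fun h => ⟨hx', h⟩⟩

lemma exists_prod_section {ι : Type*} {d : ℕ} (v : ι → Γ(tensorPow L d, (⊤ : X.Opens)))
    (s : Finset ι) : ∃ w : Γ(tensorPow L (d * s.card), (⊤ : X.Opens)),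
      ∀ (V : X.Opens) (ℓ : Γ(L, V)) (c : ι → Γ(X, V)),
        (∀ i ∈ s, res le_top (v i) = c i • powSec ℓ d) →
        res le_top w = (∏ i ∈ s, c i) • powSec ℓ (d * s.card) := by
  classical
  induction s using Finset.induction_on with
  | empty =>
    refine ⟨(1 : Γ(X, ⊤)), fun V ℓ c _ => ?_⟩
    have h1 : res (M := tensorPow L 0) (le_top : V ≤ ⊤) (1 : Γ(X, ⊤)) = (1 : Γ(X, V)) :=
      map_one (rres le_top)
    rw [Finset.prod_empty, one_smul]
    exact h1
  | insert i s hi ih =>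
    obtain ⟨w, hw⟩ := ih
    obtain ⟨w', hw'⟩ := exists_isProduct (v i) w
      (show d * (insert i s).card = d + d * s.card by rw [Finset.card_insert_of_notMem hi]; ring)
    refine ⟨w', fun V ℓ c hc => ?_⟩
    rw [Finset.prod_insert hi]
    exact hw' V ℓ _ _ (hc i (Finset.mem_insert_self i s))
      (hw V ℓ c fun j hj => hc j (Finset.mem_insert_of_mem hj))

/-- The norm of a section of a power of `L`. -/
lemma exists_invariant_section [Finite G] (hL : IsLineBundle L) {d : ℕ} (hd : d ≠ 0)
    (v : Γ(tensorPow L d, (⊤ : X.Opens))) (hv : IsAffineOpen (nonvanishingOpen v)) :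
    ∃ (N : ℕ) (w : Γ(tensorPow L N, (⊤ : X.Opens))), N ≠ 0 ∧ (∀ g, pullPow φ w g = w) ∧
      IsAffineOpen (nonvanishingOpen w) ∧ nonvanishingOpen w ≤ nonvanishingOpen v ∧
      ∀ x, (∀ g, (ρ g).hom x ∈ nonvanishingOpen v) → x ∈ nonvanishingOpen w := by
  have := Fintype.ofFinite G
  -- The norm ∏ g^* v. Its locus is the intersection of the translates of X_v, and it is affine as
  -- X_v ∩ X_w.
  obtain ⟨w, hw⟩ := exists_prod_section (pullPow φ v) Finset.univ
  have key : ∀ x, x ∈ nonvanishingOpen w ↔ ∀ g, (ρ g).hom x ∈ nonvanishingOpen v := by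
    intro x
    obtain ⟨V, ℓ, hx, hℓ⟩ := hL x
    choose c hc using fun g => exists_coord (pullPow φ v g) (hℓ.powSec d)
    rw [mem_nonvanishing_iff_evaluation hℓ (hw V ℓ c fun g _ => hc g) hx, map_prod,
      Finset.prod_ne_zero_iff]
    refine ⟨fun h g => ?_, fun h g _ => ?_⟩
    · have h1 := h g (Finset.mem_univ g)
      rw [← mem_nonvanishing_iff_evaluation hℓ (hc g) hx, nonvanishing_pullPow φ hL] at h1
      exact h1
    · rw [← mem_nonvanishing_iff_evaluation hℓ (hc g) hx, nonvanishing_pullPow φ hL]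
      exact h g
  have hle : nonvanishingOpen w ≤ nonvanishingOpen v := by
    intro x hx
    have h1 := (key x).mp hx 1
    rw [map_one] at h1
    exact h1
  refine ⟨_, w, mul_ne_zero hd Fintype.card_ne_zero, fun g => ?_, ?_, hle, fun x => (key x).mpr⟩
  -- g^* permutes the factors, since g^* (h g⁻¹)^* v = h^* v. This is checked on coordinates with
  -- respect to the generator g^* ℓ.
  · refine section_ext fun x _ => ?_
    obtain ⟨V, ℓ, hx, hℓ⟩ := hL ((ρ g).hom x)
    choose c hc using fun h => exists_coord (pullPow φ v h) (hℓ.powSec d)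
    refine ⟨(ρ g).hom ⁻¹ᵁ V, le_top, hx, ?_⟩
    rw [res_pullPow φ (hw V ℓ c fun h _ => hc h) g le_rfl, map_prod]
    refine Eq.symm ((hw _ (pull (φ.lift g) le_rfl ℓ)
      (fun h => rpull (ρ g).hom le_rfl (c (h * g⁻¹))) fun h _ => ?_).trans ?_)
    · have h1 := res_pullPow φ (hc (h * g⁻¹)) g le_rfl
      rw [← h1]
      congr 1
      refine section_ext fun y _ => ?_
      obtain ⟨V', ℓ', hy', hℓ'⟩ := hL ((ρ h).hom y)
      obtain ⟨c', hc'⟩ := exists_coord v (hℓ'.powSec d)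
      let V'' : X.Opens := (ρ (h * g⁻¹)).hom ⁻¹ᵁ V'
      have hVV : (ρ g).hom ⁻¹ᵁ V'' = (ρ h).hom ⁻¹ᵁ V' := by
        have : (ρ g).hom ⁻¹ᵁ V'' = (ρ (h * g⁻¹ * g)).hom ⁻¹ᵁ V' := by
          rw [map_mul ρ (h * g⁻¹) g]
          rfl
        rw [this, inv_mul_cancel_right]
      refine ⟨(ρ g).hom ⁻¹ᵁ V'', le_top, by rw [hVV]; exact hy', ?_⟩
      have h2 := res_pullPow φ (res_pullPow φ hc' (h * g⁻¹) (W := V'') le_rfl) g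
        (W := (ρ g).hom ⁻¹ᵁ V'') le_rfl
      have h3 := res_pullPow φ hc' h hVV.le
      rw [h2, h3, φ.pull_mul, rpull_mul]
      have e : ∀ (k : G) (_ : k = h) (hk : (ρ g).hom ⁻¹ᵁ V'' ≤ (ρ k).hom ⁻¹ᵁ V'),
          rpull (ρ h).hom hVV.le c' • powSec (pull (φ.lift h) hVV.le ℓ') d =
          rpull (ρ k).hom hk c' • powSec (pull (φ.lift k) hk ℓ') d := by
        rintro k rfl hk
        rfl
      exact e _ (inv_mul_cancel_right h g) _
    · congr 1
      exact Fintype.prod_equiv (Equiv.mulRight g⁻¹) _ _ fun h => rfl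
  · have h1 := isAffineOpen_inf hL hd v w hv
    rwa [inf_eq_right.mpr hle] at h1

lemma preimage_nonvanishing_of_invariant (hL : IsLineBundle L) {d : ℕ}
    {w : Γ(tensorPow L d, (⊤ : X.Opens))} (hw : ∀ g, pullPow φ w g = w) (g : G) :
    (ρ g).hom ⁻¹ᵁ nonvanishingOpen w = nonvanishingOpen w := by
  rw [← nonvanishing_pullPow φ hL, hw]

/-- Multiplying a section by a function. -/
lemma nonvanishing_smul (hL : IsLineBundle L) {d : ℕ} (w : Γ(tensorPow L d, (⊤ : X.Opens)))
    (b : Γ(X, (⊤ : X.Opens))) :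
    nonvanishingOpen (b • w) = nonvanishingOpen w ⊓ X.basicOpen b := by
  ext x
  obtain ⟨V, ℓ, hx, hℓ⟩ := hL x
  obtain ⟨c, hc⟩ := exists_coord w (hℓ.powSec d)
  have h1 : res le_top (b • w) = (rres le_top b * c) • powSec ℓ d := by
    rw [res_smul, hc, smul_smul]
  change x ∈ nonvanishingOpen (b • w) ↔ x ∈ nonvanishingOpen w ∧ x ∈ X.basicOpen b
  rw [mem_nonvanishing_iff (hℓ.powSec d) h1 hx, mem_nonvanishing_iff (hℓ.powSec d) hc hx,
    Scheme.basicOpen_mul]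
  have h2 : X.basicOpen (rres (le_top : V ≤ ⊤) b) = V ⊓ X.basicOpen b :=
    X.basicOpen_res b (homOfLE le_top).op
  rw [h2]
  exact ⟨fun h => ⟨h.2, h.1.2⟩, fun h => ⟨⟨hx, h.2⟩, h.1⟩⟩

end Norm

/-! ### Separatedness and finite type of projective morphisms. -/

section Projective

variable {R : Type u} [CommRing R] {X : Scheme.{u}}

/-- Forms of degree zero are constants. Hence the second factor of `projectiveSpaceHom` is a closed
immersion, and separatedness and finite type only concern Proj over its degree zero part. -/
lemma algebraMap_degree_zero_surjective (n : ℕ) :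
    Function.Surjective
      (algebraMap R (MvPolynomial.homogeneousSubmodule (Fin (n + 1)) R 0)) := by
  rintro ⟨p, hp⟩
  rw [MvPolynomial.homogeneousSubmodule_zero, Submodule.mem_one] at hp
  obtain ⟨r, hr⟩ := hp
  exact ⟨r, Subtype.ext hr⟩

lemma isClosedImmersion_SpecMap_degree_zero (n : ℕ) :
    IsClosedImmersion (Spec.map (CommRingCat.ofHom
      (algebraMap R (MvPolynomial.homogeneousSubmodule (Fin (n + 1)) R 0)))) :=
  IsClosedImmersion.spec_of_surjective _ (algebraMap_degree_zero_surjective n)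

lemma IsProjective.isSeparated {f : X ⟶ Spec (.of R)} (hf : IsProjective f) : IsSeparated f := by
  obtain ⟨n, j, hj, rfl⟩ := hf
  have := isClosedImmersion_SpecMap_degree_zero (R := R) n
  unfold projectiveSpaceHom
  infer_instance

lemma IsProjective.locallyOfFiniteType {f : X ⟶ Spec (.of R)} (hf : IsProjective f) :
    LocallyOfFiniteType f := by
  obtain ⟨n, j, hj, rfl⟩ := hf
  have := isClosedImmersion_SpecMap_degree_zero (R := R) n
  have : IsScalarTower R (MvPolynomial.homogeneousSubmodule (Fin (n + 1)) R 0)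
    (MvPolynomial (Fin (n + 1)) R) := ⟨fun r a p => smul_assoc r (a : MvPolynomial (Fin (n + 1)) R) p⟩
  have : Algebra.FiniteType (MvPolynomial.homogeneousSubmodule (Fin (n + 1)) R 0)
      (MvPolynomial (Fin (n + 1)) R) := Algebra.FiniteType.of_restrictScalars_finiteType R _ _
  unfold projectiveSpaceHom
  infer_instance

lemma isSeparated_of_isProjective {f : X ⟶ Spec (.of R)} (hf : IsProjective f) :
    X.IsSeparated := by
  have := hf.isSeparated
  rw [Scheme.isSeparated_iff, ← terminal.comp_from f]
  infer_instance

end Projective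

/-! ### The family of R-points and the invariant affine charts around it. -/

section Points

variable {R : Type u} [CommRing R] {X : Scheme.{u}} {f : X ⟶ Spec (.of R)} {m : ℕ}
  {x : Fin m → (Spec (.of R) ⟶ X)}

/-- The inclusion of one of the points in their disjoint union. -/
abbrev pointInc (R : Type u) [CommRing R] {m : ℕ} (j : Fin m) :
    Spec (.of R) ⟶ pointsScheme R m :=
  Sigma.ι (fun _ : Fin m => Spec (.of R)) j

lemma pointInc_pointsι (j : Fin m) : pointInc R j ≫ pointsι x = x j := Sigma.ι_desc _ _

lemma pointsι_apply (j : Fin m) (p : Spec (.of R)) : pointsι x (pointInc R j p) = x j p := by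
  rw [← pointInc_pointsι (x := x) j]
  rfl

lemma isClosedImmersion_point [IsSeparated f] {y : Spec (.of R) ⟶ X} (hy : y ≫ f = 𝟙 _) :
    IsClosedImmersion y := by
  have : IsClosedImmersion (y ≫ f) := by
    rw [hy]
    infer_instance
  exact IsClosedImmersion.of_comp y f

lemma exists_pointInc_eq (z : pointsScheme R m) : ∃ j p, pointInc R j p = z :=
  (sigmaOpenCover _).exists_eq z

/-- Each point is a section of a separated morphism, hence a closed immersion. Disjointness gives
injectivity of the union, finiteness its closedness, and surjectivity on stalks is inherited from
the single points. -/
lemma isClosedImmersion_pointsι [IsSeparated f] (hx : ∀ j, x j ≫ f = 𝟙 _)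
    (hdisj : Pairwise fun j j' => Disjoint (Set.range (x j)) (Set.range (x j'))) :
    IsClosedImmersion (pointsι x) := by
  have hc := fun j => isClosedImmersion_point (hx j)
  refine { stalkMap_surjective := fun z => ?_, isClosedEmbedding := ?_ }
  · obtain ⟨j, p, rfl⟩ := exists_pointInc_eq z
    have h1 : Function.Surjective ((pointInc R j ≫ pointsι x).stalkMap p) := by
      rw [pointInc_pointsι]
      exact (x j).stalkMap_surjective p
    rw [Scheme.Hom.stalkMap_comp] at h1
    have h2 : Function.Bijective ((pointInc R j).stalkMap p) := ConcreteCategory.bijective_of_isIso _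
    exact fun b => by
      obtain ⟨c, hc⟩ := h1 ((pointInc R j).stalkMap p b)
      exact ⟨c, h2.1 hc⟩
  · refine .of_continuous_injective_isClosedMap (pointsι x).continuous ?_ ?_
    · intro z z' h
      obtain ⟨j, p, rfl⟩ := exists_pointInc_eq z
      obtain ⟨j', p', rfl⟩ := exists_pointInc_eq z'
      rw [pointsι_apply, pointsι_apply] at h
      obtain rfl : j = j' := by
        by_contra hne
        exact Set.disjoint_left.mp (hdisj hne) ⟨p, rfl⟩ ⟨p', h.symm⟩
      rw [(x j).isClosedEmbedding.injective h]
    · intro C hC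
      have : pointsι x '' C = ⋃ j, x j '' (pointInc R j ⁻¹' C) := by
        ext y
        simp only [Set.mem_image, Set.mem_iUnion, Set.mem_preimage]
        constructor
        · rintro ⟨z, hz, rfl⟩
          obtain ⟨j, p, rfl⟩ := exists_pointInc_eq z
          exact ⟨j, p, hz, (pointsι_apply j p).symm⟩
        · rintro ⟨j, p, hp, rfl⟩
          exact ⟨_, hp, pointsι_apply j p⟩
      rw [this]
      exact isClosed_iUnion_of_finite fun j =>
        (x j).isClosedEmbedding.isClosedMap _ (hC.preimage (pointInc R j).continuous)

lemma mem_basicOpen_baseHom {Y : Scheme.{u}} (q : Y ⟶ Spec (.of R)) (a : R) (y : Y) :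
    y ∈ Y.basicOpen (baseHom q a) ↔ q y ∈ PrimeSpectrum.basicOpen a := by
  have h1 : Y.basicOpen (baseHom q a) =
      q ⁻¹ᵁ (Spec (.of R)).basicOpen ((Scheme.ΓSpecIso (.of R)).inv a) :=
    (Scheme.preimage_basicOpen q _).symm
  rw [h1, Scheme.Hom.mem_preimage]
  have h2 : (Spec (.of R)).basicOpen ((Scheme.ΓSpecIso (.of R)).inv a) =
      PrimeSpectrum.basicOpen a := basicOpen_eq_of_affine (R := .of R) a
  rw [h2]
  rfl

lemma rpull_baseHom {Y : Scheme.{u}} (q : X ⟶ Y) (f : Y ⟶ Spec (.of R)) (a : R) :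
    rpull q (top_le_preimage q) (baseHom f a) = baseHom (q ≫ f) a := by
  refine (rres_rfl _ _).trans ?_
  simp only [baseHom, Scheme.Hom.comp_appTop]
  rfl

/-- Locally on `Spec R`, the family of points lies in a `G`-stable affine open subset `X_s` on which
`L` is trivial, where `s` is a `G`-invariant section of a positive power of `L`. -/
lemma exists_chart (hf : IsProjective f) {G : Type v} [Group G] [Finite G]
    (ρ : G →* Aut X) (hρ : ∀ g, (ρ g).hom ≫ f = f) (hx : ∀ j, x j ≫ f = 𝟙 _)
    (hdisj : Pairwise fun j j' => Disjoint (Set.range (x j)) (Set.range (x j')))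
    (σ : G → (pointsScheme R m ⟶ pointsScheme R m))
    (hσ : ∀ g, σ g ≫ pointsι x = pointsι x ≫ (ρ g).hom)
    {L : X.Modules} (hL : IsAmple L) (φ : EquivariantStructure ρ L) (p : Spec (.of R)) :
    ∃ (a : R) (r : ℕ) (s : Γ(tensorPow L r, (⊤ : X.Opens))), p ∈ PrimeSpectrum.basicOpen a ∧
      r ≠ 0 ∧ (∀ g, pullPow φ s g = s) ∧ IsAffineOpen (nonvanishingOpen s) ∧
      (∃ ℓ : Γ(L, nonvanishingOpen s), IsGenerator ℓ (nonvanishingOpen s) le_rfl) ∧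
      IsUnit (rres (le_top : nonvanishingOpen s ≤ ⊤) (baseHom f a)) ∧
      pointsι x ⁻¹ᵁ nonvanishingOpen s = (pointsScheme R m).basicOpen (baseHom (pointsι x ≫ f) a) := by
  have := hf.isSeparated
  have := isSeparated_of_isProjective hf
  have := hL.compactSpace
  have hLB := hL.isLineBundle
  have hc := fun j => isClosedImmersion_point (hx j)
  have hfx : ∀ j q, f (x j q) = q := fun j q => by
    rw [← Scheme.Hom.comp_apply, hx]
    rfl
  -- None of the points x_j(p) specializes to another one, because the images of the x_j are closed
  -- and disjoint.
  obtain ⟨d, v, hd, hva, hyv, ℓ, hℓ⟩ := hL.exists_section_of_points (fun j => x j p)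
    (fun j l hjl h => by
      have h1 : closure {x l p} ⊆ Set.range (x l) :=
        closure_minimal (Set.singleton_subset_iff.mpr ⟨p, rfl⟩)
          (x l).isClosedEmbedding.isClosed_range
      exact Set.disjoint_left.mp (hdisj hjl) ⟨p, rfl⟩ (h1 h))
  obtain ⟨N, w, hN, hwinv, hwa, hwv, hw⟩ := exists_invariant_section φ hLB hd v hva
  have hyw : ∀ j, x j p ∈ nonvanishingOpen w := by
    refine fun j => hw _ fun g => ?_
    obtain ⟨j', p', hp'⟩ := exists_pointInc_eq (σ g (pointInc R j p))
    have h1 : (ρ g).hom (x j p) = x j' p' := by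
      rw [← pointsι_apply, ← Scheme.Hom.comp_apply, ← hσ g, Scheme.Hom.comp_apply, ← hp',
        pointsι_apply]
    -- G acts over Spec R, so it maps points over `p` to points over `p`.
    have h2 : p' = p := by
      rw [← hfx j' p', ← h1, ← Scheme.Hom.comp_apply, hρ, hfx]
    rw [h1, h2]
    exact hyv j'
  -- Over a basic open set D(a) ⊆ O containing `p`, all of Z lies in X_w. Replacing `w` by a w then
  -- makes Z ∩ X_s exactly the part of Z over D(a).
  let O : (Spec (.of R)).Opens := ⟨⋂ j, x j ⁻¹' (nonvanishingOpen w),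
    isOpen_iInter_of_finite fun j => (nonvanishingOpen w).isOpen.preimage (x j).continuous⟩
  have hpO : p ∈ O := Set.mem_iInter.mpr hyw
  obtain ⟨_, ⟨a, rfl⟩, hpa, haO⟩ := TopologicalSpace.Opens.isBasis_iff_nbhd.mp
    PrimeSpectrum.isBasis_basic_opens hpO
  have hnv := nonvanishing_smul hLB w (baseHom f a)
  refine ⟨a, N, baseHom f a • w, hpa, hN, fun g => ?_, ?_, ?_, ?_, ?_⟩
  · have h1 : pullPow φ (baseHom f a • w) g =
        rpull (ρ g).hom (top_le_preimage _) (baseHom f a) • pullPow φ w g := pull_smul _ _ _ _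
    rw [h1, rpull_baseHom, hρ, hwinv]
  · have h1 : X.basicOpen (rres (le_top : nonvanishingOpen w ≤ ⊤) (baseHom f a)) =
        nonvanishingOpen w ⊓ X.basicOpen (baseHom f a) := X.basicOpen_res _ (homOfLE le_top).op
    rw [hnv, ← h1]
    exact hwa.basicOpen _
  · have hle : nonvanishingOpen (baseHom f a • w) ≤ nonvanishingOpen v := by
      rw [hnv]
      exact inf_le_left.trans hwv
    exact ⟨res hle ℓ, hℓ.res hle⟩
  · apply isUnit_of_basicOpen_eq
    have h1 : X.basicOpen (rres (le_top : nonvanishingOpen (baseHom f a • w) ≤ ⊤) (baseHom f a)) =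
        nonvanishingOpen (baseHom f a • w) ⊓ X.basicOpen (baseHom f a) :=
      X.basicOpen_res _ (homOfLE le_top).op
    rw [h1, inf_eq_left, hnv]
    exact inf_le_right
  · ext z
    have h1 : z ∈ pointsι x ⁻¹ᵁ nonvanishingOpen (baseHom f a • w) ↔
        pointsι x z ∈ nonvanishingOpen w ∧ pointsι x z ∈ X.basicOpen (baseHom f a) := by
      rw [hnv]
      rfl
    change z ∈ pointsι x ⁻¹ᵁ nonvanishingOpen (baseHom f a • w) ↔
      z ∈ (pointsScheme R m).basicOpen (baseHom (pointsι x ≫ f) a)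
    rw [h1, mem_basicOpen_baseHom, mem_basicOpen_baseHom, ← Scheme.Hom.comp_apply]
    refine ⟨fun h => h.2, fun h => ⟨?_, h⟩⟩
    obtain ⟨j, q, rfl⟩ := exists_pointInc_eq z
    have h2 : (pointsι x ≫ f) (pointInc R j q) = q := by
      rw [Scheme.Hom.comp_apply, pointsι_apply, hfx]
    rw [h2] at h
    rw [pointsι_apply]
    exact Set.mem_iInter.mp (haO h) j

end Points

/-! ### From the splitting of the completion to level sections on a chart. -/

section Level

variable {X Z : Scheme.{u}} {R : Type u} [CommRing R] {f : X ⟶ Spec (.of R)}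

/-- The function on `U` given by an element of the base ring. -/
def baseFun (f : X ⟶ Spec (.of R)) (U : X.Opens) : R →+* Γ(X, U) := (rres le_top).comp (baseHom f)

lemma rpull_baseFun {Y : Scheme.{u}} (q : Y ⟶ X) {U : X.Opens} {W : Y.Opens} (h : W ≤ q ⁻¹ᵁ U)
    (b : R) : rpull q h (baseFun f U b) = baseFun (q ≫ f) W b := by
  have h1 : rpull q h (baseFun f U b) = rpull q (h.trans (q.preimage_mono le_top)) (baseHom f b) :=
    rpull_rres h le_top _
  have h2 := rres_rpull (top_le_preimage q) (le_top : W ≤ ⊤) (baseHom f b)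
  rw [rpull_baseHom] at h2
  rw [h1, ← h2]
  rfl

lemma app_baseFun {Y : Scheme.{u}} (q : Y ⟶ X) (U : X.Opens) (b : R) :
    q.app U (baseFun f U b) = baseFun (q ≫ f) (q ⁻¹ᵁ U) b := by
  rw [← rpull_baseFun q le_rfl b]
  exact (rres_rfl _ _).symm

lemma res_smul_H0 {M : X.Modules} {U : X.Opens} (b : R) (h : H0 f M) :
    res (M := M) (le_top : U ≤ ⊤) (b • h : H0 f M) = baseFun f U b • res (M := M) le_top h :=
  res_smul _ _ _

lemma unitApp_baseFun_smul (i : Z ⟶ X) {N : X.Modules} {U : X.Opens} {m : Γ(N, U)}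
    {h : H0 (i ≫ f) ((Scheme.Modules.pullback i).obj N)}
    (e : unitApp i N U m = res (M := (Scheme.Modules.pullback i).obj N) le_top h) (b : R) :
    unitApp i N U (baseFun f U b • m) =
      res (M := (Scheme.Modules.pullback i).obj N) le_top
        (b • h : H0 (i ≫ f) ((Scheme.Modules.pullback i).obj N)) := by
  rw [unitApp_smul, e, app_baseFun]
  exact (res_smul_H0 (f := i ≫ f) b h).symm

lemma exists_extend_of_eq_basicOpen [IsAffine Z] {N : Z.Modules} [N.IsQuasicoherent]
    {c : Γ(Z, (⊤ : Z.Opens))} {V : Z.Opens} (hV : V = Z.basicOpen c) (n : Γ(N, V)) :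
    ∃ (e : ℕ) (h : Γ(N, (⊤ : Z.Opens))), res le_top h = rres (le_top : V ≤ ⊤) c ^ e • n := by
  subst hV
  exact exists_extend_pow_smul (isAffineOpen_top Z) N n

lemma exists_pow_smul_eq_zero_of_eq_basicOpen [IsAffine Z] {N : Z.Modules} [N.IsQuasicoherent]
    {c : Γ(Z, (⊤ : Z.Opens))} {V : Z.Opens} (hV : V = Z.basicOpen c) {h : Γ(N, (⊤ : Z.Opens))}
    (h0 : res (le_top : V ≤ ⊤) h = 0) : ∃ e : ℕ, c ^ e • h = 0 := by
  subst hV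
  exact exists_pow_smul_eq_zero (isAffineOpen_top Z) N h0

lemma ker_app_eq (i : Z ⟶ X) [QuasiCompact i] {U : X.Opens} (hU : IsAffineOpen U) :
    RingHom.ker (i.app U).hom = i.ker.ideal ⟨U, hU⟩ :=
  (i.ker_apply ⟨U, hU⟩).symm

lemma ker_infNbhdι_app (i : Z ⟶ X) [QuasiCompact i] {U : X.Opens} (hU : IsAffineOpen U) (n : ℕ) :
    RingHom.ker ((infNbhdι i n).app U).hom = RingHom.ker (i.app U).hom ^ (n + 1) := by
  rw [ker_app_eq (infNbhdι i n) hU, ker_app_eq i hU, Scheme.IdealSheafData.ker_subschemeι]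
  rfl

lemma mem_smul_top_of_isUnit {B M : Type*} [CommRing B] [AddCommGroup M] [Module B M] {J : Ideal B}
    {α : B} (hα : IsUnit α) {m : M} (h : α • m ∈ (J • ⊤ : Submodule B M)) :
    m ∈ (J • ⊤ : Submodule B M) := by
  obtain ⟨β, hβ⟩ := hα.exists_left_inv
  have := Submodule.smul_mem _ β h
  rwa [smul_smul, hβ, one_smul] at this

section Equivariant

variable {G : Type v} [Group G] {ρ : G →* Aut X} {N : X.Modules}

/-- The action of `g` on the sections over a `G`-stable open subset. -/
def actOn (φ : ∀ g, N ⟶ (Scheme.Modules.pushforward (ρ g).hom).obj N) {U : X.Opens}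
    (hU : ∀ g, U ≤ (ρ g).hom ⁻¹ᵁ U) (g : G) : Γ(N, U) →+ Γ(N, U) :=
  pull (φ g⁻¹) (hU g⁻¹)

variable (hρ : ∀ g, (ρ g).hom ≫ f = f) {φ : ∀ g, N ⟶ (Scheme.Modules.pushforward (ρ g).hom).obj N}

include hρ in
lemma actOn_baseFun_smul {U : X.Opens} (hU : ∀ g, U ≤ (ρ g).hom ⁻¹ᵁ U) (g : G) (b : R)
    (m : Γ(N, U)) : actOn φ hU g (baseFun f U b • m) = baseFun f U b • actOn φ hU g m := by
  refine (pull_smul _ _ _ _).trans ?_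
  rw [rpull_baseFun, hρ]
  rfl

include hρ in
lemma actOn_baseFun_pow_smul {U : X.Opens} (hU : ∀ g, U ≤ (ρ g).hom ⁻¹ᵁ U) (g : G) (b : R) (e : ℕ)
    (m : Γ(N, U)) : actOn φ hU g (baseFun f U b ^ e • m) = baseFun f U b ^ e • actOn φ hU g m := by
  rw [← map_pow]
  exact actOn_baseFun_smul hρ hU g _ m

/-- Used for Z and for each infinitesimal neighbourhood, this carries the equivariance of the given
splitting over to the chart. -/
lemma unitApp_actOn {A : Scheme.{u}} (j : A ⟶ X) {τ : G → (A ⟶ A)}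
    (hτ : ∀ g, τ g ≫ j = j ≫ (ρ g).hom) (hτf : ∀ g, τ g ≫ j ≫ f = j ≫ f) {U : X.Opens}
    (hU : ∀ g, U ≤ (ρ g).hom ⁻¹ᵁ U) (g : G)
    {m : Γ(N, U)} {h : H0 (j ≫ f) ((Scheme.Modules.pullback j).obj N)}
    (e : unitApp j N U m = res (M := (Scheme.Modules.pullback j).obj N) le_top h) :
    unitApp j N U (actOn φ hU g m) = res (M := (Scheme.Modules.pullback j).obj N) le_top
      (act hτf (fun g => pullbackOver (hτ g) (φ g)) g h) := by
  have hW : j ⁻¹ᵁ U ≤ τ g⁻¹ ⁻¹ᵁ j ⁻¹ᵁ U := by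
    rw [← Scheme.Hom.comp_preimage, hτ, Scheme.Hom.comp_preimage]
    exact j.preimage_mono (hU _)
  have h1 := pull_pullbackOver (hτ g⁻¹) (φ g⁻¹) (V := U) (V' := j ⁻¹ᵁ U) (W := U)
    (W' := j ⁻¹ᵁ U) le_rfl hW (hU _) le_rfl m
  have h2 : pull (unitOf j N) (le_rfl : j ⁻¹ᵁ U ≤ j ⁻¹ᵁ U) m = unitApp j N U m := pull_le_rfl _ _
  have h3 : pull (unitOf j N) (le_rfl : j ⁻¹ᵁ U ≤ j ⁻¹ᵁ U) (pull (φ g⁻¹) (hU g⁻¹) m) =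
    unitApp j N U (actOn φ hU g m) := pull_le_rfl _ _
  rw [← h3, ← h1, h2, e]
  exact pull_res (pullbackOver (hτ g⁻¹) (φ g⁻¹)) hW le_top h

variable {i : Z ⟶ X} {σ : G → (Z ⟶ Z)} (hσ : ∀ g, σ g ≫ i = i ≫ (ρ g).hom)

lemma unitApp_pullbackRestrict {A B : Scheme.{u}} {h : A ⟶ B} {a : A ⟶ X} {b : B ⟶ X}
    (w : h ≫ b = a) {U : X.Opens} {y : Γ(N, U)}
    {t : Γ((Scheme.Modules.pullback b).obj N, (⊤ : B.Opens))}
    (e : unitApp b N U y = res le_top t) :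
    unitApp a N U y = res (M := (Scheme.Modules.pullback a).obj N) le_top
      ((pullbackRestrict w N).app ⊤ t) := by
  have hW : a ⁻¹ᵁ U ≤ h ⁻¹ᵁ b ⁻¹ᵁ U := by
    rw [← Scheme.Hom.comp_preimage, w]
  have h1 : pull (pullbackRestrict w N) hW (pull (unitOf b N) (le_rfl : b ⁻¹ᵁ U ≤ b ⁻¹ᵁ U) y) =
      pull (unitOf a N) (le_rfl : a ⁻¹ᵁ U ≤ a ⁻¹ᵁ U)
        (pull ((Scheme.Modules.pushforwardId X).inv.app N) (le_rfl : U ≤ (𝟙 X) ⁻¹ᵁ U) y) :=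
    pull_pullbackOver (r := 𝟙 X) (w.trans (Category.comp_id a).symm)
    ((Scheme.Modules.pushforwardId X).inv.app N) (V := U) (V' := b ⁻¹ᵁ U) (W := U)
    (W' := a ⁻¹ᵁ U) le_rfl hW le_rfl le_rfl y
  have h2 : pull (unitOf b N) (le_rfl : b ⁻¹ᵁ U ≤ b ⁻¹ᵁ U) y = unitApp b N U y := pull_le_rfl _ _
  have h3 : pull ((Scheme.Modules.pushforwardId X).inv.app N) (le_rfl : U ≤ (𝟙 X) ⁻¹ᵁ U) y = y :=
    pull_le_rfl _ _
  have h4 : pull (unitOf a N) (le_rfl : a ⁻¹ᵁ U ≤ a ⁻¹ᵁ U) y = unitApp a N U y := pull_le_rfl _ _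
  rw [h3, h4, h2, e] at h1
  rw [← h1]
  exact pull_res (pullbackRestrict w N) hW le_top t

/-- Compatibility of the components of `s` leads from level n down to level 0, and from there to Z.
-/
lemma unitApp_eq_of_completed {s : completedSections f i N}
    {h : H0 (i ≫ f) ((Scheme.Modules.pullback i).obj N)} (hs : completedToFiber f i N s = h)
    {U : X.Opens} (n : ℕ) {y : Γ(N, U)}
    (hy : unitApp (infNbhdι i n) N U y =
      res (M := (Scheme.Modules.pullback (infNbhdι i n)).obj N) le_top (s.1 n)) :
    unitApp i N U y = res (M := (Scheme.Modules.pullback i).obj N) le_top h := by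
  induction n with
  | zero =>
    rw [← hs]
    exact unitApp_pullbackRestrict (toInfNbhd_ι i 0) hy
  | succ n ih =>
    refine ih ?_
    rw [← s.2 n]
    exact unitApp_pullbackRestrict (infNbhdIncl_ι i n) hy

/-- An equivariant splitting of the completion map induces, on a `G`-stable affine open subset `U`,
equivariant splittings of the reductions `N(U) / I ^ (n + 1) N(U) → N(U) / I N(U)`, which are
described here by their graphs. -/
lemma exists_level_relation [IsClosedImmersion i] [IsAffine Z] [N.IsQuasicoherent]
    (hsp : HasEquivariantSplitting hρ hσ φ) {U : X.Opens} (hUa : IsAffineOpen U)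
    (hU : ∀ g, U ≤ (ρ g).hom ⁻¹ᵁ U) {a : R} (ha : IsUnit (baseFun f U a))
    (hZ : i ⁻¹ᵁ U = Z.basicOpen (baseHom (i ≫ f) a)) {I : Ideal Γ(X, U)}
    (hI : I = RingHom.ker (i.app U).hom) (n : ℕ) :
    ∃ Q : AddSubgroup (Γ(N, U) × Γ(N, U)), (∀ x, ∃ y, (x, y) ∈ Q) ∧
      (∀ x y, (x, y) ∈ Q → x ∈ (I • ⊤ : Submodule Γ(X, U) Γ(N, U)) →
        y ∈ (I ^ (n + 1) • ⊤ : Submodule Γ(X, U) Γ(N, U))) ∧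
      (∀ y ∈ (I ^ (n + 1) • ⊤ : Submodule Γ(X, U) Γ(N, U)), ((0 : Γ(N, U)), y) ∈ Q) ∧
      (∀ x y, (x, y) ∈ Q → x - y ∈ (I • ⊤ : Submodule Γ(X, U) Γ(N, U))) ∧
      (∀ (b : R) x y, (x, y) ∈ Q → (baseFun f U b • x, baseFun f U b • y) ∈ Q) ∧
      ∀ (g : G) x y, (x, y) ∈ Q → (actOn φ hU g x, actOn φ hU g y) ∈ Q := by
  obtain ⟨s, hs, hsG⟩ := hsp
  have hsurj : Function.Surjective (i.app U) := i.app_surjective U hUa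
  have hsurjn : Function.Surjective ((infNbhdι i n).app U) := (infNbhdι i n).app_surjective U hUa
  have hVa : IsAffineOpen (i ⁻¹ᵁ U) := hUa.preimage i
  have hVan : IsAffineOpen (infNbhdι i n ⁻¹ᵁ U) := hUa.preimage _
  have hker := unit_eq_zero_iff i hUa hVa N hsurj
  have hkern := unit_eq_zero_iff (infNbhdι i n) hUa hVan N hsurjn
  rw [← hI] at hker
  rw [ker_infNbhdι_app i hUa, ← hI] at hkern
  set α := baseFun f U a with hα
  have hαp : ∀ e : ℕ, α ^ e = baseFun f U (a ^ e) := fun e => (map_pow _ _ _).symm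
  -- Up to powers of `a`, sections over i⁻¹U come from global sections on Z. The graph consists of
  -- the pairs (x, y) such that a^e x restricts on Z to a global section `h` and a^e y restricts to
  -- the lift `s h` at level `n`, for some `e` and `h`.
  let P : Γ(N, U) → Γ(N, U) → ℕ → H0 (i ≫ f) ((Scheme.Modules.pullback i).obj N) → Prop :=
    fun x y e h => unitApp i N U (α ^ e • x) =
        res (M := (Scheme.Modules.pullback i).obj N) le_top h ∧
      unitApp (infNbhdι i n) N U (α ^ e • y) =
        res (M := (Scheme.Modules.pullback (infNbhdι i n)).obj N) le_top ((s h).1 n)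
  have hsmul : ∀ {x y e h} (b : R), P x y e h → P (baseFun f U b • x) (baseFun f U b • y) e (b • h) := by
    intro x y e h b hP
    refine ⟨?_, ?_⟩
    · rw [smul_comm]
      exact unitApp_baseFun_smul i hP.1 b
    · rw [smul_comm, map_smul s]
      exact unitApp_baseFun_smul (infNbhdι i n) hP.2 b
  have hraise : ∀ {x y e h} (k : ℕ), P x y e h → P x y (k + e) (a ^ k • h) := by
    intro x y e h k hP
    have h1 := hsmul (a ^ k) hP
    simp only [P, ← hαp, smul_smul, ← pow_add, add_comm e k] at h1 ⊢
    exact h1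
  have hadd : ∀ {x y x' y' e h h'}, P x y e h → P x' y' e h' → P (x + x') (y + y') e (h + h') := by
    intro x y x' y' e h h' hP hP'
    refine ⟨?_, ?_⟩
    · rw [smul_add, map_add, hP.1, hP'.1]
      exact (map_add (res (M := (Scheme.Modules.pullback i).obj N) le_top) h h').symm
    · rw [smul_add, map_add, hP.2, hP'.2, map_add s]
      exact (map_add (res (M := (Scheme.Modules.pullback (infNbhdι i n)).obj N) le_top)
        ((s h).1 n) ((s h').1 n)).symm
  have hzero : ∀ y, unitApp (infNbhdι i n) N U y = 0 → P 0 y 0 0 := by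
    intro y hy
    refine ⟨?_, ?_⟩
    · rw [smul_zero, map_zero]
      exact (map_zero (res (M := (Scheme.Modules.pullback i).obj N) le_top)).symm
    · rw [pow_zero, one_smul, hy, map_zero]
      exact (map_zero (res (M := (Scheme.Modules.pullback (infNbhdι i n)).obj N) le_top)).symm
  refine ⟨{ carrier := {p | ∃ e h, P p.1 p.2 e h}
            add_mem' := ?_, zero_mem' := ⟨0, 0, hzero 0 (map_zero _)⟩, neg_mem' := ?_ },
    ?_, ?_, ?_, ?_, ?_, ?_⟩
  · rintro ⟨x, y⟩ ⟨x', y'⟩ ⟨e, h, hP⟩ ⟨e', h', hP'⟩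
    have h1 := hraise e' hP
    rw [add_comm] at h1
    exact ⟨_, _, hadd h1 (hraise e hP')⟩
  · rintro ⟨x, y⟩ ⟨e, h, hP⟩
    have h1 := hsmul (-1) hP
    simp only [map_neg, map_one, neg_smul, one_smul] at h1
    exact ⟨e, _, h1⟩
  · intro x
    obtain ⟨e, h, hh⟩ := exists_extend_of_eq_basicOpen hZ (unitApp i N U x)
    obtain ⟨y, hy⟩ := unit_surjective (infNbhdι i n) hUa hVan N hsurjn
      (res (M := (Scheme.Modules.pullback (infNbhdι i n)).obj N) le_top ((s h).1 n))
    obtain ⟨β, hβ⟩ := (ha.pow e).exists_right_inv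
    refine ⟨β • y, e, h, ?_, ?_⟩
    · rw [hh, unitApp_smul, map_pow, app_baseFun]
      rfl
    · rw [smul_smul, hβ, one_smul, hy]
  -- Here `h` vanishes on i⁻¹U, so a power of `a` kills it and, by linearity, its lift. As `a` is
  -- invertible on U, this gives y ∈ I^(n+1) N(U).
  · rintro x y ⟨e, h, hP⟩ hx
    have h0 : res (M := (Scheme.Modules.pullback i).obj N) (le_top : i ⁻¹ᵁ U ≤ ⊤) h = 0 := by
      rw [← hP.1]
      exact (hker _).mpr (Submodule.smul_mem _ _ hx)
    obtain ⟨k, hk⟩ := exists_pow_smul_eq_zero_of_eq_basicOpen hZ h0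
    have hk' : (a ^ k • h : H0 (i ≫ f) ((Scheme.Modules.pullback i).obj N)) = 0 := by
      have : (a ^ k • h : H0 (i ≫ f) ((Scheme.Modules.pullback i).obj N)) =
        (baseHom (i ≫ f) (a ^ k) • (show Γ((Scheme.Modules.pullback i).obj N, ⊤) from h) :
          Γ((Scheme.Modules.pullback i).obj N, ⊤)) := rfl
      rw [this, map_pow]
      exact hk
    have h1 := (hraise k hP).2
    rw [hk', map_zero] at h1
    exact mem_smul_top_of_isUnit (ha.pow (k + e)) ((hkern _).mp (h1.trans
      (map_zero (res (M := (Scheme.Modules.pullback (infNbhdι i n)).obj N) le_top))))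
  · intro y hy
    exact ⟨0, 0, hzero y ((hkern y).mpr hy)⟩
  · rintro x y ⟨e, h, hP⟩
    have h1 := unitApp_eq_of_completed (hs h) n hP.2
    refine mem_smul_top_of_isUnit (ha.pow e) ((hker _).mp ?_)
    rw [smul_sub, map_sub, hP.1, h1, sub_self]
  · rintro b x y ⟨e, h, hP⟩
    exact ⟨e, _, hsmul b hP⟩
  · rintro g x y ⟨e, h, hP⟩
    refine ⟨e, act (comp_base hρ hσ) (fun g => pullbackOver (hσ g) (φ g)) g h, ?_, ?_⟩
    · rw [← actOn_baseFun_pow_smul hρ]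
      exact unitApp_actOn i hσ (comp_base hρ hσ) hU g hP.1
    · rw [hsG, ← actOn_baseFun_pow_smul hρ]
      exact unitApp_actOn (infNbhdι i n) (fun g => infNbhdMap_ι (hσ g) n)
        (infNbhdMap_base hρ hσ n) hU g hP.2

end Equivariant

end Level

/-! ### Assembling the algebra over R_a. -/

section Algebra

variable {R B M N : Type*} {G : Type*} [CommRing R] [CommRing B] [Group G]
  [MulSemiringAction G B]
  [AddCommGroup M] [Module B M] [AddCommGroup N] [Module B N]

lemma mem_smul_top_iff_of_equiv (e : M ≃ₗ[B] N) (J : Ideal B) (x : M) :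
    e x ∈ (J • ⊤ : Submodule B N) ↔ x ∈ (J • ⊤ : Submodule B M) := by
  have h : (J • ⊤ : Submodule B N) = (J • ⊤ : Submodule B M).map (e : M →ₗ[B] N) := by
    rw [Submodule.map_smul'', Submodule.map_top, LinearEquiv.range]
  rw [h]
  exact ⟨fun ⟨y, hy, hxy⟩ => e.injective hxy ▸ hy, fun hx => ⟨x, hx, rfl⟩⟩

/-- The graph `Q` describes a splitting of `M / I ^ n M → M / I M` which is linear over the image of
`R` and commutes with the maps `γ g`. -/
def IsLevelRelation (β : R → B) (I : Ideal B) (γ : G → M → M) (n : ℕ)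
    (Q : AddSubgroup (M × M)) : Prop :=
  (∀ x, ∃ y, (x, y) ∈ Q) ∧
    (∀ x y, (x, y) ∈ Q → x ∈ (I • ⊤ : Submodule B M) → y ∈ (I ^ n • ⊤ : Submodule B M)) ∧
    (∀ y ∈ (I ^ n • ⊤ : Submodule B M), ((0 : M), y) ∈ Q) ∧
    (∀ x y, (x, y) ∈ Q → x - y ∈ (I • ⊤ : Submodule B M)) ∧
    (∀ (b : R) x y, (x, y) ∈ Q → (β b • x, β b • y) ∈ Q) ∧
    ∀ (g : G) x y, (x, y) ∈ Q → (γ g x, γ g y) ∈ Q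

omit [CommRing R] [Group G] [MulSemiringAction G B] in
lemma IsLevelRelation.of_equiv {β : R → B} {I : Ideal B} {γ : G → N → N} {n : ℕ}
    {Q : AddSubgroup (N × N)} (h : IsLevelRelation β I γ n Q) (e : M ≃ₗ[B] N) {δ : G → M → M}
    (hδ : ∀ g x, e (δ g x) = γ g (e x)) :
    IsLevelRelation β I δ n (Q.comap (AddMonoidHom.prodMap (e : M →+ N) (e : M →+ N))) := by
  obtain ⟨h1, h2, h3, h4, h5, h6⟩ := h
  have hm : ∀ x y, (x, y) ∈ Q.comap (AddMonoidHom.prodMap (e : M →+ N) (e : M →+ N)) ↔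
      (e x, e y) ∈ Q := fun x y => Iff.rfl
  refine ⟨fun x => ?_, fun x y hxy hx => ?_, fun y hy => ?_, fun x y hxy => ?_,
    fun b x y hxy => ?_, fun g x y hxy => ?_⟩
  · obtain ⟨y, hy⟩ := h1 (e x)
    refine ⟨e.symm y, ?_⟩
    rw [hm, e.apply_symm_apply]
    exact hy
  · exact (mem_smul_top_iff_of_equiv e _ _).mp
      (h2 _ _ ((hm _ _).mp hxy) ((mem_smul_top_iff_of_equiv e _ _).mpr hx))
  · rw [hm, map_zero]
    exact h3 _ ((mem_smul_top_iff_of_equiv e _ _).mpr hy)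
  · rw [← mem_smul_top_iff_of_equiv e, map_sub]
    exact h4 _ _ ((hm _ _).mp hxy)
  · rw [hm, map_smul, map_smul]
    exact h5 _ _ _ ((hm _ _).mp hxy)
  · rw [hm, hδ, hδ]
    exact h6 _ _ _ ((hm _ _).mp hxy)

variable [Algebra R B]

/-- The relation is single-valued modulo I^n M and thus the graph of an R-linear map; between
modules over the localization such a map is automatically linear over the localization. -/
lemma IsLevelRelation.hasLevelSection {R' : Type*} [CommRing R'] [Algebra R R'] (W : Submonoid R)
    [IsLocalization W R'] [Algebra R' B] [IsScalarTower R R' B] [Module R' M]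
    [IsScalarTower R' B M] {I : Ideal B}
    {γ : ∀ g : G, M →ₛₗ[MulSemiringAction.toRingHom G B g] M} {n : ℕ}
    {Q : AddSubgroup (M × M)} (h : IsLevelRelation (algebraMap R B) I (fun g => γ g) n Q) :
    HasLevelSection R' I γ n := by
  obtain ⟨h1, h2, h3, h4, h5, h6⟩ := h
  let _ : Module R M := Module.compHom M (algebraMap R B)
  have : IsScalarTower R B M := ⟨fun r b m => by
    rw [Algebra.smul_def, mul_smul]
    rfl⟩
  have : IsScalarTower R R' M := ⟨fun r r' m => by
    rw [← algebraMap_smul B r (r' • m), ← algebraMap_smul B r' m, smul_smul,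
      ← algebraMap_smul B (r • r') m, Algebra.smul_def r r', map_mul,
      ← IsScalarTower.algebraMap_apply]⟩
  choose y hy using h1
  have uniq : ∀ x z z', (x, z) ∈ Q → (x, z') ∈ Q →
      (Submodule.Quotient.mk z : M ⧸ (I ^ n • ⊤ : Submodule B M)) = Submodule.Quotient.mk z' := by
    intro x z z' hz hz'
    refine (Submodule.Quotient.eq _).mpr (h2 0 _ ?_ (Submodule.zero_mem _))
    have := Q.sub_mem hz hz'
    rwa [Prod.mk_sub_mk, sub_self] at this
  have hmem : ∀ x z, (Submodule.Quotient.mk (y x) : M ⧸ (I ^ n • ⊤ : Submodule B M)) =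
      Submodule.Quotient.mk z → (x, z) ∈ Q := by
    intro x z hz
    have := Q.sub_mem (hy x) (h3 _ ((Submodule.Quotient.eq _).mp hz))
    rwa [Prod.mk_sub_mk, sub_zero, sub_sub_cancel] at this
  let s : M →ₗ[R] M ⧸ (I ^ n • ⊤ : Submodule B M) :=
    { toFun := fun x => Submodule.Quotient.mk (y x)
      map_add' := fun x x' => uniq _ _ _ (hy (x + x')) (Q.add_mem (hy x) (hy x'))
      map_smul' := fun b x => by
        refine uniq _ _ (algebraMap R B b • y x) (hy (b • x)) ?_ |>.trans rfl
        exact h5 b _ _ (hy x) }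
  refine ⟨s.extendScalarsOfIsLocalization W R', fun x hx => ?_, fun x z hz => ?_, fun g x z hz => ?_⟩
  · exact (Submodule.Quotient.mk_eq_zero _).mpr (h2 _ _ (hy x) hx)
  · exact h4 _ _ (hmem x z hz)
  · exact uniq _ _ _ (hy _) (h6 g _ _ (hmem x z hz))

/-- Equivariant splittings of all the reductions `M / I ^ n M → M / I M` and
`N / I ^ n N → N / I N`, where `N` is free of rank one, yield equivariant sections for the twists
of `M`. -/
theorem exists_twisted_section {R B M N C A : Type u} {G : Type v} [CommRing R]
    [IsNoetherianRing R] [CommRing B] [Group G] [Finite G] [MulSemiringAction G B]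
    [AddCommGroup M] [Module B M] [AddCommGroup N] [Module B N] [Algebra R B]
    [Algebra.FiniteType R B] [SMulCommClass G R B] {a : R} (ha : IsUnit (algebraMap R B a))
    [CommRing C] [CommRing A] [Algebra R C] [Algebra C A] [Algebra R A] [IsScalarTower R C A]
    [Algebra.FormallyEtale R C] [Module.Finite R C] [IsLocalization.Away (algebraMap R C a) A]
    (π : B →ₐ[R] A) (hπ : Function.Surjective π) {I : Ideal B} (hI : I = RingHom.ker π)
    (hIG : ∀ (g : G), ∀ b ∈ I, g • b ∈ I) [Module.Finite B M]
    (γ : ∀ g : G, M →ₛₗ[MulSemiringAction.toRingHom G B g] M)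
    (δ : ∀ g : G, N →ₛₗ[MulSemiringAction.toRingHom G B g] N) (e : B ≃ₗ[B] N) (c : G → B)
    (hc : ∀ g, δ g (e 1) = c g • e 1)
    (hγ : ∀ n, ∃ Q, IsLevelRelation (algebraMap R B) I (fun g => γ g) (n + 1) Q)
    (hδ : ∀ n, ∃ Q, IsLevelRelation (algebraMap R B) I (fun g => δ g) (n + 1) Q) (k : ℕ) :
    ∃ S : M →+ M, (∀ x ∈ (I • ⊤ : Submodule B M), S x = 0) ∧
      (∀ x, S x - x ∈ (I • ⊤ : Submodule B M)) ∧
      (∀ (b : R) x, S (algebraMap R B b • x) = algebraMap R B b • S x) ∧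
      (∀ g x, S (c g ^ k • γ g x) = c g ^ k • γ g (S x)) ∧
      ∃ (t : ℕ) (v : Fin t → M), ∀ x, ∃ (q : ℕ) (d : Fin t → R),
        algebraMap R B a ^ q • S x = ∑ i, algebraMap R B (d i) • v i := by
  classical
  -- As `a` is invertible in B, everything is linear over R_a, over which B/I ≅ A is finite as well
  -- as étale.
  let R' := Localization.Away a
  let _ : Algebra R' B := (IsLocalization.Away.lift a ha).toAlgebra
  have : IsScalarTower R R' B :=
    IsScalarTower.of_algebraMap_eq fun r => (IsLocalization.Away.lift_eq a ha r).symm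
  let _ : Module R' M := Module.compHom M (algebraMap R' B)
  have : IsScalarTower R' B M := ⟨fun r b m => by
    rw [Algebra.smul_def, mul_smul]
    rfl⟩
  have : IsNoetherianRing R' := IsLocalization.isNoetherianRing (.powers a) R' inferInstance
  have : Algebra.FiniteType R' B := Algebra.FiniteType.of_restrictScalars_finiteType R R' B
  let _ : Algebra R' A := ((π : B →+* A).comp (algebraMap R' B)).toAlgebra
  have : IsScalarTower R R' A := IsScalarTower.of_algebraMap_eq fun r => by
    change _ = π (algebraMap R' B (algebraMap R R' r))
    rw [← IsScalarTower.algebraMap_apply R R' B]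
    exact (π.commutes r).symm
  let π' : B →ₐ[R'] A := { (π : B →+* A) with commutes' := fun r => rfl }
  have hFE : Algebra.FormallyEtale R' A := by
    have : Algebra.FormallyEtale C A := Algebra.FormallyEtale.of_isLocalization
      (Submonoid.powers (algebraMap R C a))
    have : Algebra.FormallyEtale R A := Algebra.FormallyEtale.comp R C A
    exact Algebra.FormallyEtale.localization_base (Submonoid.powers a)
  have hFin : Module.Finite R' A := by
    have : IsLocalization (Algebra.algebraMapSubmonoid C (Submonoid.powers a)) A := by
      rw [Algebra.algebraMapSubmonoid_powers]
      infer_instance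
    exact Module.Finite.of_isLocalization R C (Submonoid.powers a)
  have hI' : I = RingHom.ker π' := hI
  let ε : (B ⧸ I) ≃ₐ[R'] A :=
    (Ideal.quotientEquivAlgOfEq R' hI').trans (Ideal.quotientKerAlgEquivOfSurjective hπ)
  have : Algebra.FormallyEtale R' (B ⧸ I) := Algebra.FormallyEtale.of_equiv ε.symm
  have hFinI : Module.Finite R' (B ⧸ I) := Module.Finite.equiv ε.symm.toLinearEquiv
  have : SMulCommClass G R' B := by
    have key : ∀ (g : G) (r : R'), g • (algebraMap R' B r) = algebraMap R' B r := by
      intro g r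
      have h1 : (MulSemiringAction.toRingHom G B g).comp (algebraMap R' B) = algebraMap R' B := by
        refine IsLocalization.ringHom_ext (Submonoid.powers a) (RingHom.ext fun r => ?_)
        change g • (algebraMap R' B (algebraMap R R' r)) = algebraMap R' B (algebraMap R R' r)
        rw [← IsScalarTower.algebraMap_apply R R' B, smul_algebraMap]
      exact congr($h1 r)
    exact ⟨fun g r b => by rw [Algebra.smul_def, Algebra.smul_def, smul_mul', key]⟩
  have hlev : ∀ n, 0 < n → HasLevelSection R' I (fun g => c g ^ k • γ g) n := by
    rintro (_ | n) hn
    · exact absurd hn (lt_irrefl 0)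
    obtain ⟨Q, hQ⟩ := hγ n
    obtain ⟨Q', hQ'⟩ := hδ n
    -- The generator `e 1` turns the action on N into the action on B multiplied by `c g`, as
    -- required for twisting.
    refine HasLevelSection.twist hIG hn ?_ (hQ.hasLevelSection (R' := R') (.powers a)) k
    refine (hQ'.of_equiv e (δ := fun g => ⇑(c g • (MulSemiringAction.toRingHom G B g).toSemilinearMap))
      fun g x => ?_).hasLevelSection (R' := R') (.powers a)
    have he : ∀ y : B, e y = y • e 1 := fun y => by rw [← e.map_smul, smul_eq_mul, mul_one]
    refine (he (c g * (MulSemiringAction.toRingHom G B g x))).trans ?_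
    rw [he x, (δ g).map_smulₛₗ, hc, mul_comm, mul_smul]
  have hfinM : Module.Finite R' (M ⧸ (I • ⊤ : Submodule B M)) := by
    have : IsScalarTower R' (B ⧸ I) (M ⧸ (I • ⊤ : Submodule B M)) := ⟨fun r b m => by
      obtain ⟨b, rfl⟩ := Ideal.Quotient.mk_surjective b
      obtain ⟨m, rfl⟩ := Submodule.Quotient.mk_surjective _ m
      change Submodule.Quotient.mk ((r • b) • m) = Submodule.Quotient.mk (r • b • m)
      rw [smul_assoc]⟩
    exact Module.Finite.trans (B ⧸ I) _
  obtain ⟨S, hS1, hS2, hS3, T, ⟨v, hv⟩, hT⟩ :=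
    exists_section_of_levelSections hIG (fun g => c g ^ k • γ g) hfinM hlev
  have hRM : ∀ (b : R) (x : M), algebraMap R R' b • x = algebraMap R B b • x := fun b x => by
    rw [IsScalarTower.algebraMap_apply R R' B]
    rfl
  refine ⟨S.toAddMonoidHom, hS1, hS2, fun b x => ?_, hS3, v.card,
    fun i => (v.equivFin.symm i : M), fun x => ?_⟩
  · rw [← hRM, ← hRM]
    exact S.map_smul _ x
  · have hx := hT x
    rw [← hv] at hx
    change ∃ (q : ℕ) (d : Fin v.card → R), algebraMap R B a ^ q • S x = _
    -- Values of `S` are R_a-combinations of the finite set `v`; a power of `a` clears the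
    -- denominators.
    obtain ⟨w, hw⟩ := (Submodule.mem_span_finset.mp hx)
    obtain ⟨⟨_, q, rfl⟩, hq⟩ := IsLocalization.exist_integer_multiples_of_finset
      (Submonoid.powers a) (v.image w)
    have hq' : ∀ z ∈ v, ∃ d : R, algebraMap R R' d = a ^ q • w z := fun z hz =>
      hq _ (Finset.mem_image_of_mem w hz)
    choose! d hd using hq'
    refine ⟨q, fun i => d (v.equivFin.symm i), ?_⟩
    rw [← hw.2, ← map_pow, ← hRM, Finset.smul_sum]
    have h1 : ∀ z ∈ v, algebraMap R R' (a ^ q) • w z • z = algebraMap R B (d z) • z := by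
      intro z hz
      rw [← hRM, hd z hz, smul_smul, Algebra.smul_def]
    rw [Finset.sum_congr rfl h1, ← Finset.sum_coe_sort]
    exact (Fintype.sum_equiv v.equivFin.symm _ _ fun i => rfl).symm

end Algebra

/-! ### The functions on Z: a finite étale R-algebra. -/

section PointsAlgebra

variable {R : Type u} [CommRing R] {m : ℕ}

/-- The comparison of the disjoint union of points with the spectrum of a product. -/
def pointsToSpec (R : Type u) [CommRing R] (m : ℕ) :
    pointsScheme R m ⟶ Spec (.of (ULift.{u} (Fin m) → R)) :=
  Sigma.desc fun j => Spec.map (CommRingCat.ofHom (Pi.evalRingHom (fun _ => R) (ULift.up j)))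

instance : IsIso (pointsToSpec R m) := by
  have : pointsToSpec R m =
      (Sigma.reindex Equiv.ulift.{u} (fun _ : Fin m => Spec (.of R))).inv ≫
        sigmaSpec (fun _ : ULift.{u} (Fin m) => CommRingCat.of R) := by
    rw [Iso.eq_inv_comp]
    refine Sigma.hom_ext _ _ fun j => ?_
    rw [Sigma.ι_reindex_hom_assoc]
    exact (Sigma.ι_desc _ _).trans
      (ι_sigmaSpec (fun _ : ULift.{u} (Fin m) => CommRingCat.of R) j).symm
  rw [this]
  infer_instance

/-- Z is the spectrum of R^m, and `q` corresponds to the diagonal map R → R^m because each point is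
a section of `q`. -/
lemma points_algebra (q : pointsScheme R m ⟶ Spec (.of R)) (hq : ∀ j, pointInc R j ≫ q = 𝟙 _) :
    letI := (baseHom q).toAlgebra
    Algebra.FormallyEtale R Γ(pointsScheme R m, ⊤) ∧ Module.Finite R Γ(pointsScheme R m, ⊤) := by
  let := (baseHom q).toAlgebra
  let P := ULift.{u} (Fin m) → R
  have h1 : q = pointsToSpec R m ≫ Spec.map (CommRingCat.ofHom (algebraMap R P)) := by
    refine Sigma.hom_ext _ _ fun j => (hq j).trans ?_
    rw [pointsToSpec, Sigma.ι_desc_assoc, ← Spec.map_comp, ← CommRingCat.ofHom_comp]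
    exact (Spec.map_id _).symm
  have : IsIso (pointsToSpec R m).appTop :=
    inferInstanceAs (IsIso ((pointsToSpec R m).app ⊤))
  let θ : CommRingCat.of P ≅ Γ(pointsScheme R m, ⊤) :=
    (Scheme.ΓSpecIso (.of P)).symm ≪≫ asIso (pointsToSpec R m).appTop
  have h2 : ∀ r : R, θ.hom (algebraMap R P r) = baseHom q r := by
    intro r
    have h3 : (Scheme.ΓSpecIso (.of R)).inv ≫ q.appTop =
        CommRingCat.ofHom (algebraMap R P) ≫ θ.hom := by
      rw [h1, Scheme.Hom.comp_appTop, ← Scheme.ΓSpecIso_inv_naturality_assoc]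
      rfl
    exact congr($h3.symm r)
  let ε : P ≃ₐ[R] Γ(pointsScheme R m, ⊤) :=
    AlgEquiv.ofRingEquiv (f := θ.commRingCatIsoToRingEquiv) h2
  exact ⟨Algebra.FormallyEtale.of_equiv ε, Module.Finite.equiv ε.toLinearEquiv⟩

end PointsAlgebra

/-! ### Line bundles: quasi-coherence and powers of sections. -/

section LineBundle

variable {X : Scheme.{u}} {L : X.Modules}

/-- L is isomorphic to L ⊗ O_X, and `isQuasicoherent_tensor` applies to the latter. -/
lemma IsLineBundle.isQuasicoherent (hL : IsLineBundle L) : L.IsQuasicoherent := by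
  let φ : L ⟶ tensor L (unitSheaf X) := homMk (fun U =>
      { toFun := fun n => tmul (N := unitSheaf X) n (1 : Γ(X, U))
        map_add' := fun n n' => add_tmul _ _ _
        map_smul' := fun r n => smul_tmul _ _ _ })
      (fun {U W} hW s => by
        have e := res_tmul (N := unitSheaf X) hW s (1 : Γ(X, U))
        have e' : res (M := unitSheaf X) hW (1 : Γ(X, U)) = (1 : Γ(X, W)) := map_one (rres hW)
        rw [e'] at e
        exact e.symm)
  have hφ : ∀ (U : X.Opens) (s : Γ(L, U)), φ.app U s = tmul (N := unitSheaf X) s (1 : Γ(X, U)) :=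
    fun U s => rfl
  have : IsIso φ := by
    rw [Scheme.Modules.Hom.isIso_iff_isIso_app]
    intro U
    rw [ConcreteCategory.isIso_iff_bijective]
    refine bijective_of_locally (fun V _ s => φ.app V s) (fun V W _ hW s => (app_res φ hW s).symm)
      fun x hx => ?_
    obtain ⟨V, ℓ, hxV, hℓ⟩ := hL x
    refine ⟨V, hxV, fun W _ hW => ?_⟩
    have h1 := (hℓ.res hW).bijective le_rfl
    have h2 := hℓ.tmul_bijective (N := unitSheaf X) hW
    refine (Function.Bijective.of_comp_iff _ h1).mp ?_
    have key : ∀ h : Γ(X, W), φ.app W (h • res le_rfl (res hW ℓ)) =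
        tmul (N := unitSheaf X) (res hW ℓ) h := by
      intro h
      have h3 : tmul (N := unitSheaf X) (res hW ℓ)
          (h • (show Γ(unitSheaf X, W) from (1 : Γ(X, W)))) =
        h • tmul (N := unitSheaf X) (res hW ℓ) (1 : Γ(X, W)) := tmul_smul _ _ _
      have h4 : h • (show Γ(unitSheaf X, W) from (1 : Γ(X, W))) = (h * 1 : Γ(X, W)) := rfl
      rw [h4, mul_one] at h3
      refine Eq.trans ?_ h3.symm
      rw [hφ, res_rfl]
      exact smul_tmul _ _ _
    have e : (fun s => φ.app W s) ∘ (fun h : Γ(X, W) => h • res le_rfl (res hW ℓ)) =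
      fun h : Γ(X, W) => tmul (N := unitSheaf X) (res hW ℓ) h := funext key
    rw [e]
    exact h2
  have := isQuasicoherent_tensor (F := unitSheaf X) hL
  exact (SheafOfModules.isQuasicoherent X.ringCatSheaf).prop_of_iso (asIso φ).symm this

lemma powSec_smul {V : X.Opens} (c : Γ(X, V)) (ℓ : Γ(L, V)) (k : ℕ) :
    powSec (c • ℓ) k = c ^ k • powSec ℓ k := by
  induction k with
  | zero =>
    rw [pow_zero, one_smul]
    rfl
  | succ k ih =>
    have h1 : powSec (c • ℓ) (k + 1) = tmul (c • ℓ) (powSec (c • ℓ) k) := rfl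
    rw [h1, ih, smul_tmul, tmul_smul, smul_smul, pow_succ']
    rfl

end LineBundle

/-! ### The equivariant section on a chart for L^k ⊗ F. -/

section ChartSection

variable {R : Type u} [CommRing R] {X : Scheme.{u}} {f : X ⟶ Spec (.of R)}
  {G : Type v} [Group G] {ρ : G →* Aut X}

/-- The action of the group on the functions on a stable open subset. -/
abbrev functionsAction {U : X.Opens} (hU : ∀ g, U ≤ (ρ g).hom ⁻¹ᵁ U) :
    MulSemiringAction G Γ(X, U) where
  smul g b := rpull (ρ g⁻¹).hom (hU g⁻¹) b
  one_smul b := by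
    have key : ∀ (k : G) (_ : k = 1), rpull (ρ k).hom (hU k) b = b := by
      rintro k rfl
      exact (rpull_one le_rfl b).trans (rres_rfl _ _)
    exact key 1⁻¹ inv_one
  mul_smul g h b := by
    have key : ∀ (k : G) (_ : k = h⁻¹ * g⁻¹), rpull (ρ k).hom (hU k) b =
        rpull (ρ g⁻¹).hom (hU g⁻¹) (rpull (ρ h⁻¹).hom (hU h⁻¹) b) := by
      rintro k rfl
      exact (rpull_mul (hU h⁻¹) (hU g⁻¹) b).symm
    exact key (g * h)⁻¹ (mul_inv_rev g h)
  smul_zero g := map_zero _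
  smul_add g := map_add _
  smul_one g := map_one _
  smul_mul g := map_mul _

/-- The action on sections as a family of semilinear maps. -/
def semilinearActOn {N : X.Modules} (φ : ∀ g, N ⟶ (Scheme.Modules.pushforward (ρ g).hom).obj N)
    {U : X.Opens} (hU : ∀ g, U ≤ (ρ g).hom ⁻¹ᵁ U) (g : G) :
    letI := functionsAction hU
    Γ(N, U) →ₛₗ[MulSemiringAction.toRingHom G Γ(X, U) g] Γ(N, U) :=
  letI := functionsAction hU
  { toFun := actOn φ hU g
    map_add' := map_add _
    map_smul' := fun c n => pull_smul _ _ c n }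

/-- Multiplication by a generator. -/
def IsGenerator.linearEquiv {N : X.Modules} {U : X.Opens} {ℓ : Γ(N, U)}
    (h : IsGenerator ℓ U le_rfl) : Γ(X, U) ≃ₗ[Γ(X, U)] Γ(N, U) :=
  LinearEquiv.ofBijective (LinearMap.toSpanSingleton Γ(X, U) Γ(N, U) ℓ) (by
    have := h.bijective le_rfl
    rw [res_rfl] at this
    exact this)

lemma finiteType_baseFun [LocallyOfFiniteType f] {U : X.Opens} (hU : IsAffineOpen U) :
    (baseFun f U).FiniteType := by
  have h1 := f.finiteType_appLE (isAffineOpen_top (Spec (.of R))) hU (fun _ _ => trivial)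
  have h2 : baseFun f U = (f.appLE ⊤ U (fun _ _ => trivial)).hom.comp
    (Scheme.ΓSpecIso (.of R)).inv.hom := rfl
  rw [h2]
  exact h1.comp (RingHom.FiniteType.of_surjective _
    (ConcreteCategory.bijective_of_isIso (Scheme.ΓSpecIso (.of R)).inv).2)

variable {m : ℕ} {x : Fin m → (Spec (.of R) ⟶ X)}
  {σ : G → (pointsScheme R m ⟶ pointsScheme R m)}

/-- On a stable affine chart, the sections over `Z` of the twists of `F` lift equivariantly. -/
theorem exists_section_of_chart [IsNoetherianRing R] [Finite G] [LocallyOfFiniteType f]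
    [IsClosedImmersion (pointsι x)] (hx : ∀ j, x j ≫ f = 𝟙 _)
    (hρ : ∀ g, (ρ g).hom ≫ f = f) (hσ : ∀ g, σ g ≫ pointsι x = pointsι x ≫ (ρ g).hom)
    {L F : X.Modules} (hL : IsLineBundle L) [F.IsQuasicoherent] [F.IsFiniteType]
    {φL : ∀ g, L ⟶ (Scheme.Modules.pushforward (ρ g).hom).obj L}
    {φF : ∀ g, F ⟶ (Scheme.Modules.pushforward (ρ g).hom).obj F}
    (hsL : HasEquivariantSplitting hρ hσ φL) (hsF : HasEquivariantSplitting hρ hσ φF)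
    {U : X.Opens} (hUa : IsAffineOpen U) (hU : ∀ g, U ≤ (ρ g).hom ⁻¹ᵁ U) {ℓ : Γ(L, U)}
    (hℓ : IsGenerator ℓ U le_rfl) {a : R} (ha : IsUnit (baseFun f U a))
    (hZ : pointsι x ⁻¹ᵁ U = (pointsScheme R m).basicOpen (baseHom (pointsι x ≫ f) a)) (k : ℕ) :
    ∃ S : Γ(tensor (tensorPow L k) F, U) →+ Γ(tensor (tensorPow L k) F, U),
      (∀ n, unitApp (pointsι x) _ U n = 0 → S n = 0) ∧
      (∀ n, unitApp (pointsι x) _ U (S n) = unitApp (pointsι x) _ U n) ∧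
      (∀ (b : R) n, S (baseFun f U b • n) = baseFun f U b • S n) ∧
      (∀ g n, S (actOn (fun g => tensorOver (ρ g).hom (tensorPowOver (ρ g).hom (φL g) k) (φF g))
        hU g n) = actOn (fun g => tensorOver (ρ g).hom (tensorPowOver (ρ g).hom (φL g) k) (φF g))
          hU g (S n)) ∧
      ∃ (t : ℕ) (v : Fin t → Γ(tensor (tensorPow L k) F, U)), ∀ n, ∃ (q : ℕ) (d : Fin t → R),
        baseFun f U a ^ q • S n = ∑ j, baseFun f U (d j) • v j := by
  set i := pointsι x with hi
  set q := i ≫ f with hq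
  let Z := pointsScheme R m
  let _ : MulSemiringAction G Γ(X, U) := functionsAction hU
  let _ : Algebra R Γ(X, U) := (baseFun f U).toAlgebra
  let _ : Algebra R Γ(Z, ⊤) := (baseHom q).toAlgebra
  let _ : Algebra R Γ(Z, i ⁻¹ᵁ U) := (baseFun q (i ⁻¹ᵁ U)).toAlgebra
  let _ : Algebra Γ(Z, ⊤) Γ(Z, i ⁻¹ᵁ U) := (Z.presheaf.map (homOfLE le_top).op).hom.toAlgebra
  have : IsScalarTower R Γ(Z, ⊤) Γ(Z, i ⁻¹ᵁ U) := IsScalarTower.of_algebraMap_eq fun r => rfl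
  have hft : Algebra.FiniteType R Γ(X, U) := finiteType_baseFun hUa
  obtain ⟨hFE, hFin⟩ := points_algebra q fun j => by
    rw [hq, hi, ← Category.assoc, pointInc_pointsι, hx]
  have hLoc : IsLocalization.Away (algebraMap R Γ(Z, ⊤) a) Γ(Z, i ⁻¹ᵁ U) :=
    (isAffineOpen_top Z).isLocalization_of_eq_basicOpen (baseHom q a) (homOfLE le_top) hZ
  have hcomm : SMulCommClass G R Γ(X, U) := ⟨fun g r b => by
    have h1 : g • (baseFun f U r * b) = g • baseFun f U r * g • b := smul_mul' g _ _
    have h2 : g • baseFun f U r = baseFun f U r := by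
      have := rpull_baseFun (f := f) (ρ g⁻¹).hom (hU g⁻¹) r
      rw [hρ] at this
      exact this
    rw [h2] at h1
    exact h1⟩
  let π : Γ(X, U) →ₐ[R] Γ(Z, i ⁻¹ᵁ U) :=
    { (i.app U).hom with commutes' := fun r => app_baseFun i U r }
  have hπ : Function.Surjective π := i.app_surjective U hUa
  have hker : RingHom.ker (i.app U).hom = RingHom.ker π := rfl
  have hVa : IsAffineOpen (i ⁻¹ᵁ U) := hUa.preimage i
  have hIG : ∀ (g : G), ∀ b ∈ RingHom.ker (i.app U).hom, g • b ∈ RingHom.ker (i.app U).hom := by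
    intro g b hb
    have hW : i ⁻¹ᵁ U ≤ σ g⁻¹ ⁻¹ᵁ i ⁻¹ᵁ U := by
      rw [← Scheme.Hom.comp_preimage, hσ, Scheme.Hom.comp_preimage]
      exact i.preimage_mono (hU _)
    have h1 : rpull i (le_rfl : i ⁻¹ᵁ U ≤ i ⁻¹ᵁ U) (rpull (ρ g⁻¹).hom (hU g⁻¹) b) =
        rpull (σ g⁻¹) hW (rpull i le_rfl b) := by
      rw [rpull_comp, rpull_comp]
      exact rpull_congr (hσ g⁻¹).symm _ _
    have h2 : rpull i (le_rfl : i ⁻¹ᵁ U ≤ i ⁻¹ᵁ U) b = 0 := (rres_rfl _ _).trans hb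
    rw [h2, map_zero] at h1
    exact (rres_rfl le_rfl _).symm.trans h1
  have hZaff : IsAffine Z := inferInstance
  have hLq := hL.isQuasicoherent
  have hFfin : Module.Finite Γ(X, U) Γ(F, U) := finite_sections F hUa
  have hc : ∀ g, ∃ c : Γ(X, U), actOn φL hU g ℓ = c • ℓ := fun g => by
    obtain ⟨c, hc⟩ := (hℓ.bijective le_rfl).2 (actOn φL hU g ℓ)
    rw [res_rfl] at hc
    exact ⟨c, hc.symm⟩
  choose c hc using hc
  have he1 : hℓ.linearEquiv 1 = ℓ := one_smul Γ(X, U) ℓ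
  obtain ⟨S, hS1, hS2, hS3, hS4, t, v, hv⟩ := exists_twisted_section
    (C := Γ(Z, ⊤)) ha π hπ hker hIG
    (semilinearActOn φF hU) (semilinearActOn φL hU) hℓ.linearEquiv c
    (fun g => by
      rw [he1]
      exact hc g)
    (fun n => exists_level_relation hρ hσ hsF hUa hU ha hZ rfl n)
    (fun n => exists_level_relation hρ hσ hsL hUa hU ha hZ rfl n) k
  have hqc : (tensor (tensorPow L k) F).IsQuasicoherent := isQuasicoherent_tensor (hL.tensorPow k)
  -- Tensoring with ℓ^k transports the section from F(U), with action multiplied by c_g^k, to L^k ⊗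
  -- F.
  let E : Γ(F, U) ≃ₗ[Γ(X, U)] Γ(tensor (tensorPow L k) F, U) :=
    LinearEquiv.ofBijective ((tensorTwists L F).chart ℓ k) ((tensorTwists L F).bijective hℓ k)
  have hEsymm : ∀ n, E (E.symm n) = n := E.apply_symm_apply
  have hact : ∀ g y, actOn (fun g => tensorOver (ρ g).hom (tensorPowOver (ρ g).hom (φL g) k) (φF g))
      hU g (E y) = E (c g ^ k • actOn φF hU g y) := by
    intro g y
    have h1 : actOn (fun g => tensorOver (ρ g).hom (tensorPowOver (ρ g).hom (φL g) k) (φF g))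
        hU g (tmul (powSec ℓ k) y) = tmul (powSec (actOn φL hU g ℓ) k) (actOn φF hU g y) := by
      refine (pull_tmul _ _ _ _ _).trans ?_
      rw [pull_powSec]
      rfl
    rw [hc, powSec_smul, smul_tmul] at h1
    rw [map_smul]
    exact h1
  have hzero : ∀ y, unitApp i _ U (E y) = 0 ↔
      y ∈ (RingHom.ker (i.app U).hom • ⊤ : Submodule Γ(X, U) Γ(F, U)) := fun y => by
    rw [unit_eq_zero_iff i hUa hVa _ hπ, mem_smul_top_iff_of_equiv]
  refine ⟨(E : Γ(F, U) →+ Γ(tensor (tensorPow L k) F, U)).comp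
    (S.comp (E.symm : Γ(tensor (tensorPow L k) F, U) →+ Γ(F, U))), fun n hn => ?_, fun n => ?_,
    fun b n => ?_, fun g n => ?_, t, fun j => E (v j), fun n => ?_⟩
  · change E (S (E.symm n)) = 0
    rw [hS1 _ ((hzero _).mp (by rw [hEsymm]; exact hn)), map_zero]
  · change unitApp i _ U (E (S (E.symm n))) = _
    rw [← sub_eq_zero, ← map_sub]
    have : E (S (E.symm n)) - n = E (S (E.symm n) - E.symm n) := by rw [map_sub, hEsymm]
    rw [this]
    exact (hzero _).mpr (hS2 _)
  · change E (S (E.symm (baseFun f U b • n))) = baseFun f U b • E (S (E.symm n))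
    rw [map_smul]
    refine (congrArg E (hS3 b (E.symm n))).trans ?_
    exact E.map_smul _ _
  · change E (S (E.symm _)) = actOn _ hU g (E (S (E.symm n)))
    rw [hact]
    have h1 : E.symm (actOn (fun g => tensorOver (ρ g).hom (tensorPowOver (ρ g).hom (φL g) k) (φF g))
        hU g n) = c g ^ k • actOn φF hU g (E.symm n) := by
      rw [LinearEquiv.symm_apply_eq, ← hact, hEsymm]
    rw [h1]
    exact congrArg E (hS4 g (E.symm n))
  · obtain ⟨q, d, hd⟩ := hv (E.symm n)
    refine ⟨q, d, ?_⟩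
    change baseFun f U a ^ q • E (S (E.symm n)) = _
    rw [← map_smul]
    refine (congrArg E hd).trans ?_
    rw [map_sum]
    exact Finset.sum_congr rfl fun j _ => E.map_smul _ _

end ChartSection

/-! ### Multiplication by powers of an invariant section. -/

section TwistMul

variable {X : Scheme.{u}} {L F : X.Modules} {r : ℕ}

/-- The morphism `μ` between twists of `F` is the multiplication by `s ^ q`. -/
def IsTwistMul (s : Γ(tensorPow L r, (⊤ : X.Opens))) (q : ℕ) {k K : ℕ}
    (μ : tensor (tensorPow L k) F ⟶ tensor (tensorPow L K) F) : Prop :=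
  ∀ (V : X.Opens) (ℓ : Γ(L, V)) (c : Γ(X, V)) (f : Γ(F, V)), res le_top s = c • powSec ℓ r →
    μ.app V (tmul (powSec ℓ k) f) = tmul (powSec ℓ K) (c ^ q • f)

lemma exists_isTwistMul (F : X.Modules) (s : Γ(tensorPow L r, (⊤ : X.Opens))) (q : ℕ) {k K : ℕ}
    (hK : K = r * q + k) :
    ∃ μ : tensor (tensorPow L k) F ⟶ tensor (tensorPow L K) F, IsTwistMul s q μ :=
  (tensorTwists L F).exists_isMul s q hK

lemma exists_twistMul_eq_zero [CompactSpace X] [F.IsQuasicoherent] (hL : IsLineBundle L)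
    (s : Γ(tensorPow L r, (⊤ : X.Opens))) {k : ℕ}
    {m : Γ(tensor (tensorPow L k) F, (⊤ : X.Opens))}
    (hm : res (le_top : nonvanishingOpen s ≤ ⊤) m = 0) :
    ∃ n : ℕ, ∀ q : ℕ, n ≤ q → ∀ (K : ℕ)
      (μ : tensor (tensorPow L k) F ⟶ tensor (tensorPow L K) F), IsTwistMul s q μ →
        μ.app ⊤ m = 0 :=
  (tensorTwists L F).exists_mul_eq_zero s hL hm

lemma exists_extend_twistMul [CompactSpace X] [X.IsSeparated] [F.IsQuasicoherent]
    (hL : IsLineBundle L) (s : Γ(tensorPow L r, (⊤ : X.Opens))) {k : ℕ}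
    (m : Γ(tensor (tensorPow L k) F, nonvanishingOpen s)) :
    ∃ n : ℕ, ∀ q : ℕ, n ≤ q → ∀ (K : ℕ)
      (μ : tensor (tensorPow L k) F ⟶ tensor (tensorPow L K) F), K = r * q + k →
        IsTwistMul s q μ → ∃ w : Γ(tensor (tensorPow L K) F, (⊤ : X.Opens)),
          res le_top w = μ.app (nonvanishingOpen s) m :=
  (tensorTwists L F).exists_extend_mul s hL m

lemma exists_tmul_eq {V : X.Opens} {ℓ : Γ(L, V)} (hℓ : IsGenerator ℓ V le_rfl) {k : ℕ}
    (m : Γ(tensor (tensorPow L k) F, V)) : ∃ n : Γ(F, V), tmul (powSec ℓ k) n = m :=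
  ((tensorTwists L F).bijective hℓ k).2 m

/-- On an open subset where `s` does not vanish and `L` is trivial, the multiplication by `s ^ q` is
bijective. -/
lemma IsTwistMul.bijective {s : Γ(tensorPow L r, (⊤ : X.Opens))} {q k K : ℕ}
    {μ : tensor (tensorPow L k) F ⟶ tensor (tensorPow L K) F} (hμ : IsTwistMul s q μ)
    {ℓ : Γ(L, nonvanishingOpen s)} (hℓ : IsGenerator ℓ (nonvanishingOpen s) le_rfl) :
    Function.Bijective (μ.app (nonvanishingOpen s)) := by
  obtain ⟨c, hc⟩ := exists_coord s (hℓ.powSec r)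
  have hcu : IsUnit c := by
    have h1 := basicOpen_eq_inf (hℓ.powSec r) hc
    rw [inf_idem] at h1
    exact isUnit_of_basicOpen_eq h1
  have hb := (tensorTwists L F).bijective hℓ k
  refine (Function.Bijective.of_comp_iff _ hb).mp ?_
  have e : (fun m => μ.app (nonvanishingOpen s) m) ∘ ((tensorTwists L F).chart ℓ k) =
      ((tensorTwists L F).chart ℓ K) ∘ fun n => c ^ q • n :=
    funext fun n => hμ _ ℓ c n hc
  have h2 : Function.Bijective fun n : Γ(F, nonvanishingOpen s) => c ^ q • n := by
    obtain ⟨b, hb⟩ := (hcu.pow q).exists_left_inv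
    refine Function.bijective_iff_has_inverse.mpr ⟨fun n => b • n, fun n => ?_, fun n => ?_⟩
    · change b • c ^ q • n = n
      rw [smul_smul, hb, one_smul]
    · change c ^ q • b • n = n
      rw [smul_smul, mul_comm, hb, one_smul]
  exact e ▸ ((tensorTwists L F).bijective hℓ K).comp h2

variable {G : Type v} [Group G] {ρ : G →* Aut X}

/-- The maps `g^*` on the twists `L^{⊗ k} ⊗ F`. -/
abbrev twistLift (φL : ∀ g, L ⟶ (Scheme.Modules.pushforward (ρ g).hom).obj L)
    (φF : ∀ g, F ⟶ (Scheme.Modules.pushforward (ρ g).hom).obj F) (k : ℕ) (g : G) :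
    tensor (tensorPow L k) F ⟶
      (Scheme.Modules.pushforward (ρ g).hom).obj (tensor (tensorPow L k) F) :=
  tensorOver (ρ g).hom (tensorPowOver (ρ g).hom (φL g) k) (φF g)

lemma pull_twistLift (φL : ∀ g, L ⟶ (Scheme.Modules.pushforward (ρ g).hom).obj L)
    (φF : ∀ g, F ⟶ (Scheme.Modules.pushforward (ρ g).hom).obj F) (k : ℕ) (g : G) {V W : X.Opens}
    (h : W ≤ (ρ g).hom ⁻¹ᵁ V) (ℓ : Γ(L, V)) (n : Γ(F, V)) :
    pull (twistLift φL φF k g) h (tmul (powSec ℓ k) n) =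
      tmul (powSec (pull (φL g) h ℓ) k) (pull (φF g) h n) := by
  refine (pull_tmul _ _ _ _ _).trans ?_
  rw [pull_powSec]

/-- Multiplication by a power of an invariant section is equivariant. -/
lemma IsTwistMul.pull_app (hL : IsLineBundle L) (φL : EquivariantStructure ρ L)
    (φF : ∀ g, F ⟶ (Scheme.Modules.pushforward (ρ g).hom).obj F)
    {s : Γ(tensorPow L r, (⊤ : X.Opens))} (hs : ∀ g, pullPow φL s g = s) {q k K : ℕ}
    {μ : tensor (tensorPow L k) F ⟶ tensor (tensorPow L K) F} (hμ : IsTwistMul s q μ) (g : G)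
    {V W : X.Opens} (h : W ≤ (ρ g).hom ⁻¹ᵁ V) (m : Γ(tensor (tensorPow L k) F, V)) :
    pull (twistLift φL.lift φF K g) h (μ.app V m) =
      μ.app W (pull (twistLift φL.lift φF k g) h m) := by
  refine section_ext fun y hy => ?_
  obtain ⟨V', ℓ, hyV, hℓ⟩ := hL ((ρ g).hom y)
  have hℓ' := hℓ.res (inf_le_left : V' ⊓ V ≤ V')
  have hV : V' ⊓ V ≤ V := inf_le_right
  obtain ⟨n, hn⟩ := exists_tmul_eq hℓ' (res hV m)
  obtain ⟨c, hc⟩ := exists_coord s (hℓ'.powSec r)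
  have hW : W ⊓ (ρ g).hom ⁻¹ᵁ (V' ⊓ V) ≤ (ρ g).hom ⁻¹ᵁ (V' ⊓ V) := inf_le_right
  refine ⟨W ⊓ (ρ g).hom ⁻¹ᵁ (V' ⊓ V), inf_le_left, ⟨hy, hyV, h hy⟩, ?_⟩
  -- By invariance of `s`, the pulled back coordinate is the coordinate of `s` itself with respect
  -- to g^* ℓ.
  have hc' := res_pullPow φL hc g hW
  rw [hs] at hc'
  rw [res_pull, ← app_res, res_pull, ← pull_res (twistLift φL.lift φF K g) hW hV,
    ← pull_res (twistLift φL.lift φF k g) hW hV, ← app_res, ← hn, hμ _ _ _ _ hc, pull_twistLift,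
    pull_twistLift, hμ _ _ _ _ hc', pull_smul, map_pow]

variable {R : Type u} [CommRing R] {f : X ⟶ Spec (.of R)}

/-- The kernel of the restriction to `X_s` on a finitely generated submodule is killed by a power
of `s`. -/
lemma exists_twistMul_eq_zero_of_fg [IsNoetherianRing R] [CompactSpace X] [F.IsQuasicoherent]
    (hL : IsLineBundle L) (s : Γ(tensorPow L r, (⊤ : X.Opens))) {k : ℕ}
    {W : Submodule R (H0 f (tensor (tensorPow L k) F))} (hW : W.FG) :
    ∃ n : ℕ, ∀ q : ℕ, n ≤ q → ∀ (K : ℕ)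
      (μ : tensor (tensorPow L k) F ⟶ tensor (tensorPow L K) F), IsTwistMul s q μ →
        ∀ y ∈ W, res (M := tensor (tensorPow L k) F) (le_top : nonvanishingOpen s ≤ ⊤) y = 0 →
          μ.app ⊤ y = 0 := by
  let r₀ := res (M := tensor (tensorPow L k) F) (le_top : nonvanishingOpen s ≤ ⊤)
  let Ke : Submodule R (H0 f (tensor (tensorPow L k) F)) :=
    { carrier := {y | r₀ y = 0}
      add_mem' := fun {y z} hy hz =>
        (map_add r₀ y z).trans ((congrArg₂ (· + ·) hy hz).trans (add_zero _))
      zero_mem' := map_zero r₀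
      smul_mem' := fun b y hy => (res_smul_H0 (U := nonvanishingOpen s) b y).trans
        ((congrArg (baseFun f _ b • ·) hy).trans (smul_zero _)) }
  -- Since R is noetherian, the part of `W` vanishing on X_s is finitely generated, so a single
  -- exponent suffices.
  have hfg : (W ⊓ Ke).FG := by
    have : IsNoetherian R W := isNoetherian_of_fg_of_noetherian W hW
    exact (isNoetherian_submodule.mp this) _ inf_le_left
  obtain ⟨v, hv⟩ := hfg
  have hvK : ∀ y ∈ v, res (M := tensor (tensorPow L k) F) (le_top : nonvanishingOpen s ≤ ⊤) y = 0 :=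
    fun y hy => ((hv ▸ Submodule.subset_span hy : y ∈ W ⊓ Ke)).2
  choose! n hn using fun y (hy : y ∈ v) => exists_twistMul_eq_zero hL s (hvK y hy)
  refine ⟨v.sup n, fun q hq K μ hμ y hyW hy => ?_⟩
  let Kμ : Submodule R (H0 f (tensor (tensorPow L k) F)) :=
    { carrier := {y | μ.app ⊤ y = 0}
      add_mem' := fun {y z} hy hz =>
        (map_add (μ.app ⊤).hom y z).trans ((congrArg₂ (· + ·) hy hz).trans (add_zero _))
      zero_mem' := map_zero (μ.app ⊤).hom
      smul_mem' := fun b y hy => (Scheme.Modules.Hom.app_smul μ (baseHom f b) y).trans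
        ((congrArg (baseHom f b • ·) hy).trans (smul_zero _)) }
  have hle : W ⊓ Ke ≤ Kμ := by
    rw [← hv, Submodule.span_le]
    exact fun z hz => hn z hz q ((Finset.le_sup hz).trans hq) K μ hμ
  exact hle ⟨hyW, hy⟩

end TwistMul

/-! ### Comparing sections on the chart, on X and on Z. -/

section LocalLift

variable {X Z : Scheme.{u}}

/-- Both kernels are multiples by the ideal of Z, which a linear bijection matches. -/
lemma unitApp_app_eq_zero_iff (i : Z ⟶ X) [IsClosedImmersion i] {U : X.Opens} (hU : IsAffineOpen U)
    {N N' : X.Modules} [N.IsQuasicoherent] [N'.IsQuasicoherent] (μ : N ⟶ N')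
    (hμ : Function.Bijective (μ.app U)) (n : Γ(N, U)) :
    unitApp i N' U (μ.app U n) = 0 ↔ unitApp i N U n = 0 := by
  have hs : Function.Surjective (i.app U) := i.app_surjective U hU
  have hZ : IsAffineOpen (i ⁻¹ᵁ U) := hU.preimage i
  let e : Γ(N, U) ≃ₗ[Γ(X, U)] Γ(N', U) := LinearEquiv.ofBijective
    { toFun := μ.app U
      map_add' := map_add (μ.app U).hom
      map_smul' := fun b y => Scheme.Modules.Hom.app_smul μ b y } hμ
  rw [unit_eq_zero_iff i hU hZ N hs, unit_eq_zero_iff i hU hZ N' hs]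
  exact mem_smul_top_iff_of_equiv e _ n

variable {R : Type u} [CommRing R] {f : X ⟶ Spec (.of R)} {G : Type v} [Group G] {ρ : G →* Aut X}

lemma res_act (hρ : ∀ g, (ρ g).hom ≫ f = f) {N : X.Modules}
    (φ : ∀ g, N ⟶ (Scheme.Modules.pushforward (ρ g).hom).obj N) {U : X.Opens}
    (hU : ∀ g, U ≤ (ρ g).hom ⁻¹ᵁ U) (g : G) (w : H0 f N) :
    res (M := N) (le_top : U ≤ ⊤) (act hρ φ g w) = actOn φ hU g (res (M := N) le_top w) :=
  (pull_res (φ g⁻¹) (hU g⁻¹) le_top w).symm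

lemma IsTwistMul.act_app {L F : X.Modules} {r : ℕ} (hρ : ∀ g, (ρ g).hom ≫ f = f)
    (hL : IsLineBundle L) (φL : EquivariantStructure ρ L)
    (φF : ∀ g, F ⟶ (Scheme.Modules.pushforward (ρ g).hom).obj F)
    {s : Γ(tensorPow L r, (⊤ : X.Opens))} (hs : ∀ g, pullPow φL s g = s) {q k K : ℕ}
    {μ : tensor (tensorPow L k) F ⟶ tensor (tensorPow L K) F} (hμ : IsTwistMul s q μ) (g : G)
    (y : H0 f (tensor (tensorPow L k) F)) :
    act hρ (twistLift φL.lift φF K) g (μ.app ⊤ y : Γ(tensor (tensorPow L K) F, ⊤)) =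
      (μ.app ⊤ (act hρ (twistLift φL.lift φF k) g y) : Γ(tensor (tensorPow L K) F, ⊤)) := by
  have h1 := hμ.pull_app hL φL φF hs g⁻¹ (top_le_preimage _) y
  have h2 : pull (twistLift φL.lift φF K g⁻¹) (top_le_preimage (ρ g⁻¹).hom) (μ.app ⊤ y) =
    act hρ (twistLift φL.lift φF K) g (μ.app ⊤ y : Γ(tensor (tensorPow L K) F, ⊤)) :=
    pull_le_rfl _ _
  have h3 : pull (twistLift φL.lift φF k g⁻¹) (top_le_preimage (ρ g⁻¹).hom) y =
    act hρ (twistLift φL.lift φF k) g y := pull_le_rfl _ _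
  rw [← h2, h1, h3]

/-- A global section whose restriction to `Z` agrees with `t` where `a` is invertible restricts to
`t` after multiplication by a power of `a`. -/
lemma exists_restrictSections_eq (i : Z ⟶ X) [IsAffine Z] {N : X.Modules} [N.IsQuasicoherent]
    {U : X.Opens} {a : R} (hZ : i ⁻¹ᵁ U = Z.basicOpen (baseHom (i ≫ f) a)) {w : H0 f N}
    {t : H0 (i ≫ f) ((Scheme.Modules.pullback i).obj N)}
    (h : unitApp i N U (res (M := N) le_top w) =
      res (M := (Scheme.Modules.pullback i).obj N) le_top t) :
    ∃ e : ℕ, restrictSections f i N (a ^ e • w) = a ^ e • t := by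
  have h1 : res (M := (Scheme.Modules.pullback i).obj N) (le_top : i ⁻¹ᵁ U ≤ ⊤)
      (restrictSections f i N w - t) = 0 := by
    refine (map_sub (res (M := (Scheme.Modules.pullback i).obj N) (le_top : i ⁻¹ᵁ U ≤ ⊤))
      (restrictSections f i N w) t).trans (sub_eq_zero.mpr ?_)
    exact (res_unitApp i N le_top w).trans h
  obtain ⟨e, he⟩ := exists_pow_smul_eq_zero_of_eq_basicOpen hZ h1
  refine ⟨e, ?_⟩
  rw [map_smul, ← sub_eq_zero, ← smul_sub]
  have h2 : (a ^ e • (restrictSections f i N w - t) :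
        H0 (i ≫ f) ((Scheme.Modules.pullback i).obj N)) =
      (baseHom (i ≫ f) (a ^ e) •
        (show Γ((Scheme.Modules.pullback i).obj N, ⊤) from restrictSections f i N w - t) :
          Γ((Scheme.Modules.pullback i).obj N, ⊤)) := rfl
  rw [h2, map_pow]
  exact he

end LocalLift

/-! ### Lifting eigensections on one chart. -/

section ChartLift

variable {R : Type u} [CommRing R] {X : Scheme.{u}} {f : X ⟶ Spec (.of R)}
  {G : Type v} [Group G] {ρ : G →* Aut X} {m : ℕ} {x : Fin m → (Spec (.of R) ⟶ X)}
  {σ : G → (pointsScheme R m ⟶ pointsScheme R m)}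

/-- On the chart given by an invariant section `s`, eigensections over `Z` of high twists of `F` lift
to global eigensections, up to a power of `a`. -/
theorem exists_eigenSection_of_chart [IsNoetherianRing R] [Finite G] [LocallyOfFiniteType f]
    [CompactSpace X] [X.IsSeparated] [IsClosedImmersion (pointsι x)] (hx : ∀ j, x j ≫ f = 𝟙 _)
    (hρ : ∀ g, (ρ g).hom ≫ f = f) (hσ : ∀ g, σ g ≫ pointsι x = pointsι x ≫ (ρ g).hom)
    {L F : X.Modules} (hL : IsLineBundle L) [F.IsQuasicoherent] [F.IsFiniteType]
    (φL : EquivariantStructure ρ L)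
    {φF : ∀ g, F ⟶ (Scheme.Modules.pushforward (ρ g).hom).obj F}
    (hsL : HasEquivariantSplitting hρ hσ φL.lift) (hsF : HasEquivariantSplitting hρ hσ φF)
    {r : ℕ} {s : Γ(tensorPow L r, (⊤ : X.Opens))} (hs : ∀ g, pullPow φL s g = s)
    (hUa : IsAffineOpen (nonvanishingOpen s)) {ℓ : Γ(L, nonvanishingOpen s)}
    (hℓ : IsGenerator ℓ (nonvanishingOpen s) le_rfl) {a : R}
    (ha : IsUnit (baseFun f (nonvanishingOpen s) a))
    (hZ : pointsι x ⁻¹ᵁ nonvanishingOpen s =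
      (pointsScheme R m).basicOpen (baseHom (pointsι x ≫ f) a)) (k₀ : ℕ) :
    ∃ q₁ : ℕ, ∀ q : ℕ, q₁ ≤ q → ∀ k : ℕ, k = r * q + k₀ → ∀ ψ : G →* Rˣ,
      ∀ t ∈ eigenSections (comp_base hρ hσ)
        (fun g => pullbackOver (hσ g) (twistLift φL.lift φF k g)) ψ,
      ∃ (e : ℕ), ∃ w ∈ eigenSections hρ (twistLift φL.lift φF k) ψ,
        restrictSections f (pointsι x) _ w = a ^ e • t := by
  have hU : ∀ g, nonvanishingOpen s ≤ (ρ g).hom ⁻¹ᵁ nonvanishingOpen s := fun g =>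
    (preimage_nonvanishing_of_invariant φL hL hs g).ge
  have hqc : ∀ k, (tensor (tensorPow L k) F).IsQuasicoherent := fun k =>
    isQuasicoherent_tensor (hL.tensorPow k)
  set U := nonvanishingOpen s with hUdef
  set i := pointsι x with hi
  obtain ⟨S, hS0, hS, hSb, hSG, b, v, hv⟩ :=
    exists_section_of_chart hx hρ hσ hL hsL hsF hUa hU hℓ ha hZ k₀
  -- One power q₀ of `s` extends all of the finitely many `v j` to X.
  choose n hn using fun j => exists_extend_twistMul (F := F) hL s (v j)
  set q₀ := Finset.univ.sup n with hq₀
  obtain ⟨K, hK⟩ : ∃ K, K = r * q₀ + k₀ := ⟨_, rfl⟩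
  obtain ⟨μ₀, hμ₀⟩ := exists_isTwistMul F s q₀ hK
  have hw : ∀ j, ∃ y : H0 f (tensor (tensorPow L K) F),
      res (M := tensor (tensorPow L K) F) (le_top : U ≤ ⊤) y = μ₀.app U (v j) := fun j =>
    hn j q₀ (Finset.le_sup (Finset.mem_univ j)) K μ₀ hK hμ₀
  choose w hw using hw
  let A : G → H0 f (tensor (tensorPow L K) F) →ₗ[R] H0 f (tensor (tensorPow L K) F) :=
    act hρ (twistLift φL.lift φF K)
  -- `W` contains the extensions and their translates, hence g w₀ - ψ(g) w₀ for every character ψ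
  -- and every combination w₀ of the `w j`. So `q'` does not depend on ψ or `t`.
  let W : Submodule R (H0 f (tensor (tensorPow L K) F)) :=
    Submodule.span R (Set.range w ∪ Set.range fun p : G × Fin b => A p.1 (w p.2))
  have hW : W.FG := Submodule.fg_span ((Set.finite_range w).union (Set.finite_range _))
  obtain ⟨q', hq'⟩ := exists_twistMul_eq_zero_of_fg hL s hW
  refine ⟨q₀ + q', fun q hq k hk ψ t ht => ?_⟩
  obtain ⟨p, rfl⟩ := Nat.exists_eq_add_of_le ((Nat.le_add_right q₀ q').trans hq)
  obtain ⟨μ', hμ'⟩ := exists_isTwistMul F s p (show k = r * p + K by rw [hk, hK]; ring)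
  -- On U the section `t` is represented by s^p s^q₀ n₃, because powers of `s` act bijectively
  -- there.
  obtain ⟨n₁, hn₁⟩ := unit_surjective i hUa (hUa.preimage i) (tensor (tensorPow L k) F)
    (i.app_surjective U hUa)
    (res (M := (Scheme.Modules.pullback i).obj (tensor (tensorPow L k) F)) le_top t)
  obtain ⟨n₂, rfl⟩ := (hμ'.bijective hℓ).2 n₁
  obtain ⟨n₃, rfl⟩ := (hμ₀.bijective hℓ).2 n₂
  have hact : ∀ g y, actOn (twistLift φL.lift φF k) hU g (μ'.app U (μ₀.app U y)) =
      μ'.app U (μ₀.app U (actOn (twistLift φL.lift φF k₀) hU g y)) := fun g y =>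
    (hμ'.pull_app hL φL φF hs _ _ _).trans
      (congrArg (μ'.app U) (hμ₀.pull_app hL φL φF hs _ _ _))
  have hbase : ∀ (c : R) y, μ'.app U (μ₀.app U (baseFun f U c • y)) =
      baseFun f U c • μ'.app U (μ₀.app U y) := fun c y =>
    (congrArg (μ'.app U) (Scheme.Modules.Hom.app_smul μ₀ _ _)).trans
      (Scheme.Modules.Hom.app_smul μ' _ _)
  have hsub : ∀ y y', μ'.app U (μ₀.app U (y - y')) =
      μ'.app U (μ₀.app U y) - μ'.app U (μ₀.app U y') := fun y y' =>
    (congrArg (μ'.app U) (map_sub (μ₀.app U).hom y y')).trans (map_sub (μ'.app U).hom _ _)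
  have hz : ∀ y, unitApp i _ U (μ'.app U (μ₀.app U y)) = 0 ↔ unitApp i _ U y = 0 := fun y =>
    (unitApp_app_eq_zero_iff i hUa μ' (hμ'.bijective hℓ) _).trans
      (unitApp_app_eq_zero_iff i hUa μ₀ (hμ₀.bijective hℓ) y)
  -- `t` is an eigensection, so g n₃ - ψ(g) n₃ restricts to zero on Z, and `S` kills it.
  have heig : ∀ g, S (actOn (twistLift φL.lift φF k₀) hU g n₃) =
      baseFun f U (ψ g : R) • S n₃ := by
    intro g
    rw [← hSb, ← sub_eq_zero, ← map_sub]
    refine hS0 _ ((hz _).mp ?_)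
    rw [hsub, ← hact, hbase, map_sub, unitApp_baseFun_smul (f := f) i hn₁,
      unitApp_actOn i hσ (comp_base hρ hσ) hU g hn₁, ht g, sub_self]
  obtain ⟨e, d, hd⟩ := hv n₃
  let w₀ : H0 f (tensor (tensorPow L K) F) := ∑ j, d j • w j
  have hw₀W : w₀ ∈ W := Submodule.sum_mem _ fun j _ =>
    Submodule.smul_mem _ _ (Submodule.subset_span (Or.inl ⟨j, rfl⟩))
  have hAw₀W : ∀ g, A g w₀ ∈ W := fun g => by
    rw [map_sum]
    refine Submodule.sum_mem _ fun j _ => ?_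
    rw [map_smul]
    exact Submodule.smul_mem _ _ (Submodule.subset_span (Or.inr ⟨(g, j), rfl⟩))
  have hw₀ : res (M := tensor (tensorPow L K) F) (le_top : U ≤ ⊤) w₀ =
      μ₀.app U (baseFun f U a ^ e • S n₃) := by
    rw [hd]
    refine (map_sum (res (M := tensor (tensorPow L K) F) (le_top : U ≤ ⊤)) _ _).trans ?_
    refine Eq.trans ?_ (map_sum (μ₀.app U).hom _ _).symm
    refine Finset.sum_congr rfl fun j _ => (res_smul_H0 (f := f) _ _).trans ?_
    refine (congrArg (baseFun f U (d j) • ·) (hw j)).trans ?_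
    exact (Scheme.Modules.Hom.app_smul μ₀ _ _).symm
  -- `w₀` extends a^e s^q₀ S(n₃), so its defect g w₀ - ψ(g) w₀ vanishes on X_s; as p ≥ q',
  -- multiplication by s^p removes it on X.
  let w₁ : H0 f (tensor (tensorPow L k) F) := μ'.app ⊤ w₀
  have hw₁ : w₁ ∈ eigenSections hρ (twistLift φL.lift φF k) ψ := by
    intro g
    have h1 : act hρ (twistLift φL.lift φF k) g w₁ = μ'.app ⊤ (A g w₀) :=
      hμ'.act_app hρ hL φL φF hs g w₀
    have h2 : ((ψ g : R) • w₁ : H0 f (tensor (tensorPow L k) F)) =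
        μ'.app ⊤ ((ψ g : R) • w₀ : H0 f (tensor (tensorPow L K) F)) :=
      (Scheme.Modules.Hom.app_smul μ' (baseHom f (ψ g : R)) w₀).symm
    refine h1.trans (Eq.trans ?_ h2.symm)
    refine sub_eq_zero.mp
      ((map_sub (μ'.app ⊤).hom (A g w₀) ((ψ g : R) • w₀ : H0 f _)).symm.trans ?_)
    refine hq' p (by omega) k μ' hμ' _ (W.sub_mem (hAw₀W g) (W.smul_mem _ hw₀W)) ?_
    refine (map_sub (res (M := tensor (tensorPow L K) F) (le_top : U ≤ ⊤)) (A g w₀)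
      ((ψ g : R) • w₀ : H0 f _)).trans (sub_eq_zero.mpr ?_)
    refine (res_act hρ _ hU g w₀).trans (Eq.trans ?_ (res_smul_H0 (f := f) _ _).symm)
    rw [hw₀]
    refine (hμ₀.pull_app hL φL φF hs g⁻¹ (hU g⁻¹) _).trans ?_
    refine Eq.trans ?_ (Scheme.Modules.Hom.app_smul μ₀ _ _)
    refine congrArg (μ₀.app U) ?_
    refine (actOn_baseFun_pow_smul hρ hU g a e _).trans ?_
    rw [← hSG, heig, smul_comm]
  have hw₁t : unitApp i _ U (res (M := tensor (tensorPow L k) F) le_top w₁) =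
      res (M := (Scheme.Modules.pullback i).obj (tensor (tensorPow L k) F)) le_top
        (a ^ e • t) := by
    have h1 : res (M := tensor (tensorPow L k) F) (le_top : U ≤ ⊤) w₁ =
        baseFun f U (a ^ e) • μ'.app U (μ₀.app U (S n₃)) := by
      refine (app_res μ' le_top w₀).symm.trans ?_
      rw [hw₀, ← map_pow, hbase]
    rw [h1]
    refine unitApp_baseFun_smul (f := f) i ?_ (a ^ e)
    rw [← hn₁, ← sub_eq_zero, ← map_sub, ← hsub, hz, map_sub, hS, sub_self]
  -- The restriction agrees with a^e t on Z ∩ U; a further power of `a` gives equality on all of Z.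
  obtain ⟨e', he'⟩ := exists_restrictSections_eq (f := f) i hZ hw₁t
  exact ⟨e' + e, a ^ e' • w₁, Submodule.smul_mem _ _ hw₁, by rw [he', smul_smul, pow_add]⟩

end ChartLift

/-! ### All large twists, locally on Spec R, and descent to R. -/

section Global

variable {R : Type u} [CommRing R] {X : Scheme.{u}} {f : X ⟶ Spec (.of R)}
  {G : Type v} [Group G] {ρ : G →* Aut X} {m : ℕ} {x : Fin m → (Spec (.of R) ⟶ X)}
  {σ : G → (pointsScheme R m ⟶ pointsScheme R m)}

/-- Near every point of `Spec R`, eigensections over `Z` of high twists of `F` lift to global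
eigensections. -/
theorem exists_eigenSection_locally [IsNoetherianRing R] [Finite G] (hf : IsProjective f)
    (hρ : ∀ g, (ρ g).hom ≫ f = f) (hx : ∀ j, x j ≫ f = 𝟙 _)
    (hdisj : Pairwise fun j j' => Disjoint (Set.range (x j)) (Set.range (x j')))
    (hσ : ∀ g, σ g ≫ pointsι x = pointsι x ≫ (ρ g).hom)
    {L F : X.Modules} (hL : IsAmple L) [F.IsQuasicoherent] [F.IsFiniteType]
    (φL : EquivariantStructure ρ L)
    {φF : ∀ g, F ⟶ (Scheme.Modules.pushforward (ρ g).hom).obj F}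
    (hsL : HasEquivariantSplitting hρ hσ φL.lift) (hsF : HasEquivariantSplitting hρ hσ φF)
    (p : PrimeSpectrum R) :
    ∃ a ∉ p.asIdeal, ∃ k₀ : ℕ, ∀ k : ℕ, k₀ ≤ k → ∀ ψ : G →* Rˣ,
      ∀ t ∈ eigenSections (comp_base hρ hσ)
        (fun g => pullbackOver (hσ g) (twistLift φL.lift φF k g)) ψ,
      ∃ (e : ℕ), ∃ w ∈ eigenSections hρ (twistLift φL.lift φF k) ψ,
        restrictSections f (pointsι x) _ w = a ^ e • t := by
  have := hL.compactSpace
  have := isSeparated_of_isProjective hf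
  have := hf.isSeparated
  have := hf.locallyOfFiniteType
  have := isClosedImmersion_pointsι hx hdisj
  obtain ⟨a, r, s, hpa, hr, hs, hUa, ⟨ℓ, hℓ⟩, ha, hZ⟩ :=
    exists_chart hf ρ hρ hx hdisj σ hσ hL φL p
  choose q₁ hq₁ using fun k₀ =>
    exists_eigenSection_of_chart hx hρ hσ hL.isLineBundle φL hsL hsF hs hUa hℓ ha hZ k₀
  -- With k = r (k / r) + k % r, this bound makes the exponent k / r large enough for every residue
  -- class modulo r.
  refine ⟨a, hpa, r * (Finset.range r).sup q₁, fun k hk => ?_⟩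
  refine hq₁ (k % r) (k / r) ?_ k (Nat.div_add_mod k r).symm
  refine (Finset.le_sup (Finset.mem_range.mpr (Nat.mod_lt k (Nat.pos_of_ne_zero hr)))).trans ?_
  rw [Nat.le_div_iff_mul_le (Nat.pos_of_ne_zero hr), mul_comm]
  exact hk

end Global

/-- A submodule that contains a power of `a` times `t` for all `a` in a set generating the unit ideal
contains `t`. -/
lemma mem_of_pow_smul_mem {R M : Type*} [CommRing R] [AddCommGroup M] [Module R M]
    (N : Submodule R M) (t : M) {s : Set R} (hs : Ideal.span s = ⊤)
    (h : ∀ a ∈ s, ∃ e : ℕ, a ^ e • t ∈ N) : t ∈ N := by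
  let J : Ideal R := N.comap (LinearMap.toSpanSingleton R M t)
  have h1 : J.radical = ⊤ := by
    rw [eq_top_iff, ← hs, Ideal.span_le]
    exact h
  have h2 : (1 : R) ∈ J := by
    rw [Ideal.radical_eq_top.mp h1]
    trivial
  have h3 : (1 : R) • t ∈ N := h2
  rwa [one_smul] at h3

end EquivSurj

end

theorem mainTheorem8 {R : Type u} [CommRing R] [IsNoetherianRing R]
    {X : Scheme.{u}} (f : X ⟶ Spec (.of R)) (hf : IsProjective f)
    {G : Type v} [Group G] [Finite G]
    -- `G` acts on `X` over `R`
    (ρ : G →* Aut X) (hρ : ∀ g, (ρ g).hom ≫ f = f)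
    -- `Z` is the union of the pairwise disjoint `R`-points `x j`, and it is `G`-stable
    {m : ℕ} (x : Fin m → (Spec (.of R) ⟶ X)) (hx : ∀ j, x j ≫ f = 𝟙 _)
    (hdisj : Pairwise fun j j' => Disjoint (Set.range (x j)) (Set.range (x j')))
    (σ : G → (pointsScheme R m ⟶ pointsScheme R m))
    (hσ : ∀ g, σ g ≫ pointsι x = pointsι x ≫ (ρ g).hom)
    (L : X.Modules) (hL : IsAmple L) (φL : EquivariantStructure ρ L)
    (F : X.Modules) [F.IsQuasicoherent] [F.IsFiniteType] (φF : EquivariantStructure ρ F)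
    (hsF : HasEquivariantSplitting hρ hσ φF.lift)
    (hsL : HasEquivariantSplitting hρ hσ φL.lift) :
    ∃ k₀ : ℕ, 0 < k₀ ∧ ∀ k : ℕ, k₀ ≤ k → ∀ ψ : G →* Rˣ,
      Function.Surjective
        (restrictEigenSections (M := tensor (tensorPow L k) F) hρ hσ
          (fun g => tensorOver (ρ g).hom (tensorPowOver (ρ g).hom (φL.lift g) k) (φF.lift g))
          ψ) := by
  -- The elements of R up to powers of which all eigensections lift, for all large k. By the local
  -- result no maximal ideal contains all of them.
  let T : Set R := {a | ∃ k₀ : ℕ, ∀ k : ℕ, k₀ ≤ k → ∀ ψ : G →* Rˣ,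
    ∀ t ∈ eigenSections (comp_base hρ hσ)
      (fun g => pullbackOver (hσ g) (twistLift φL.lift φF.lift k g)) ψ,
    ∃ (e : ℕ), ∃ w ∈ eigenSections hρ (twistLift φL.lift φF.lift k) ψ,
      restrictSections f (pointsι x) _ w = a ^ e • t}
  have hT : Ideal.span T = ⊤ := by
    by_contra hne
    obtain ⟨P, hP, hle⟩ := Ideal.exists_le_maximal _ hne
    obtain ⟨a, ha, k₀, hk₀⟩ := exists_eigenSection_locally hf hρ hx hdisj hσ hL φL hsL hsF
      ⟨P, hP.isPrime⟩
    exact ha (hle (Ideal.subset_span ⟨k₀, hk₀⟩))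
  obtain ⟨T', hT', hspan⟩ := (Ideal.span_eq_top_iff_finite T).mp hT
  choose! κ hκ using fun a (ha : a ∈ T') => hT' ha
  -- Finitely many elements of `T` suffice for the unit ideal, which gives a common bound; the `+ 1`
  -- makes it positive.
  refine ⟨T'.sup κ + 1, Nat.succ_pos _, fun k hk ψ t => ?_⟩
  refine LinearMap.mem_range.mp (mem_of_pow_smul_mem _ t hspan fun a ha => ?_)
  obtain ⟨e, w, hw, h⟩ := hκ a ha k ((Finset.le_sup ha).trans ((Nat.le_succ _).trans hk)) ψ t.1 t.2
  exact ⟨e, ⟨w, hw⟩, Subtype.ext h⟩
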